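/- Let $W\ge 0$ and $k\ge 1$ be integers. A *partition* is a vector $P=[p_1,\dots,p_k]$ of non-negative integers with $\sum_i p_i=2^W$. A *transaction* is either $[i\to_\ell j]$ with $i\ne j$ and $\ell\ge 0$, which replaces $p_i$ by $p_i-2^\ell$ and $p_j$ by $p_j+2^\ell$, or the final dummy transaction $[j\to_W\bot]$, which replaces $p_j$ by $p_j-2^W$. A sequence of transactions *induces* $P$ if applying it to $P$ makes all weights zero (intermediate weights may be negative). The *complexity* $\lambda(P)$ is the length of a shortest sequence that induces $P$ (it is the smallest number of rules of a longest-prefix-match TCAM of width $W$ realizing $P$). Let $L_\infty(P',P)=\max_i|p'_i-p_i|$. * *Bounded-error problem for $L_\infty$*: given a partition $P$ and a real $e>0$, find a partition $P'$ with $L_\infty(P',P)<e$ that minimizes $\lambda(P')$. (As $L_\infty$ is integer-valued, only $\lceil e\rceil$ matters; it is what the machine receives.) * *Bounded-length problem for $L_\infty$*: given a partition $P$ and an integer $n\ge 1$, find a partition $P'$ with $\lambda(P')\le n$ that minimizes $L_\infty(P',P)$. The machine is a word RAM: words are integers in $[0,2^b)$; arithmetic ($+,-,\times$), bitwise and, or,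 xor, shifts, the index of the highest set bit, comparisons, memory accesses and procedure calls take one step each. The word length $b$ may be any integer with $2^b\ge c\,(2^W+k)$ for a constant $c$ (so words of $\max(W,\lg k)+O(1)$ bits suffice) such that the input number $\lceil e\rceil$ or $n$ fits in a word. **Theorem.** On this machine: 1. there is a single program, with absolute constants $c$ and $C$, that solves the bounded-error problem for $L_\infty$ on every input in at most $C\cdot k$ steps, i.e. in $O(k)$ time; 2. there is a single program, with absolute constants $c$ and $C$, that solves the bounded-length problem for $L_\infty$ on every input with $W\ge 1$ in at most $C\cdot W\cdot\min(W k,\;k+n\lg k)$ steps, i.e. in $O(W\cdot T)$ time with $T=O(\min(Wk,\,k+n\lg k))$, where $\lg=\log_2$. -/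

import Mathlib

namespace TrafficSplit

/-! ### Partitions, transactions, complexity -/

/-- A partition of `2 ^ W` into `k` non-negative integer parts. -/
def IsPartition {k : ℕ} (W : ℕ) (P : Fin k → ℕ) : Prop :=
  ∑ i, P i = 2 ^ W

/-- A transaction on `k` weights at width `W`: either `[i →_ℓ j]` with `i ≠ j`, which moves `2 ^ ℓ`
from weight `i` to weight `j`, or the dummy transaction `[j →_W ⊥]`, which removes `2 ^ W` from
weight `j`. -/
inductive Transaction (k : ℕ) : Type
  | move (i j : Fin k) (hij : i ≠ j) (l : ℕ) : Transaction k
  | toBot (j : Fin k) : Transaction k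

/-- Applying one transaction to a vector of weights. Intermediate weights may be negative. -/
def Transaction.apply {k : ℕ} (W : ℕ) (X : Fin k → ℤ) : Transaction k → (Fin k → ℤ)
  | .move i j _ l => X - Pi.single i (2 ^ l) + Pi.single j (2 ^ l)
  | .toBot j => X - Pi.single j (2 ^ W)

/-- The sequence `s` induces `P`: applying all of `s` to `P` makes every weight zero. A move keeps
the sum of the weights and a dummy transaction lowers it by `2 ^ W`, so a sequence that induces a
partition contains exactly one dummy transaction. -/
def Induces {k : ℕ} (W : ℕ) (s : List (Transaction k)) (P : Fin k → ℕ) : Prop :=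
  s.foldl (Transaction.apply W) (fun i => (P i : ℤ)) = 0

/-- The complexity `λ(P)`: the length of a shortest sequence that induces `P`
(every partition is induced by some sequence). -/
noncomputable def complexity {k : ℕ} (W : ℕ) (P : Fin k → ℕ) : ℕ :=
  sInf {m | ∃ s : List (Transaction k), Induces W s P ∧ s.length = m}

/-- The set `Λ_n` of all partitions of complexity at most `n`. -/
def Lam (k W n : ℕ) : Set (Fin k → ℕ) :=
  {P | IsPartition W P ∧ complexity W P ≤ n}

/-- The distance `L_∞(P', P) = max_i |p'_i - p_i|`. -/
def linftyDist {k : ℕ} (P' P : Fin k → ℕ) : ℕ :=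
  Finset.univ.sup fun i => ((P' i : ℤ) - (P i : ℤ)).natAbs

/-- The open ball `B_e(P)`: all partitions at distance less than `e` from `P`. -/
def openBall {k : ℕ} (W : ℕ) (P : Fin k → ℕ) (e : ℝ) : Set (Fin k → ℕ) :=
  {P' | IsPartition W P' ∧ (linftyDist P' P : ℝ) < e}

/-- `P'` is a correct answer to the bounded-error approximation problem `(P, e)`. -/
def SolvesBoundedError {k : ℕ} (W : ℕ) (P : Fin k → ℕ) (e : ℝ) (P' : Fin k → ℕ) : Prop :=
  P' ∈ openBall W P e ∧ ∀ Q ∈ openBall W P e, complexity W P' ≤ complexity W Q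

/-- `P'` is a correct answer to the bounded-length approximation problem `(P, n)`. -/
def SolvesBoundedLength {k : ℕ} (W : ℕ) (P : Fin k → ℕ) (n : ℕ) (P' : Fin k → ℕ) : Prop :=
  P' ∈ Lam k W n ∧ ∀ Q ∈ Lam k W n, linftyDist P' P ≤ linftyDist Q P

/-! ### The word RAM

Words are natural numbers below `2 ^ b`; every operation is reduced modulo `2 ^ b`. A program uses
finitely many registers and a random access memory whose cells are addressed by words. -/

/-- Binary word operations. -/
inductive BinOp : Type
  | add | sub | mul | and | or | xor | shl | shr

/-- The value of a binary operation on `b`-bit words. -/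
def BinOp.eval (b : ℕ) : BinOp → ℕ → ℕ → ℕ
  | .add, x, y => (x + y) % 2 ^ b
  | .sub, x, y => (x + (2 ^ b - y)) % 2 ^ b
  | .mul, x, y => (x * y) % 2 ^ b
  | .and, x, y => (x &&& y) % 2 ^ b
  | .or, x, y => (x ||| y) % 2 ^ b
  | .xor, x, y => (x ^^^ y) % 2 ^ b
  | .shl, x, y => (x <<< y) % 2 ^ b
  | .shr, x, y => (x >>> y) % 2 ^ b

/-- Comparisons of words. -/
inductive Cmp : Type
  | lt | le | eq | ne

/-- The meaning of a comparison. -/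
def Cmp.Holds : Cmp → ℕ → ℕ → Prop
  | .lt, x, y => x < y
  | .le, x, y => x ≤ y
  | .eq, x, y => x = y
  | .ne, x, y => x ≠ y

/-- Commands. The natural number arguments are register names, except for the literal `v` in
`const d v` and the procedure number `p` in `call p`. -/
inductive Cmd : Type
  /-- do nothing -/
  | skip : Cmd
  /-- `r_d := v` -/
  | const (d v : ℕ) : Cmd
  /-- `r_d := r_x` -/
  | copy (d x : ℕ) : Cmd
  /-- `r_d := r_x op r_y` -/
  | binop (op : BinOp) (d x y : ℕ) : Cmd
  /-- `r_d :=` index of the highest set bit of `r_x` (`0` if `r_x = 0`) -/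
  | log2 (d x : ℕ) : Cmd
  /-- `r_d := memory[r_x]` -/
  | load (d x : ℕ) : Cmd
  /-- `memory[r_x] := r_y` -/
  | store (x y : ℕ) : Cmd
  /-- first `c₁`, then `c₂` -/
  | seq (c₁ c₂ : Cmd) : Cmd
  /-- if `r_x cmp r_y` then `c₁` else `c₂` -/
  | cond (cmp : Cmp) (x y : ℕ) (c₁ c₂ : Cmd) : Cmd
  /-- while `r_x cmp r_y` do `c` -/
  | loop (cmp : Cmp) (x y : ℕ) (c : Cmd) : Cmd
  /-- run procedure number `p` of the program; registers and memory are global -/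
  | call (p : ℕ) : Cmd

/-- A machine state: registers and memory. -/
structure State : Type where
  reg : ℕ → ℕ
  mem : ℕ → ℕ

/-- The state with register `d` overwritten by `v`. -/
def State.setReg (σ : State) (d v : ℕ) : State :=
  { σ with reg := Function.update σ.reg d v }

/-- The state with memory cell `a` overwritten by `v`. -/
def State.setMem (σ : State) (a v : ℕ) : State :=
  { σ with mem := Function.update σ.mem a v }

/-- `Exec b procs c σ t σ'`: on `b`-bit words, command `c` started in state `σ` halts after exactly
`t` steps in state `σ'`. Each word operation, memory access, test and call costs one step. -/
inductive Exec (b : ℕ) (procs : List Cmd) : Cmd → State → ℕ → State → Prop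
  | skip (σ : State) : Exec b procs .skip σ 1 σ
  | const (σ : State) (d v : ℕ) :
      Exec b procs (.const d v) σ 1 (σ.setReg d (v % 2 ^ b))
  | copy (σ : State) (d x : ℕ) :
      Exec b procs (.copy d x) σ 1 (σ.setReg d (σ.reg x))
  | binop (σ : State) (op : BinOp) (d x y : ℕ) :
      Exec b procs (.binop op d x y) σ 1 (σ.setReg d (op.eval b (σ.reg x) (σ.reg y)))
  | log2 (σ : State) (d x : ℕ) :
      Exec b procs (.log2 d x) σ 1 (σ.setReg d (Nat.log2 (σ.reg x)))
  | load (σ : State) (d x : ℕ) :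
      Exec b procs (.load d x) σ 1 (σ.setReg d (σ.mem (σ.reg x)))
  | store (σ : State) (x y : ℕ) :
      Exec b procs (.store x y) σ 1 (σ.setMem (σ.reg x) (σ.reg y))
  | seq {c₁ c₂ : Cmd} {σ σ₁ σ₂ : State} {t₁ t₂ : ℕ} :
      Exec b procs c₁ σ t₁ σ₁ → Exec b procs c₂ σ₁ t₂ σ₂ →
      Exec b procs (.seq c₁ c₂) σ (t₁ + t₂) σ₂
  | condTrue {cmp : Cmp} {x y : ℕ} {c₁ c₂ : Cmd} {σ σ' : State} {t : ℕ} :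
      cmp.Holds (σ.reg x) (σ.reg y) → Exec b procs c₁ σ t σ' →
      Exec b procs (.cond cmp x y c₁ c₂) σ (t + 1) σ'
  | condFalse {cmp : Cmp} {x y : ℕ} {c₁ c₂ : Cmd} {σ σ' : State} {t : ℕ} :
      ¬ cmp.Holds (σ.reg x) (σ.reg y) → Exec b procs c₂ σ t σ' →
      Exec b procs (.cond cmp x y c₁ c₂) σ (t + 1) σ'
  | loopDone {cmp : Cmp} {x y : ℕ} {c : Cmd} {σ : State} :
      ¬ cmp.Holds (σ.reg x) (σ.reg y) → Exec b procs (.loop cmp x y c) σ 1 σ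
  | loopStep {cmp : Cmp} {x y : ℕ} {c : Cmd} {σ σ₁ σ₂ : State} {t₁ t₂ : ℕ} :
      cmp.Holds (σ.reg x) (σ.reg y) → Exec b procs c σ t₁ σ₁ →
      Exec b procs (.loop cmp x y c) σ₁ t₂ σ₂ →
      Exec b procs (.loop cmp x y c) σ (t₁ + t₂ + 1) σ₂
  | call {p : ℕ} {c : Cmd} {σ σ' : State} {t : ℕ} :
      procs[p]? = some c → Exec b procs c σ t σ' →
      Exec b procs (.call p) σ (t + 1) σ'

/-- The machine is deterministic: running time and final state are determined by the start. -/
theorem Exec.deterministic {b : ℕ} {procs : List Cmd} {c : Cmd} {σ σ₁ σ₂ : State} {t₁ t₂ : ℕ}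
    (h₁ : Exec b procs c σ t₁ σ₁) (h₂ : Exec b procs c σ t₂ σ₂) : t₁ = t₂ ∧ σ₁ = σ₂ := by
  induction h₁ generalizing t₂ σ₂ with
  | skip | const | copy | binop | log2 | load | store => cases h₂; exact ⟨rfl, rfl⟩
  | seq _ _ ih₁ ih₂ =>
    cases h₂ with
    | seq a a' =>
      obtain ⟨rfl, rfl⟩ := ih₁ a
      obtain ⟨rfl, rfl⟩ := ih₂ a'
      exact ⟨rfl, rfl⟩
  | condTrue hc _ ih =>
    cases h₂ with
    | condTrue _ a => obtain ⟨rfl, rfl⟩ := ih a; exact ⟨rfl, rfl⟩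
    | condFalse hn _ => exact absurd hc hn
  | condFalse hc _ ih =>
    cases h₂ with
    | condTrue hn _ => exact absurd hn hc
    | condFalse _ a => obtain ⟨rfl, rfl⟩ := ih a; exact ⟨rfl, rfl⟩
  | loopDone hc =>
    cases h₂ with
    | loopDone _ => exact ⟨rfl, rfl⟩
    | loopStep hn _ _ => exact absurd hn hc
  | loopStep hc _ _ ih₁ ih₂ =>
    cases h₂ with
    | loopDone hn => exact absurd hc hn
    | loopStep _ a a' =>
      obtain ⟨rfl, rfl⟩ := ih₁ a
      obtain ⟨rfl, rfl⟩ := ih₂ a'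
      exact ⟨rfl, rfl⟩
  | call hp _ ih =>
    cases h₂ with
    | call hp' a =>
      obtain rfl := Option.some.inj (hp.symm.trans hp')
      obtain ⟨rfl, rfl⟩ := ih a
      exact ⟨rfl, rfl⟩

/-- A program: a main command and finitely many procedures. -/
structure Program : Type where
  main : Cmd
  procs : List Cmd

/-- The initial state on input `k`, `W`, `P` and a parameter `a` (an error or a length bound):
`r_0 = k`, `r_1 = W`, `r_2 = a`, `memory[i] = p_i` for `i < k`, and zero everywhere else. -/
def initState (k W a : ℕ) (P : Fin k → ℕ) : State where
  reg := fun r => if r = 0 then k else if r = 1 then W else if r = 2 then a else 0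
  mem := fun i => if h : i < k then P ⟨i, h⟩ else 0

/-- With `b`-bit words and on input `(k, W, a, P)`, the program halts after exactly `t` steps with
the vector `P'` in the memory cells `0, …, k - 1`. -/
def Program.Outputs (prog : Program) (b k W a : ℕ) (P : Fin k → ℕ) (t : ℕ) (P' : Fin k → ℕ) :
    Prop :=
  ∃ σ : State, Exec b prog.procs prog.main (initState k W a P) t σ ∧ ∀ i : Fin k, σ.mem i = P' i

end TrafficSplit

/-! Complexity is a statement about signed binary expansions. A move at level `l` is a digit vector
with one entry `+1` and one entry `-1` at weight `2 ^ l`; the dummy transaction is a single digit at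
weight `2 ^ W`. Hence a partition has complexity at most `n` exactly when it is a sum of terms `2 ^
t • D t` whose digit vectors have coordinate sum `0` or `1` and total ℓ₁-norm at most `2 * n - 1`
(`Decomp`, `complexity_le_iff`). As the binary expansion of `2 ^ W` is unique, the coordinate sum
`1` can occur only at level `W`. Digits may be taken in `{-1, 0, 1}`, so an even vector pays nothing
at the lowest level.

The engine is `Decomp.exchange`. When one of two entries must be increased by one, the entry that is
larger in the order by bits read from the lowest upwards is never the worse choice. It follows that
units move freely between odd entries, and that at the lowest level it is optimal to raise the upper
half of the odd entries in this order and to lower the other half (`decomp_match`). Repeating this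
level by level is the bit matcher, a greedy computation of the complexity.

For the error problem choose `l` with `2 ^ l ≤ e < 2 ^ (l + 1)`. Rounding a part up or down to a
multiple of `2 ^ l` stays within the tolerance, and all digits below level `l` can be cleared at no
cost (`Decomp.exists_scaled`). After division by `2 ^ l` each part has at most four admissible
values. Comparing `2 ^ (W - l)` with the sums of the lowest and of the highest even values shows
that all parts can be confined to two values each, again at no cost (`Decomp.exists_even`,
`Decomp.exists_beyond`). The sum then dictates how many parts take the larger value, and the
exchange lemma dictates which: the largest in the bit order (`Decomp.round_box`). The program needs
a few scans and one selection by median of medians. Words are compared in the bit order in constant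
time (`ltWord`), so the total is linear in `k`. The result is optimal for all budgets simultaneously
(`IsOptimalRounding`).

For the length problem an error bound `e` is achievable if and only if the optimal rounding for `e`
has complexity at most `n`, so `W` steps of binary search suffice. Each test rounds and then runs
the bit matcher with budget `n`. The matcher keeps the entries in buckets by the position of their
lowest bit; a round costs time proportional to the entries it changes, which is twice the number of
moves it spends. The test therefore takes `O(k + min n (W * k))` steps, which for `k ≥ 2` is within
the claimed bound; `k = 1` is answered directly.

The programs are written in a small structured language with exact arithmetic and compiled to the
word RAM with constant slowdown (`Run.exec`); their correctness and running time are proved together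
by timed weakest preconditions (`WP`). -/

namespace TrafficSplit

/-! ### Signed digit decompositions -/

section Decomp
variable {ι : Type*} [Fintype ι] [DecidableEq ι]

/-- `Decomp X n`: the vector `X` is a sum `∑ 2 ^ t • D t` of integer vectors whose coordinate sums
are `0` or `1` and whose `ℓ₁`-norms add up to at most `n`. -/
inductive Decomp : (ι → ℤ) → ℤ → Prop
  | zero (X : ι → ℤ) (n : ℤ) (hX : ∀ i, X i = 0) (hn : 0 ≤ n) : Decomp X n
  | step (X D C : ι → ℤ) (n m : ℤ) (hD : ∑ i, D i = 0 ∨ ∑ i, D i = 1) (hC : Decomp C m)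
      (hn : ∑ i, |D i| + m ≤ n) (hX : ∀ i, X i = D i + 2 * C i) : Decomp X n

theorem Decomp.exists_step {X : ι → ℤ} {n : ℤ} (h : Decomp X n) :
    ∃ (D C : ι → ℤ) (m : ℤ), (∑ i, D i = 0 ∨ ∑ i, D i = 1) ∧ Decomp C m ∧
      ∑ i, |D i| + m ≤ n ∧ ∀ i, X i = D i + 2 * C i := by
  cases h with
  | zero _ _ hX hn => exact ⟨0, 0, 0, by simp, .zero _ _ (by simp) le_rfl, by simpa using hn, by simpa using hX⟩
  | step _ D C _ m hD hC hn hX => exact ⟨D, C, m, hD, hC, hn, hX⟩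

theorem Decomp.mono {X : ι → ℤ} {n n' : ℤ} (h : Decomp X n) (hn : n ≤ n') : Decomp X n' := by
  cases h with
  | zero _ _ hX h0 => exact .zero _ _ hX (h0.trans hn)
  | step _ D C _ m hD hC hm hX => exact .step _ D C _ m hD hC (hm.trans hn) hX

theorem Decomp.nonneg {X : ι → ℤ} {n : ℤ} (h : Decomp X n) : 0 ≤ n := by
  induction h with
  | zero X n hX h0 => exact h0
  | step X D C n m hD hC hm hX ih =>
    have : 0 ≤ ∑ i, |D i| := Finset.sum_nonneg fun i _ => abs_nonneg _
    omega

theorem Decomp.congr {X Y : ι → ℤ} {n : ℤ} (h : Decomp X n) (hXY : ∀ i, Y i = X i) :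
    Decomp Y n := by
  obtain rfl : Y = X := funext hXY
  exact h

theorem Decomp.comp_equiv {X : ι → ℤ} {n : ℤ} (h : Decomp X n) (e : ι ≃ ι) :
    Decomp (fun i => X (e i)) n := by
  induction h with
  | zero X n hX h0 => exact .zero _ _ (fun i => hX _) h0
  | step X D C n m hD hC hm hX ih =>
    refine .step _ (fun i => D (e i)) (fun i => C (e i)) n m ?_ ih ?_ (fun i => hX _)
    · rwa [Equiv.sum_comp e D]
    · rwa [Equiv.sum_comp e (fun i => |D i|)]

omit [DecidableEq ι] in
theorem sum_sub_sum_of_eq_off {f g : ι → ℤ} (s : Finset ι) (h : ∀ i, i ∉ s → f i = g i) :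
    ∑ i, f i - ∑ i, g i = ∑ i ∈ s, (f i - g i) := by
  rw [← Finset.sum_sub_distrib]
  exact (Finset.sum_subset (Finset.subset_univ s) fun i _ hi => by rw [h i hi, sub_self]).symm

theorem sum_two {f g : ι → ℤ} {j z : ι} (hjz : j ≠ z) (h : ∀ i, i ≠ j → i ≠ z → f i = g i) :
    ∑ i, f i = ∑ i, g i + (f j - g j) + (f z - g z) := by
  have := sum_sub_sum_of_eq_off (f := f) (g := g) {j, z} (fun i hi => h i (by grind) (by grind))
  rw [Finset.sum_pair hjz] at this
  omega

theorem sum_three {f g : ι → ℤ} {i j z : ι} (hij : i ≠ j) (hiz : i ≠ z) (hjz : j ≠ z)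
    (h : ∀ x, x ≠ i → x ≠ j → x ≠ z → f x = g x) :
    ∑ x, f x = ∑ x, g x + (f i - g i) + (f j - g j) + (f z - g z) := by
  have := sum_sub_sum_of_eq_off (f := f) (g := g) {i, j, z}
    (fun x hx => h x (by grind) (by grind) (by grind))
  rw [Finset.sum_insert (by grind), Finset.sum_pair hjz] at this
  omega

/-- The vector `X` with one unit moved from `j` to `i`. -/
def shift (X : ι → ℤ) (i j : ι) : ι → ℤ :=
  fun x => X x + (if x = i then 1 else 0) - (if x = j then 1 else 0)

theorem sum_shift (X : ι → ℤ) (i j : ι) : ∑ x, shift X i j x = ∑ x, X x := by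
  simp [shift, Finset.sum_add_distrib]

/-- Only the lowest digit vector changes: its coordinate sum stays and its norm grows by at most 2.
This is the price of a carry in all exchange arguments below. -/
theorem Decomp.shift {X : ι → ℤ} {n : ℤ} (h : Decomp X n) (i j : ι) :
    Decomp (shift X i j) (n + 2) := by
  obtain ⟨D, C, m, hD, hC, hn, hX⟩ := h.exists_step
  refine .step _ (TrafficSplit.shift D i j) C _ m (by rwa [sum_shift]) hC ?_ (fun x => by
    simp only [TrafficSplit.shift, hX]; ring)
  have : ∑ x, |TrafficSplit.shift D i j x| ≤
      ∑ x, (|D x| + (if x = i then 1 else 0) + (if x = j then 1 else 0)) := by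
    refine Finset.sum_le_sum fun x _ => ?_
    simp only [TrafficSplit.shift]
    split_ifs <;> grind
  simp only [Finset.sum_add_distrib, Finset.sum_ite_eq', Finset.mem_univ, if_true] at this
  omega

omit [DecidableEq ι] in
theorem exists_neg_of_sum_le_one {D : ι → ℤ} (hD : ∑ i, D i ≤ 1) {s : Finset ι}
    (hs : 2 ≤ ∑ i ∈ s, D i) : ∃ z, z ∉ s ∧ D z < 0 := by
  classical
  by_contra! hc
  have := Finset.sum_le_sum_of_subset_of_nonneg (f := D) (Finset.subset_univ s)
    (fun i _ hi => hc i hi)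
  omega

omit [DecidableEq ι] in
theorem exists_pos_of_sum_nonneg {D : ι → ℤ} (hD : 0 ≤ ∑ i, D i) {s : Finset ι}
    (hs : ∑ i ∈ s, D i < 0) : ∃ z, z ∉ s ∧ 0 < D z := by
  classical
  by_contra! hc
  have := Finset.sum_le_sum_of_subset_of_nonneg (f := fun i => - D i) (Finset.subset_univ s)
    (fun i _ hi => by have := hc i hi; omega)
  simp only [Finset.sum_neg_distrib] at this
  omega

/-- Digits can be taken in `{-1, 0, 1}`. -/
theorem Decomp.exists_normal_step {X : ι → ℤ} {n : ℤ} (h : Decomp X n) :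
    ∃ (D C : ι → ℤ) (m : ℤ), (∑ i, D i = 0 ∨ ∑ i, D i = 1) ∧ Decomp C m ∧
      ∑ i, |D i| + m ≤ n ∧ (∀ i, X i = D i + 2 * C i) ∧ ∀ i, D i = -1 ∨ D i = 0 ∨ D i = 1 := by
  obtain ⟨D, C, m, hD, hC, hn, hX⟩ := h.exists_step
  obtain ⟨N, hN⟩ : ∃ N : ℕ, ∑ i, |D i| ≤ N := ⟨_, Int.self_le_toNat _⟩
  induction N using Nat.strong_induction_on generalizing D C m with
  | _ N ih =>
  by_cases hsmall : ∀ i, D i = -1 ∨ D i = 0 ∨ D i = 1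
  · exact ⟨D, C, m, hD, hC, hn, hX, hsmall⟩
  push Not at hsmall
  obtain ⟨j, hj⟩ := hsmall
  -- A digit of size at least 2 forces a digit of the opposite sign, because the coordinate sum is 0
  -- or 1. Shifting `2 * s` from the former to the latter saves 2 at this level and is a carry of
  -- one unit above, which costs at most 2.
  have key : ∃ (z : ι) (s : ℤ), (s = 1 ∨ s = -1) ∧ z ≠ j ∧ 2 ≤ s * D j ∧ s * D z < 0 := by
    rcases lt_or_ge (D j) 0 with hneg | hpos
    · obtain ⟨z, hz, hz'⟩ := exists_pos_of_sum_nonneg (D := D) (by omega) (s := {j}) (by simpa using hneg)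
      exact ⟨z, -1, by simp, by simpa using hz, by omega, by omega⟩
    · obtain ⟨z, hz, hz'⟩ := exists_neg_of_sum_le_one (D := D) (by omega) (s := {j}) (by simp; omega)
      exact ⟨z, 1, by simp, by simpa using hz, by omega, by omega⟩
  obtain ⟨z, s, hs, hzj, hDj, hDz⟩ := key
  set D' : ι → ℤ := fun x => if x = j then D j - 2 * s else if x = z then D z + 2 * s else D x with hD'
  have e1 := sum_two (f := D') (g := D) hzj.symm (fun i h1 h2 => by simp [D', h1, h2])
  have e2 := sum_two (f := fun x => |D' x|) (g := fun x => |D x|) hzj.symm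
    (fun i h1 h2 => by simp [D', h1, h2])
  have hj' : D' j = D j - 2 * s := by simp [D']
  have hz' : D' z = D z + 2 * s := by simp [D', hzj]
  simp only [hj', hz'] at e1 e2
  have e3 : |D j - 2 * s| = |D j| - 2 := by rcases hs with rfl | rfl <;> grind
  have e4 : |D z + 2 * s| ≤ |D z| := by rcases hs with rfl | rfl <;> grind
  have hnn : 0 ≤ ∑ x, |D' x| := Finset.sum_nonneg fun i _ => abs_nonneg _
  have hsum : ∑ x, |D' x| ≤ ∑ x, |D x| - 2 := by omega
  have hC' : ∃ C', Decomp C' (m + 2) ∧ ∀ x, X x = D' x + 2 * C' x := by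
    rcases hs with rfl | rfl
    · refine ⟨_, hC.shift j z, fun x => ?_⟩
      simp only [TrafficSplit.shift, D', hX]
      by_cases h1 : x = j
      · subst h1; simp [hzj.symm]; ring
      · by_cases h2 : x = z
        · subst h2; simp [h1]; ring
        · simp [h1, h2]
    · refine ⟨_, hC.shift z j, fun x => ?_⟩
      simp only [TrafficSplit.shift, D', hX]
      by_cases h1 : x = j
      · subst h1; simp [hzj.symm]; ring
      · by_cases h2 : x = z
        · subst h2; simp [h1]; ring
        · simp [h1, h2]
  obtain ⟨C', hC1, hC2⟩ := hC'
  exact ih (N - 2) (by omega) D' C' (m + 2) (by omega) hC1 (by omega) hC2 (by omega)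

theorem Decomp.double {X : ι → ℤ} {n : ℤ} (h : Decomp X n) : Decomp (fun i => 2 * X i) n :=
  .step _ 0 X n n (by simp) h (by simp) (by simp)

/-- Digits in `{-1, 0, 1}` of even entries vanish, so the lowest level can be dropped. -/
theorem Decomp.of_double {X : ι → ℤ} {n : ℤ} (h : Decomp (fun i => 2 * X i) n) : Decomp X n := by
  obtain ⟨D, C, m, hD, hC, hn, hX, hs⟩ := h.exists_normal_step
  have : ∀ i, D i = 0 := fun i => by have := hX i; have := hs i; omega
  refine (hC.mono (n' := n) ?_).congr fun i => ?_
  · simpa [this] using hn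
  · have := hX i; have := this; have := hs i; omega

theorem decomp_double_iff {X : ι → ℤ} {n : ℤ} : Decomp (fun i => 2 * X i) n ↔ Decomp X n :=
  ⟨.of_double, .double⟩

theorem decomp_two_pow_mul_iff {X : ι → ℤ} {n : ℤ} (t : ℕ) :
    Decomp (fun i => 2 ^ t * X i) n ↔ Decomp X n := by
  induction t with
  | zero => simp
  | succ t ih =>
    rw [← ih, ← decomp_double_iff (X := fun i => 2 ^ t * X i)]
    simp only [pow_succ']
    simp only [mul_assoc]

/-- The order by bits read from the lowest one upwards. -/
inductive LexLe : ℤ → ℤ → Prop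
  | refl (x : ℤ) : LexLe x x
  | parity (x y : ℤ) (hx : x % 2 = 0) (hy : y % 2 = 1) : LexLe x y
  | half (x y : ℤ) (h : x % 2 = y % 2) (h' : LexLe (x / 2) (y / 2)) : LexLe x y

/-- The vector `X` with one unit added at `j`. -/
def bump (X : ι → ℤ) (j : ι) : ι → ℤ := fun x => X x + if x = j then 1 else 0

/-- Induction along the common low bits. At the first difference, incrementing the odd entry makes
both entries even, whereas incrementing the even entry leaves both odd. Two digits are saved, and
they pay for the single carry that may be needed. Where the low bits agree, the lowest digits of the
two entries are swapped and the comparison passes to the halves. -/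
theorem Decomp.exchange {x y : ℤ} (hxy : LexLe x y) {X : ι → ℤ} {i j : ι} {n : ℤ}
    (hx : X j = x) (hy : X i = y) (h : Decomp (bump X j) n) : Decomp (bump X i) n := by
  induction hxy generalizing X n with
  | refl x =>
    refine (h.comp_equiv (Equiv.swap i j)).congr fun a => ?_
    simp only [bump, Equiv.swap_apply_def]
    split_ifs <;> grind
  | parity x y hpx hpy =>
    have hij : i ≠ j := by rintro rfl; omega
    obtain ⟨D, C, m, hD, hC, hn, hX, hs⟩ := h.exists_normal_step
    have hi := hX i
    have hj := hX j
    simp only [bump, hij, if_false, if_true] at hi hj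
    have hDi : D i = 1 ∨ D i = -1 := by have := hs i; omega
    have hDj : D j = 1 ∨ D j = -1 := by have := hs j; omega
    by_cases hopp : D i + D j = 0
    · set D' : ι → ℤ := fun a => if a = i then 0 else if a = j then 0 else D a
      have hD'i : D' i = 0 := by simp [D']
      have hD'j : D' j = 0 := by simp [D']
      have e1 := sum_two (f := D') (g := D) hij (fun a h1 h2 => by simp [D', h1, h2])
      have e2 := sum_two (f := fun a => |D' a|) (g := fun a => |D a|) hij
        (fun a h1 h2 => by simp [D', h1, h2])
      simp only [hD'i, hD'j, abs_zero] at e1 e2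
      have e3 : |D i| = 1 := by rcases hDi with h | h <;> simp [h]
      have e4 : |D j| = 1 := by rcases hDj with h | h <;> simp [h]
      have hC' : ∃ C', Decomp C' (m + 2) ∧ ∀ a, bump X i a = D' a + 2 * C' a := by
        rcases hDi with h1 | h1
        · refine ⟨_, hC.shift i j, fun a => ?_⟩
          have := hX a
          simp only [bump, TrafficSplit.shift, D'] at this ⊢
          split_ifs at this ⊢ <;> grind
        · refine ⟨C, hC.mono (by omega), fun a => ?_⟩
          have := hX a
          simp only [bump, D'] at this ⊢
          split_ifs at this ⊢ <;> grind
      obtain ⟨C', hC1, hC2⟩ := hC'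
      exact .step _ D' C' _ _ (by omega) hC1 (by linarith) hC2
    -- For equal digits at `i` and `j` the coordinate sum supplies a third entry with the opposite
    -- digit. Its sign is flipped while the digits at `i` and `j` are deleted; the coordinate sum is
    -- unchanged and the norm drops by 2. Opposite digits, the case above, could simply be deleted.
    · have hz : ∃ z, z ≠ i ∧ z ≠ j ∧ D z = - D i := by
        rcases hDi with h1 | h1
        · obtain ⟨z, hz, hz'⟩ := exists_neg_of_sum_le_one (D := D) (by omega) (s := {i, j})
            (by rw [Finset.sum_pair hij]; omega)
          exact ⟨z, by grind, by grind, by have := hs z; omega⟩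
        · obtain ⟨z, hz, hz'⟩ := exists_pos_of_sum_nonneg (D := D) (by omega) (s := {i, j})
            (by rw [Finset.sum_pair hij]; omega)
          exact ⟨z, by grind, by grind, by have := hs z; omega⟩
      obtain ⟨z, hzi, hzj, hDz⟩ := hz
      set D' : ι → ℤ := fun a => if a = i then 0 else if a = j then 0 else if a = z then D i else D a
      have hD'i : D' i = 0 := by simp [D']
      have hD'j : D' j = 0 := by simp [D']
      have hD'z : D' z = D i := by simp [D', hzi, hzj]
      have e1 := sum_three (f := D') (g := D) hij hzi.symm hzj.symm
        (fun a h1 h2 h3 => by simp [D', h1, h2, h3])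
      have e2 := sum_three (f := fun a => |D' a|) (g := fun a => |D a|) hij hzi.symm hzj.symm
        (fun a h1 h2 h3 => by simp [D', h1, h2, h3])
      simp only [hD'i, hD'j, hD'z, hDz, abs_neg, abs_zero] at e1 e2
      have e3 : |D i| = 1 := by rcases hDi with h | h <;> simp [h]
      have e4 : |D j| = 1 := by rcases hDj with h | h <;> simp [h]
      have hC' : ∃ C', Decomp C' (m + 2) ∧ ∀ a, bump X i a = D' a + 2 * C' a := by
        rcases hDi with h1 | h1
        · refine ⟨_, hC.shift i z, fun a => ?_⟩
          have := hX a
          simp only [bump, TrafficSplit.shift, D'] at this ⊢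
          split_ifs at this ⊢ <;> grind
        · refine ⟨_, hC.shift z j, fun a => ?_⟩
          have := hX a
          simp only [bump, TrafficSplit.shift, D'] at this ⊢
          split_ifs at this ⊢ <;> grind
      obtain ⟨C', hC1, hC2⟩ := hC'
      exact .step _ D' C' _ _ (by omega) hC1 (by omega) hC2
  | half x y hp hlex ih =>
    by_cases hij : i = j
    · subst hij; exact h
    obtain ⟨D, C, m, hD, hC, hn, hX, hs⟩ := h.exists_normal_step
    have hi := hX i
    have hj := hX j
    simp only [bump, hij, if_false, if_true] at hi hj
    have hsi := hs i
    have hsj := hs j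
    -- the digits at `i` and `j` are exchanged
    have hD' : ∑ a, D (Equiv.swap i j a) = ∑ a, D a := Equiv.sum_comp (Equiv.swap i j) D
    have hn' : ∑ a, |D (Equiv.swap i j a)| = ∑ a, |D a| :=
      Equiv.sum_comp (Equiv.swap i j) fun a => |D a|
    suffices hC' : ∃ C', Decomp C' m ∧ C' i = (X i + 1 - D j) / 2 ∧ C' j = (X j - D i) / 2 ∧
        ∀ a, a ≠ i → a ≠ j → C' a = C a by
      obtain ⟨C', hC', hCi, hCj, hCo⟩ := hC'
      refine .step _ (fun a => D (Equiv.swap i j a)) C' _ m (by rwa [hD']) hC' (by rwa [hn']) fun a => ?_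
      by_cases hai : a = i
      · subst hai; simp only [bump, Equiv.swap_apply_left, if_true]; omega
      by_cases haj : a = j
      · subst haj; simp only [bump, Equiv.swap_apply_right, hai, if_false]; omega
      · have := hX a
        simp only [bump, haj, if_false] at this
        simp only [bump, Equiv.swap_apply_of_ne_of_ne hai haj, hai, if_false, hCo a hai haj, this]
    -- Either the upper parts already fit the swapped digits, or the upper part at `j` exceeds `x /
    -- 2` by one and the induction hypothesis hands this unit over to `i`.
    by_cases hsame : C i = y / 2 ∧ C j = x / 2 ∨ x % 2 = 1 ∧ D i = -1
    · exact ⟨C, hC, by omega, by omega, fun _ _ _ => rfl⟩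
    · have h1 : C i = y / 2 := by omega
      have h2 : C j = x / 2 + 1 := by omega
      refine ⟨_, ih (X := fun a => if a = j then x / 2 else C a) (n := m) (by simp)
        (by simp [hij, h1]) (hC.congr fun a => ?_), ?_, ?_, ?_⟩
      · simp only [bump]
        by_cases ha : a = j
        · subst ha; simp [h2]
        · simp [ha]
      · simp only [bump, hij, if_false, if_true]; omega
      · simp only [bump, Ne.symm hij, if_false, if_true]; omega
      · intro a ha ha'; simp [bump, ha, ha']

end Decomp
end TrafficSplit

/-! ### Free moves inside boxes, and the optimal matching round. -/

namespace TrafficSplit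

section Exchange
variable {ι : Type*} [Fintype ι] [DecidableEq ι]

theorem LexLe.half_of_odd {x y : ℤ} (h : LexLe x y) (hx : x % 2 = 1) : LexLe (x / 2) (y / 2) := by
  cases h with
  | refl => exact .refl _
  | parity _ _ h1 h2 => omega
  | half _ _ h1 h2 => exact h2

/-- Take the unit away from `j` first: entry `j` is then even and entry `i` odd, so the exchange
lemma prefers to return the unit to `i`. -/
theorem Decomp.shift_of_odd {X : ι → ℤ} {n : ℤ} (h : Decomp X n) {i j : ι} (hi : X i % 2 = 1)
    (hj : X j % 2 = 1) : Decomp (TrafficSplit.shift X i j) n := by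
  by_cases hij : i = j
  · subst hij
    exact h.congr fun x => by simp [TrafficSplit.shift]
  have h1 : Decomp (bump (fun x => X x - if x = j then 1 else 0) j) n :=
    h.congr fun x => by simp [bump]
  refine (h1.exchange (i := i) (x := X j - 1) (y := X i) (.parity _ _ (by omega) hi) (by simp)
    (by simp [hij])).congr fun x => ?_
  simp only [TrafficSplit.shift, bump]; ring

/-- Two of the odd entries can be moved by `s`, against `-2 s` at a given entry. -/
theorem Decomp.exists_move_pair {X : ι → ℤ} {n : ℤ} (h : Decomp X n) (hpar : (∑ x, X x) % 2 = 0)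
    {j₀ : ι} (hodd : X j₀ % 2 = 1) (i : ι) {s : ℤ} (hs : s = 1 ∨ s = -1) :
    ∃ j j', j ≠ j' ∧ X j % 2 = 1 ∧ X j' % 2 = 1 ∧
      Decomp (fun x => X x + (if x = j then s else 0) + (if x = j' then s else 0) -
        if x = i then 2 * s else 0) n := by
  obtain ⟨D, C, m, hD, hC, hn, hX, hsm⟩ := h.exists_normal_step
  have hsum : ∑ x, X x = ∑ x, D x + 2 * ∑ x, C x := by
    rw [Finset.mul_sum, ← Finset.sum_add_distrib]; exact Finset.sum_congr rfl fun x _ => hX x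
  have hD0 : ∑ x, D x = 0 := by omega
  -- A zero coordinate sum and one odd entry give digits of both signs. Deleting such a pair saves
  -- 2, which pays for the carry between `j` and `i`.
  have key : ∃ j j', D j = s ∧ D j' = -s := by
    have h0 := hX j₀
    have h0' := hsm j₀
    have h1 : ∃ z, D z = - D j₀ := by
      rcases (by omega : D j₀ = -1 ∨ D j₀ = 1) with h1 | h1
      · obtain ⟨z, hz, hz'⟩ := exists_pos_of_sum_nonneg (D := D) (by omega) (s := {j₀}) (by simp; omega)
        exact ⟨z, by have := hsm z; omega⟩
      · by_contra! hc
        have : ∀ z, 0 ≤ D z := fun z => by have := hsm z; have := hc z; omega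
        have := (Finset.sum_eq_zero_iff_of_nonneg (fun z _ => this z)).1 hD0 j₀ (Finset.mem_univ _)
        omega
    obtain ⟨z, hz⟩ := h1
    by_cases h2 : D j₀ = s
    · exact ⟨j₀, z, h2, by omega⟩
    · exact ⟨z, j₀, by omega, by omega⟩
  obtain ⟨j, j', hj, hj'⟩ := key
  have hjj : j ≠ j' := by rintro rfl; omega
  have hXj := hX j
  have hXj' := hX j'
  refine ⟨j, j', hjj, by omega, by omega, ?_⟩
  set D' : ι → ℤ := fun x => if x = j then 0 else if x = j' then 0 else D x with hD'
  have h1 : D' j = 0 := by simp [D']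
  have h2 : D' j' = 0 := by simp [D']
  have e1 := sum_two (f := D') (g := D) hjj (fun a h1 h2 => by simp [D', h1, h2])
  have e2 := sum_two (f := fun x => |D' x|) (g := fun x => |D x|) hjj
    (fun a h1 h2 => by simp [D', h1, h2])
  have e3 : |s| = 1 := by rcases hs with rfl | rfl <;> simp
  simp only [h1, h2, hj, hj', abs_neg, e3, abs_zero] at e1 e2
  have hC' : ∃ C', Decomp C' (m + 2) ∧
      ∀ x, C' x = C x + (if x = j then s else 0) - if x = i then s else 0 := by
    rcases hs with rfl | rfl
    · exact ⟨_, hC.shift j i, fun x => rfl⟩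
    · refine ⟨_, hC.shift i j, fun x => ?_⟩
      simp only [TrafficSplit.shift]
      split_ifs <;> omega
  obtain ⟨C', hC1, hC2⟩ := hC'
  refine .step _ D' C' _ _ (by omega) hC1 (by linarith) fun x => ?_
  have := hX x
  rw [hC2]
  simp only [D']
  by_cases hxj : x = j
  · subst hxj
    simp only [hjj, if_true, if_false]
    split_ifs <;> omega
  by_cases hxj' : x = j'
  · subst hxj'
    simp only [hxj, if_true, if_false]
    split_ifs <;> omega
  simp only [hxj, hxj', if_false]
  split_ifs <;> omega

omit [DecidableEq ι] in
theorem exists_lt_of_sum_le {f g : ι → ℤ} (h : ∑ x, f x ≤ ∑ x, g x) {i : ι} (hi : g i < f i) :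
    ∃ j, f j < g j := by
  by_contra! hc
  have := Finset.sum_lt_sum (fun x _ => hc x) ⟨i, Finset.mem_univ i, hi⟩
  omega

omit [DecidableEq ι] in
theorem card_odd_even {X : ι → ℤ} :
    ((Finset.univ.filter fun x => X x % 2 = 1).card : ℤ) % 2 = (∑ x, X x) % 2 := by
  have : ∑ x, X x = ∑ x, (X x % 2) + 2 * ∑ x, X x / 2 := by
    rw [Finset.mul_sum, ← Finset.sum_add_distrib]
    exact Finset.sum_congr rfl fun x _ => by omega
  rw [this, Finset.card_filter]
  push_cast
  have : ∑ x, (X x % 2) = ∑ x, (if X x % 2 = 1 then (1 : ℤ) else 0) :=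
    Finset.sum_congr rfl fun x _ => by split_ifs <;> omega
  omega

/-- Within a box, a vector can be made even at no cost if the even points of the box allow it. -/
theorem Decomp.exists_even {a b X : ι → ℤ} {n : ℤ} (hab : ∀ i, (a i + 1) / 2 ≤ b i / 2)
    (hX : ∀ i, a i ≤ X i ∧ X i ≤ b i) (hlo : ∑ i, 2 * ((a i + 1) / 2) ≤ ∑ i, X i)
    (hhi : ∑ i, X i ≤ ∑ i, 2 * (b i / 2)) (hpar : (∑ i, X i) % 2 = 0) (h : Decomp X n) :
    ∃ Y : ι → ℤ, (∀ i, a i ≤ Y i ∧ Y i ≤ b i ∧ Y i % 2 = 0) ∧ ∑ i, Y i = ∑ i, X i ∧ Decomp Y n := by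
  obtain ⟨N, hN⟩ : ∃ N, (Finset.univ.filter fun x => X x % 2 = 1).card = N := ⟨_, rfl⟩
  induction N using Nat.strong_induction_on generalizing X with
  | _ N ih =>
  have hcard := card_odd_even (X := X)
  by_cases hno : ∀ i, X i % 2 = 0
  · exact ⟨X, fun i => ⟨(hX i).1, (hX i).2, hno i⟩, rfl, h⟩
  push Not at hno
  obtain ⟨j₀, hj₀⟩ := hno
  -- progress is measured by the odd entries
  have step : ∀ Y : ι → ℤ, (∀ i, a i ≤ Y i ∧ Y i ≤ b i) → ∑ i, Y i = ∑ i, X i → Decomp Y n →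
      (∀ x, Y x % 2 = 1 → X x % 2 = 1) → (∃ x, X x % 2 = 1 ∧ Y x % 2 ≠ 1) →
      ∃ Y : ι → ℤ, (∀ i, a i ≤ Y i ∧ Y i ≤ b i ∧ Y i % 2 = 0) ∧ ∑ i, Y i = ∑ i, X i ∧
        Decomp Y n := by
    rintro Y hY hs hd hsub ⟨x, hx1, hx2⟩
    have hlt : (Finset.univ.filter fun x => Y x % 2 = 1).card < N := by
      rw [← hN]
      refine Finset.card_lt_card ⟨fun y hy => ?_, fun hc => ?_⟩
      · simp only [Finset.mem_filter, Finset.mem_univ, true_and] at hy ⊢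
        exact hsub y hy
      · have := hc (by simp [hx1] : x ∈ _)
        simp [hx2] at this
    obtain ⟨Z, h1, h2, h3⟩ := ih _ hlt hY (by omega) (by omega) (by omega) hd rfl
    exact ⟨Z, h1, by omega, h3⟩
  -- Two odd entries, one with room above and one with room below, can trade a unit for free and
  -- both become even.
  by_cases hpair : ∃ i j, i ≠ j ∧ X i % 2 = 1 ∧ X j % 2 = 1 ∧ X i < b i ∧ a j < X j
  · obtain ⟨i, j, hij, hi, hj, hib, hja⟩ := hpair
    refine step (TrafficSplit.shift X i j) (fun x => ?_) (sum_shift X i j) (h.shift_of_odd hi hj)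
      (fun x => ?_) ⟨i, hi, ?_⟩
    · have := hX x
      simp only [TrafficSplit.shift]
      by_cases h1 : x = i
      · subst h1; simp only [hij, if_true, if_false]; omega
      · by_cases h2 : x = j
        · subst h2; simp only [h1, if_true, if_false]; omega
        · simp only [h1, h2, if_false]; omega
    · simp only [TrafficSplit.shift]
      by_cases h1 : x = i
      · subst h1; simp only [hij, if_true, if_false]; omega
      · by_cases h2 : x = j
        · subst h2; simp only [h1, if_true, if_false]; omega
        · simp only [h1, h2, if_false]; omega
    · simp only [TrafficSplit.shift, hij, if_true, if_false]; omega
  push Not at hpair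
  -- all odd entries sit at the same end of the box
  have hend : ∃ s : ℤ, (s = 1 ∨ s = -1) ∧ ∀ j, X j % 2 = 1 →
      a j ≤ X j + s ∧ X j + s ≤ b j ∧ X j = if s = 1 then a j else b j := by
    obtain ⟨j₁, hj₁, hj₁'⟩ : ∃ j₁, j₁ ≠ j₀ ∧ X j₁ % 2 = 1 := by
      by_contra! hc
      have : (Finset.univ.filter fun x => X x % 2 = 1) = {j₀} := by
        ext x
        simp only [Finset.mem_filter, Finset.mem_univ, true_and, Finset.mem_singleton]
        refine ⟨fun hx => by_contra fun hne => hc x hne hx, fun hx => by subst hx; omega⟩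
      rw [this] at hcard
      simp at hcard
      omega
    have hj₀' : X j₀ % 2 = 1 := by omega
    have b0 := hX j₀
    have b1 := hX j₁
    have c0 := hab j₀
    have c1 := hab j₁
    by_cases hd : a j₀ < X j₀
    · have hall : ∀ j, X j % 2 = 1 → X j = b j := fun j hj => by
        have bj := hX j
        by_contra hne
        by_cases hjj : j = j₀
        · subst hjj
          have e1 : b j₁ ≤ X j₁ := by
            by_contra hlt; have := hpair j₁ j hj₁ hj₁' hj (by omega); omega
          have := hpair j j₁ hj₁.symm hj hj₁' (by omega)
          omega
        · have := hpair j j₀ hjj hj hj₀' (by omega); omega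
      refine ⟨-1, by simp, fun j hj => ?_⟩
      have := hall j hj
      have := hab j
      have := hX j
      simp only [show ¬ ((-1 : ℤ) = 1) by omega, if_false]
      omega
    · have hall : ∀ j, X j % 2 = 1 → X j = a j := fun j hj => by
        have bj := hX j
        by_contra hne
        have hjj : j ≠ j₀ := by rintro rfl; omega
        have := hpair j₀ j hjj.symm hj₀' hj (by omega)
        omega
      refine ⟨1, by simp, fun j hj => ?_⟩
      have := hall j hj
      have := hab j
      have := hX j
      simp only [if_true]
      omega
  obtain ⟨s, hs, hend⟩ := hend
  -- The bound on the sum provides an even entry with room for 2 in the direction opposite to `s`.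
  -- It compensates for two odd entries stepping away from their end of the box.
  have hi : ∃ i, X i % 2 = 0 ∧ a i ≤ X i - 2 * s ∧ X i - 2 * s ≤ b i := by
    have e0 := hend j₀ (by omega)
    have c0 := hab j₀
    rcases hs with rfl | rfl
    · simp only [if_true] at hend e0
      obtain ⟨i, hi⟩ := exists_lt_of_sum_le hlo (i := j₀) (by omega)
      have h1 := hX i
      have h2 := hab i
      have h3 := hend i
      exact ⟨i, by omega, by omega, by omega⟩
    · simp only [show ¬ ((-1 : ℤ) = 1) by omega, if_false] at hend e0
      obtain ⟨i, hi⟩ := exists_lt_of_sum_le hhi (i := j₀) (by omega)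
      have h1 := hX i
      have h2 := hab i
      have h3 := hend i
      exact ⟨i, by omega, by omega, by omega⟩
  obtain ⟨i, hi0, hia, hib⟩ := hi
  obtain ⟨j, j', hjj, hj, hj', hd⟩ := h.exists_move_pair hpar (j₀ := j₀) (by omega) i hs
  have hij : i ≠ j := by rintro rfl; omega
  have hij' : i ≠ j' := by rintro rfl; omega
  have bj := hend j hj
  have bj' := hend j' hj'
  have hval : ∀ x, (if x = j then X x + s else if x = j' then X x + s else if x = i then
      X x - 2 * s else X x) = X x + (if x = j then s else 0) + (if x = j' then s else 0) -
        if x = i then 2 * s else 0 := fun x => by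
    by_cases h1 : x = j
    · subst h1; simp [hjj, Ne.symm hij]
    by_cases h2 : x = j'
    · subst h2; simp [h1, Ne.symm hij']
    by_cases h3 : x = i
    · subst h3; simp [h1, h2]
    simp [h1, h2, h3]
  refine step _ (fun x => ?_) ?_ (hd.congr hval) (fun x => ?_) ⟨j, hj, ?_⟩
  · have := hX x
    split_ifs with h1 h2 h3
    · subst h1; omega
    · subst h2; omega
    · subst h3; omega
    · omega
  · simp only [hval, Finset.sum_sub_distrib, Finset.sum_add_distrib, Finset.sum_ite_eq',
      Finset.mem_univ, if_true]
    omega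
  · split_ifs with h1 h2 h3
    · subst h1; omega
    · subst h2; omega
    · subst h3; omega
    · omega
  · simp only [if_true]; omega

/-- If the anchor `q` is on the `s`-side of the even points and the sum lies beyond it, then all
entries can be brought to the `s`-side of the anchor. -/
theorem Decomp.exists_beyond {a b q e X : ι → ℤ} {n s : ℤ} (hs : s = 1 ∨ s = -1)
    (hX : ∀ i, a i ≤ X i ∧ X i ≤ b i) (hq : ∀ i, a i ≤ q i ∧ q i ≤ b i)
    (he : ∀ i x, a i ≤ x → x ≤ b i → s * x ≤ s * e i) (hqe : ∀ i, e i = q i ∨ e i = q i + s)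
    (hqodd : ∀ i, q i % 2 = 1 → a i = q i ∧ b i = q i)
    (hnear : ∀ j, q j % 2 = 1 → ∀ i x, a i ≤ x → x ≤ b i → s * q i ≤ s * x + 1)
    (hsum : s * ∑ i, q i ≤ s * ∑ i, X i) (hpar : (∑ i, X i) % 2 = 0) (h : Decomp X n) :
    ∃ Y : ι → ℤ, (∀ i, a i ≤ Y i ∧ Y i ≤ b i ∧ s * q i ≤ s * Y i) ∧ ∑ i, Y i = ∑ i, X i ∧
      Decomp Y n := by
  obtain ⟨N, hN⟩ : ∃ N : ℕ, ∑ i, max 0 (s * (q i - X i)) = N :=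
    ⟨_, (Int.toNat_of_nonneg (Finset.sum_nonneg fun i _ => le_max_left _ _)).symm⟩
  induction N using Nat.strong_induction_on generalizing X with
  | _ N ih =>
  by_cases hno : ∀ i, s * q i ≤ s * X i
  · exact ⟨X, fun i => ⟨(hX i).1, (hX i).2, hno i⟩, rfl, h⟩
  push Not at hno
  obtain ⟨i₀, hi₀⟩ := hno
  have step : ∀ Y : ι → ℤ, (∀ i, a i ≤ Y i ∧ Y i ≤ b i) → ∑ i, Y i = ∑ i, X i → Decomp Y n →
      (∀ x, max 0 (s * (q x - Y x)) ≤ max 0 (s * (q x - X x))) →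
      (∃ x, max 0 (s * (q x - Y x)) < max 0 (s * (q x - X x))) →
      ∃ Y : ι → ℤ, (∀ i, a i ≤ Y i ∧ Y i ≤ b i ∧ s * q i ≤ s * Y i) ∧ ∑ i, Y i = ∑ i, X i ∧
        Decomp Y n := by
    rintro Y hY hs' hd hle ⟨x, hx⟩
    have h1 := Finset.sum_lt_sum (fun y _ => hle y) ⟨x, Finset.mem_univ x, hx⟩
    have h2 : 0 ≤ ∑ i, max 0 (s * (q i - Y i)) := Finset.sum_nonneg fun i _ => le_max_left _ _
    obtain ⟨Z, h3, h4, h5⟩ := ih (∑ i, max 0 (s * (q i - Y i))).toNat (by omega) hY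
      (by rw [hs']; exact hsum) (by omega) hd (Int.toNat_of_nonneg h2).symm
    exact ⟨Z, h3, by omega, h5⟩
  -- an entry strictly beyond the anchor
  obtain ⟨j₀, hj₀⟩ : ∃ j, s * q j < s * X j := by
    refine exists_lt_of_sum_le (f := fun i => s * q i) (g := fun i => s * X i) ?_ hi₀
    rwa [← Finset.mul_sum, ← Finset.mul_sum]
  -- Beyond the anchor there is room for a single step, and none where the anchor is odd; the
  -- entries beyond the anchor are therefore odd.
  have hbeyond : ∀ j, s * q j < s * X j → X j = q j + s ∧ X j % 2 = 1 := fun j hj => by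
    have h1 := he j (X j) (hX j).1 (hX j).2
    have h2 := hqe j
    have h3 := hqodd j
    have h4 := hX j
    rcases hs with rfl | rfl <;> omega
  obtain ⟨hj1, hj2⟩ := hbeyond j₀ hj₀
  have bj := hq j₀
  by_cases hodd : ∃ i, s * X i < s * q i ∧ X i % 2 = 1
  · obtain ⟨i, hi, hi'⟩ := hodd
    have bi := hq i
    have hij : i ≠ j₀ := by rintro rfl; omega
    have hY : ∃ Y, Decomp Y n ∧ ∀ x, Y x = if x = i then X x + s else if x = j₀ then X x - s else
        X x := by
      rcases hs with rfl | rfl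
      · refine ⟨_, h.shift_of_odd hi' hj2, fun x => ?_⟩
        simp only [TrafficSplit.shift]
        by_cases h1 : x = i
        · subst h1; simp [hij]
        by_cases h2 : x = j₀
        · subst h2; simp [h1]
        simp [h1, h2]
      · refine ⟨_, h.shift_of_odd hj2 hi', fun x => ?_⟩
        simp only [TrafficSplit.shift]
        by_cases h1 : x = i
        · subst h1; simp [hij]; omega
        by_cases h2 : x = j₀
        · subst h2; simp [h1]
        simp [h1, h2]
    obtain ⟨Y, hY, hYx⟩ := hY
    refine step Y (fun x => ?_) ?_ hY (fun x => ?_) ⟨i, ?_⟩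
    · have := hX x
      rw [hYx]
      split_ifs with h1 h2
      · subst h1; rcases hs with rfl | rfl <;> omega
      · subst h2; rcases hs with rfl | rfl <;> omega
      · omega
    · rw [sum_two (f := Y) (g := X) hij (fun x h1 h2 => by simp [hYx, h1, h2])]
      simp only [hYx, if_true, Ne.symm hij, if_false]; omega
    · rw [hYx]
      split_ifs with h1 h2
      · subst h1; rcases hs with rfl | rfl <;> omega
      · subst h2; rcases hs with rfl | rfl <;> omega
      · omega
    · simp only [hYx, if_true]; rcases hs with rfl | rfl <;> omega
  -- Now every lagging entry is even. A pair of odd entries steps back and `i₀` advances by 2; this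
  -- does not overshoot because the anchor of `i₀` is even as well. As `i₀` lags by at least 2,
  -- `hnear` rules out odd anchors altogether, so all odd entries lie beyond theirs and can afford
  -- the step back.
  · push Not at hodd
    have hie : X i₀ % 2 = 0 := by have := hodd i₀ hi₀; omega
    have bi := hX i₀
    have ci := hq i₀
    have hqi : q i₀ % 2 = 0 := by have := hqodd i₀; rcases hs with rfl | rfl <;> omega
    have hqall : ∀ j, q j % 2 = 0 := fun j => by
      by_contra hc
      have := hnear j (by omega) i₀ (X i₀) bi.1 bi.2
      rcases hs with rfl | rfl <;> omega
    obtain ⟨j, j', hjj, hj, hj', hd⟩ := h.exists_move_pair hpar hj2 i₀ (s := -s) (by omega)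
    have hij : i₀ ≠ j := by rintro rfl; omega
    have hij' : i₀ ≠ j' := by rintro rfl; omega
    have hbey : ∀ j, X j % 2 = 1 → X j = q j + s := fun j hj => by
      refine (hbeyond j ?_).1
      have := hodd j
      have := hqall j
      rcases hs with rfl | rfl <;> omega
    have ej := hbey j hj
    have ej' := hbey j' hj'
    have cj := hq j
    have cj' := hq j'
    have hval : ∀ x, (if x = j then X x - s else if x = j' then X x - s else if x = i₀ then
        X x + 2 * s else X x) = X x + (if x = j then -s else 0) + (if x = j' then -s else 0) -
          if x = i₀ then 2 * -s else 0 := fun x => by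
      by_cases h1 : x = j
      · subst h1; simp [hjj, Ne.symm hij]; ring
      by_cases h2 : x = j'
      · subst h2; simp [h1, Ne.symm hij']; ring
      by_cases h3 : x = i₀
      · subst h3; simp [h1, h2]
      simp [h1, h2, h3]
    refine step _ (fun x => ?_) ?_ (hd.congr hval) (fun x => ?_) ⟨i₀, ?_⟩
    · have := hX x
      split_ifs with h1 h2 h3
      · subst h1; rcases hs with rfl | rfl <;> omega
      · subst h2; rcases hs with rfl | rfl <;> omega
      · subst h3; rcases hs with rfl | rfl <;> omega
      · omega
    · simp only [hval, Finset.sum_sub_distrib, Finset.sum_add_distrib, Finset.sum_ite_eq',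
        Finset.mem_univ, if_true]
      omega
    · split_ifs with h1 h2 h3
      · subst h1; rcases hs with rfl | rfl <;> omega
      · subst h2; rcases hs with rfl | rfl <;> omega
      · subst h3; rcases hs with rfl | rfl <;> omega
      · omega
    · simp only [hij, hij', if_true, if_false]; rcases hs with rfl | rfl <;> omega

/-- Among equally large sets of entries to increment, a top set in the bit order is best. -/
theorem Decomp.exchange_set {z : ι → ℤ} {n : ℤ} {c S U : Finset ι} (hS : S ⊆ c) (hU : U ⊆ c)
    (hcard : S.card = U.card) (htop : ∀ i ∈ U, ∀ j ∈ c, j ∉ U → LexLe (z j) (z i))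
    (h : Decomp (fun i => z i + if i ∈ S then 1 else 0) n) :
    Decomp (fun i => z i + if i ∈ U then 1 else 0) n := by
  obtain ⟨N, hN⟩ : ∃ N, (S \ U).card = N := ⟨_, rfl⟩
  induction N generalizing S with
  | zero =>
    have h1 : S ⊆ U := by rwa [Finset.card_eq_zero, Finset.sdiff_eq_empty_iff_subset] at hN
    rwa [← Finset.eq_of_subset_of_card_le h1 hcard.ge]
  | succ N ih =>
    have h1 : (U \ S).card = N + 1 := by
      rw [← hN]; exact (Finset.card_sdiff_comm hcard).symm
    obtain ⟨j, hj⟩ : (S \ U).Nonempty := Finset.card_pos.1 (by omega)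
    obtain ⟨i, hi⟩ : (U \ S).Nonempty := Finset.card_pos.1 (by omega)
    rw [Finset.mem_sdiff] at hi hj
    have hij : i ≠ j := by rintro rfl; exact hj.2 hi.1
    have h2 : Decomp (bump (fun x => z x + if x ∈ S.erase j then 1 else 0) j) n := by
      refine h.congr fun x => ?_
      simp only [bump, Finset.mem_erase]
      by_cases hx : x = j
      · subst hx; simp [hj.1]
      · simp [hx]
    have h3 := h2.exchange (htop i hi.1 j (hS hj.1) hj.2) (i := i) (by simp) (by simp [hi.2])
    refine ih (S := insert i (S.erase j)) ?_ ?_ (h3.congr fun x => ?_) ?_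
    · intro x hx
      rw [Finset.mem_insert, Finset.mem_erase] at hx
      rcases hx with rfl | hx
      · exact hU hi.1
      · exact hS hx.2
    · rw [Finset.card_insert_of_notMem (by simp [hi.2]), Finset.card_erase_of_mem hj.1]
      have := Finset.card_pos.2 ⟨j, hj.1⟩
      omega
    · simp only [bump, Finset.mem_insert, Finset.mem_erase]
      by_cases hx : x = i
      · subst hx; simp [hi.2]
      · simp [hx]
    · have : insert i (S.erase j) \ U = (S \ U).erase j := by
        ext x
        simp only [Finset.mem_sdiff, Finset.mem_insert, Finset.mem_erase]
        constructor
        · rintro ⟨rfl | h, h'⟩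
          · exact absurd hi.1 h'
          · exact ⟨h.1, h.2, h'⟩
        · rintro ⟨h1, h2, h3⟩
          exact ⟨Or.inr ⟨h1, h2⟩, h3⟩
      rw [this, Finset.card_erase_of_mem (Finset.mem_sdiff.2 hj), hN]; rfl

/-- One round of the bit matcher: the upper half of the odd entries goes up, the lower half goes
down. -/
theorem decomp_match {X : ι → ℤ} {n : ℤ} {U : Finset ι} (hpar : (∑ i, X i) % 2 = 0)
    (hU : ∀ i ∈ U, X i % 2 = 1)
    (hcard : 2 * U.card = (Finset.univ.filter fun i => X i % 2 = 1).card)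
    (htop : ∀ i ∈ U, ∀ j, X j % 2 = 1 → j ∉ U → LexLe (X j) (X i)) :
    Decomp X n ↔ Decomp (fun i => X i + if i ∈ U then 1 else if X i % 2 = 1 then -1 else 0)
      (n - (Finset.univ.filter fun i => X i % 2 = 1).card) := by
  set O := Finset.univ.filter fun i => X i % 2 = 1 with hO
  have memO : ∀ i, i ∈ O ↔ X i % 2 = 1 := fun i => by simp [O]
  have hX2 : ∀ i, (X i + if i ∈ U then 1 else if X i % 2 = 1 then -1 else 0) =
      2 * (X i / 2 + if i ∈ U then 1 else 0) := fun i => by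
    have := hU i
    split_ifs <;> grind
  have hUO : U ⊆ O := fun i hi => (memO i).2 (hU i hi)
  constructor
  · intro h
    obtain ⟨D, C, m, hD, hC, hn, hX, hs⟩ := h.exists_normal_step
    have hsum : ∑ x, X x = ∑ x, D x + 2 * ∑ x, C x := by
      rw [Finset.mul_sum, ← Finset.sum_add_distrib]; exact Finset.sum_congr rfl fun x _ => hX x
    -- Exactly the odd entries carry a nonzero digit, and a digit `-1` means that the half is
    -- rounded up. Since the digits sum to zero, `S` is half of the odd entries and can be exchanged
    -- for `U`.
    set S := Finset.univ.filter fun i => D i = -1 with hS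
    have memS : ∀ i, i ∈ S ↔ D i = -1 := fun i => by simp [S]
    have hSO : S ⊆ O := fun i hi => (memO i).2 (by have := (memS i).1 hi; have := hX i; omega)
    have hDval : ∀ i, D i = (if i ∈ O then 1 else 0) - 2 * (if i ∈ S then 1 else 0) := fun i => by
      have := hs i
      have := hX i
      simp only [memO, memS]
      split_ifs <;> omega
    have hDabs : ∀ i, |D i| = if i ∈ O then 1 else 0 := fun i => by
      have := hX i
      rcases hs i with h | h | h <;> simp only [memO, h] <;> split_ifs <;> simp <;> omega
    have e1 : ∑ i, D i = O.card - 2 * S.card := by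
      simp only [hDval, Finset.sum_sub_distrib, ← Finset.mul_sum, Finset.sum_boole]
      simp
    have e2 : ∑ i, |D i| = O.card := by
      simp only [hDabs, Finset.sum_boole]; simp
    have hC' : Decomp (fun i => X i / 2 + if i ∈ S then 1 else 0) m := hC.congr fun i => by
      have := hX i
      have := hs i
      simp only [memS]
      split_ifs <;> omega
    have := hC'.exchange_set (U := U) hSO hUO (by omega) fun i hi j hj hjU =>
      (htop i hi j ((memO j).1 hj) hjU).half_of_odd ((memO j).1 hj)
    exact (this.mono (by omega)).double.congr hX2
  · intro h
    have hC : Decomp (fun i => X i / 2 + if i ∈ U then 1 else 0) (n - O.card) :=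
      (h.congr fun i => (hX2 i).symm).of_double
    set D : ι → ℤ := fun i => (if i ∈ O then 1 else 0) - 2 * (if i ∈ U then 1 else 0)
    have hDabs : ∀ i, |D i| = if i ∈ O then 1 else 0 := fun i => by
      have := @hUO i
      by_cases h1 : i ∈ U
      · simp [D, h1, this h1]
      · by_cases h2 : i ∈ O <;> simp [D, h1, h2]
    refine .step _ D _ n _ (Or.inl ?_) hC ?_ fun i => ?_
    · simp only [D, Finset.sum_sub_distrib, ← Finset.mul_sum, Finset.sum_boole]
      simp
      omega
    · simp only [hDabs, Finset.sum_boole]; simp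
    · have h1 := hX2 i
      have h2 := hU i
      have h3 := memO i
      simp only [D, h3]
      split_ifs <;> grind

end Exchange
end TrafficSplit

/-! ### Complexity expressed by signed digit decompositions. -/

namespace TrafficSplit

section Complexity

theorem Decomp.add_move {ι : Type*} [Fintype ι] [DecidableEq ι] {X : ι → ℤ} {n : ℤ}
    (h : Decomp X n) (l : ℕ) (i j : ι) :
    Decomp (fun x => X x + (if x = i then 2 ^ l else 0) - if x = j then 2 ^ l else 0) (n + 2) := by
  induction l generalizing X n with
  | zero => exact h.shift i j
  | succ l ih =>
    obtain ⟨D, C, m, hD, hC, hn, hX⟩ := h.exists_step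
    refine .step _ D _ _ _ hD (ih hC) (by omega) fun x => ?_
    rw [hX, pow_succ]
    split_ifs <;> ring

/-- In a vector of sum zero every digit vector has coordinate sum zero, by parity at each level in
turn. A lone unit at level `l` is thus allowed, and it costs 1 where a move costs 2. -/
theorem Decomp.add_top {ι : Type*} [Fintype ι] [DecidableEq ι] {X : ι → ℤ} {n : ℤ}
    (h : Decomp X n) (hsum : ∑ i, X i = 0) (l : ℕ) (j : ι) :
    Decomp (fun x => X x + if x = j then 2 ^ l else 0) (n + 1) := by
  induction l generalizing X n with
  | zero =>
    obtain ⟨D, C, m, hD, hC, hn, hX⟩ := h.exists_step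
    have h1 : ∑ x, X x = ∑ x, D x + 2 * ∑ x, C x := by
      rw [Finset.mul_sum, ← Finset.sum_add_distrib]; exact Finset.sum_congr rfl fun x _ => hX x
    refine .step _ (fun x => D x + if x = j then 1 else 0) C _ m ?_ hC ?_ fun x => ?_
    · simp only [Finset.sum_add_distrib, Finset.sum_ite_eq', Finset.mem_univ, if_true]
      omega
    · have : ∑ x, |D x + if x = j then 1 else 0| ≤ ∑ x, (|D x| + if x = j then 1 else 0) := by
        refine Finset.sum_le_sum fun x _ => ?_
        split_ifs <;> grind
      simp only [Finset.sum_add_distrib, Finset.sum_ite_eq', Finset.mem_univ, if_true] at this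
      omega
    · simp only [hX, pow_zero]; ring
  | succ l ih =>
    obtain ⟨D, C, m, hD, hC, hn, hX⟩ := h.exists_step
    have h1 : ∑ x, X x = ∑ x, D x + 2 * ∑ x, C x := by
      rw [Finset.mul_sum, ← Finset.sum_add_distrib]; exact Finset.sum_congr rfl fun x _ => hX x
    refine .step _ D _ _ _ hD (ih hC (by omega)) (by omega) fun x => ?_
    rw [hX, pow_succ]
    split_ifs <;> ring

variable {k : ℕ}

theorem sum_apply_move (W : ℕ) (X : Fin k → ℤ) (i j : Fin k) (hij : i ≠ j) (l : ℕ) :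
    ∑ x, Transaction.apply W X (.move i j hij l) x = ∑ x, X x := by
  simp [Transaction.apply, Finset.sum_add_distrib]

theorem sum_apply_toBot (W : ℕ) (X : Fin k → ℤ) (j : Fin k) :
    ∑ x, Transaction.apply W X (.toBot j) x = ∑ x, X x - 2 ^ W := by
  simp [Transaction.apply]

/-- The sequence is read backwards from the zero vector, each move adding 2 to the cost and the
dummy 1. Only the dummy changes the sum, so sum `0` means that none is left and sum `2 ^ W` that
exactly one is; the induction needs both cases, and nonnegativity of the sum to exclude any other.
-/
theorem decomp_of_foldl (W : ℕ) (s : List (Transaction k)) (X : Fin k → ℤ)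
    (h : s.foldl (Transaction.apply W) X = 0) :
    0 ≤ ∑ i, X i ∧ (∑ i, X i = 0 → Decomp X (2 * s.length)) ∧
      (∑ i, X i = 2 ^ W → Decomp X (2 * s.length - 1)) := by
  have hW : (0 : ℤ) < 2 ^ W := by positivity
  induction s generalizing X with
  | nil =>
    simp only [List.foldl_nil] at h
    subst h
    exact ⟨by simp, fun _ => .zero _ _ (by simp) (by simp), fun h => by simp at h; omega⟩
  | cons a s ih =>
    rw [List.foldl_cons] at h
    obtain ⟨h1, h2, h3⟩ := ih _ h
    simp only [List.length_cons]
    cases a with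
    | move i j hij l =>
      rw [sum_apply_move] at h1 h2 h3
      have key : ∀ n, Decomp (Transaction.apply W X (.move i j hij l)) n → Decomp X (n + 2) := by
        intro n hn
        refine (hn.add_move l i j).congr fun x => ?_
        simp only [Transaction.apply, Pi.add_apply, Pi.sub_apply, Pi.single_apply]
        ring
      exact ⟨h1, fun h => (key _ (h2 h)).mono (by push_cast; omega),
        fun h => (key _ (h3 h)).mono (by push_cast; omega)⟩
    | toBot j =>
      rw [sum_apply_toBot] at h1 h2 h3
      refine ⟨by omega, fun h => by omega, fun h => ?_⟩
      refine (((h2 (by omega)).add_top (by rw [sum_apply_toBot]; omega) W j).congr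
        fun x => ?_).mono (n := 2 * s.length + 1) (by push_cast; omega)
      simp [Transaction.apply, Pi.single_apply]

/-- A nonzero vector of sum zero has a positive and a negative entry; one move cancels a unit of
each and lowers the norm by 2. -/
theorem exists_moves (W l : ℕ) (D : Fin k → ℤ) (hD : ∑ i, D i = 0) :
    ∃ s : List (Transaction k), (∀ Y : Fin k → ℤ,
      s.foldl (Transaction.apply W) (fun i => Y i + 2 ^ l * D i) = Y) ∧
      2 * (s.length : ℤ) ≤ ∑ i, |D i| := by
  obtain ⟨N, hN⟩ : ∃ N : ℕ, ∑ i, |D i| = N :=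
    ⟨_, (Int.toNat_of_nonneg (Finset.sum_nonneg fun i _ => abs_nonneg _)).symm⟩
  induction N using Nat.strong_induction_on generalizing D with
  | _ N ih =>
  by_cases h0 : ∀ i, D i = 0
  · exact ⟨[], fun Y => by simp [h0], by simp [h0]⟩
  push Not at h0
  obtain ⟨i₀, hi₀⟩ := h0
  obtain ⟨i, hi⟩ : ∃ i, 0 < D i := by
    by_contra! hc
    exact hi₀ ((Finset.sum_eq_zero_iff_of_nonpos fun i _ => hc i).1 hD i₀ (Finset.mem_univ _))
  obtain ⟨j, hj⟩ : ∃ j, D j < 0 := by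
    by_contra! hc
    exact hi₀ ((Finset.sum_eq_zero_iff_of_nonneg fun i _ => hc i).1 hD i₀ (Finset.mem_univ _))
  have hij : i ≠ j := by rintro rfl; omega
  have e2 := sum_two (f := fun x => |shift D j i x|) (g := fun x => |D x|) hij
    (fun a h1 h2 => by simp [shift, h1, h2])
  simp only [shift, hij, Ne.symm hij, if_true, if_false] at e2
  have e3 : |D i + 0 - 1| = |D i| - 1 := by grind
  have e4 : |D j + 1 - 0| = |D j| - 1 := by grind
  rw [e3, e4] at e2
  have h1 : ∑ x, |shift D j i x| = N - 2 := by simp only [shift]; omega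
  have h2 : 0 ≤ ∑ x, |shift D j i x| := Finset.sum_nonneg fun i _ => abs_nonneg _
  obtain ⟨s, hs, hlen⟩ := ih (N - 2) (by omega) (shift D j i) (by rw [sum_shift, hD]) (by omega)
  refine ⟨.move i j hij l :: s, fun Y => ?_, by simp only [List.length_cons]; push_cast; omega⟩
  rw [List.foldl_cons]
  convert hs Y using 2
  funext x
  simp only [Transaction.apply, Pi.add_apply, Pi.sub_apply, Pi.single_apply, shift]
  split_ifs <;> ring

/-- Here `l` is the level already reached. Digit vectors of sum zero are turned into moves. If the
sum is `2 ^ v`, parity keeps the digit sums zero until `v = 0`, that is until level `W`; there the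
digit sum is 1, the dummy transaction removes a unit from a positive digit, and what remains sums to
zero. -/
theorem Decomp.exists_transactions {X : Fin k → ℤ} {n : ℤ} (h : Decomp X n) (W l : ℕ) :
    (∑ i, X i = 0 → ∃ s : List (Transaction k),
      s.foldl (Transaction.apply W) (fun i => 2 ^ l * X i) = 0 ∧ 2 * (s.length : ℤ) ≤ n) ∧
    (∀ v, l + v = W → ∑ i, X i = 2 ^ v → ∃ s : List (Transaction k),
      s.foldl (Transaction.apply W) (fun i => 2 ^ l * X i) = 0 ∧ 2 * (s.length : ℤ) ≤ n + 1) := by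
  induction h generalizing l with
  | zero X n hX hn =>
    refine ⟨fun _ => ⟨[], by ext; simp [hX], by simpa⟩, fun v _ h => ?_⟩
    have : (0 : ℤ) < 2 ^ v := by positivity
    simp only [hX, Finset.sum_const_zero] at h
    omega
  | step X D C n m hD hC hn hX ih =>
    have hsum : ∑ x, X x = ∑ x, D x + 2 * ∑ x, C x := by
      rw [Finset.mul_sum, ← Finset.sum_add_distrib]; exact Finset.sum_congr rfl fun x _ => hX x
    have h00 : ∑ i, X i = 0 → ∑ i, D i = 0 ∧ ∑ i, C i = 0 := by clear ih; omega
    have h11 : ∑ i, X i = 1 → ∑ i, D i = 1 ∧ ∑ i, C i = 0 := by clear ih; omega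
    have hvv : ∀ y : ℤ, ∑ i, X i = y * 2 → ∑ i, D i = 0 ∧ ∑ i, C i = y := by clear ih; omega
    obtain ⟨ih0, ihv⟩ := ih (l + 1)
    clear ih hsum
    have hXl : (fun i => 2 ^ l * X i) = fun i => 2 ^ (l + 1) * C i + 2 ^ l * D i := by
      funext i; rw [hX, pow_succ]; ring
    have comb : ∑ i, D i = 0 → ∀ s : List (Transaction k),
        s.foldl (Transaction.apply W) (fun i => 2 ^ (l + 1) * C i) = 0 →
        ∃ s' : List (Transaction k), s'.foldl (Transaction.apply W) (fun i => 2 ^ l * X i) = 0 ∧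
          2 * (s'.length : ℤ) ≤ ∑ i, |D i| + 2 * (s.length : ℤ) := fun h0 s hs => by
      obtain ⟨t, ht, ht'⟩ := exists_moves W l D h0
      refine ⟨t ++ s, ?_, by simp only [List.length_append]; push_cast; omega⟩
      rw [List.foldl_append, hXl, ht, hs]
    constructor
    · intro h0
      obtain ⟨s, hs, hs'⟩ := ih0 (h00 h0).2
      obtain ⟨s', h1, h2⟩ := comb (h00 h0).1 s hs
      exact ⟨s', h1, by linarith⟩
    · intro v hv h0
      cases v with
      | zero =>
        obtain ⟨hD1, hC0⟩ := h11 (by simpa using h0)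
        obtain ⟨s, hs, hs'⟩ := ih0 hC0
        obtain ⟨j, -, hj⟩ := Finset.exists_lt_of_sum_lt (s := Finset.univ) (f := fun _ => (0 : ℤ))
          (g := D) (by simp [hD1])
        have e2 := sum_sub_sum_of_eq_off (f := fun x => |D x - if x = j then 1 else 0|)
          (g := fun x => |D x|) {j} (fun x hx => by simp at hx; simp [hx])
        simp only [Finset.sum_singleton, if_true] at e2
        have e3 : |D j - 1| = |D j| - 1 := by rw [abs_of_pos hj, abs_of_nonneg (by linarith [Int.add_one_le_iff.2 hj])]
        obtain ⟨t, ht, ht'⟩ := exists_moves W l (fun x => D x - if x = j then 1 else 0)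
          (by simp [Finset.sum_sub_distrib, hD1])
        refine ⟨.toBot j :: (t ++ s), ?_, by
          simp only [List.length_cons, List.length_append]; push_cast; linarith⟩
        rw [List.foldl_cons, List.foldl_append, hXl]
        convert hs using 2
        convert ht (fun i => 2 ^ (l + 1) * C i) using 2
        funext x
        obtain rfl : l = W := by omega
        simp only [Transaction.apply, Pi.sub_apply, Pi.single_apply]
        split_ifs <;> ring
      | succ v =>
        rw [pow_succ] at h0
        obtain ⟨hD0, hC0⟩ := hvv _ h0
        obtain ⟨s, hs, hs'⟩ := ihv v (by clear ih0 ihv comb; omega) hC0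
        obtain ⟨s', h1, h2⟩ := comb hD0 s hs
        exact ⟨s', h1, by linarith⟩

theorem IsPartition.sum_cast {W : ℕ} {P : Fin k → ℕ} (hP : IsPartition W P) :
    ∑ i, (P i : ℤ) = 2 ^ W := by
  exact_mod_cast hP

theorem IsPartition.pos {W : ℕ} {P : Fin k → ℕ} (hP : IsPartition W P) : 0 < k := by
  rcases Nat.eq_zero_or_pos k with rfl | h
  · have : 0 < 2 ^ W := by positivity
    simp only [IsPartition, Finset.univ_eq_empty, Finset.sum_empty] at hP
    omega
  · exact h

/-- Needed because the infimum of the empty set is `0`: without an inducing sequence, a small value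
of `complexity` would say nothing. -/
theorem IsPartition.exists_induces {W : ℕ} {P : Fin k → ℕ} (hP : IsPartition W P) :
    ∃ s : List (Transaction k), Induces W s P := by
  let j : Fin k := ⟨0, hP.pos⟩
  have hs : ∑ x, ((P x : ℤ) - if x = j then 2 ^ W else 0) = 0 := by
    simp [Finset.sum_sub_distrib, hP.sum_cast]
  have h0 : Decomp (fun x => (P x : ℤ) - if x = j then 2 ^ W else 0) _ :=
    .step _ _ 0 _ 0 (Or.inl hs) (.zero _ _ (by simp) le_rfl) le_rfl (by simp)
  have h1 := (h0.add_top hs W j).congr (Y := fun x => (P x : ℤ)) (by simp)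
  obtain ⟨s, hs, -⟩ := (h1.exists_transactions W 0).2 W (by simp) hP.sum_cast
  exact ⟨s, by simpa [Induces] using hs⟩

/-- A sequence of length `n` consists of `n - 1` moves of cost 2 and one dummy transaction of cost
1, whence the budget `2 * n - 1`. -/
theorem complexity_le_iff {W n : ℕ} {P : Fin k → ℕ} (hP : IsPartition W P) :
    complexity W P ≤ n ↔ Decomp (fun i => (P i : ℤ)) (2 * n - 1) := by
  constructor
  · intro h
    obtain ⟨s₀, hs₀⟩ := hP.exists_induces
    obtain ⟨s, hs, hlen⟩ := Nat.sInf_mem (⟨_, s₀, hs₀, rfl⟩ :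
      {m | ∃ s : List (Transaction k), Induces W s P ∧ s.length = m}.Nonempty)
    have hlen' : s.length ≤ n := by rw [hlen]; exact h
    exact ((decomp_of_foldl W s _ hs).2.2 hP.sum_cast).mono (by omega)
  · intro h
    obtain ⟨s, hs, hlen⟩ := (h.exists_transactions W 0).2 W (by simp) hP.sum_cast
    have hle : complexity W P ≤ s.length := Nat.sInf_le ⟨s, by simpa [Induces] using hs, rfl⟩
    omega

end Complexity
end TrafficSplit

/-! ### The shape of an optimal rounding. -/

namespace TrafficSplit

section Rounding
variable {ι : Type*} [Fintype ι] [DecidableEq ι]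

theorem LexLe.half_of_even {x y : ℤ} (h : LexLe x y) (hy : y % 2 = 0) : LexLe (x / 2) (y / 2) := by
  cases h with
  | refl => exact .refl _
  | parity _ _ h1 h2 => omega
  | half _ _ h1 h2 => exact h2

/-- A vector between `lo` and `lo + 1` can be replaced by one that is one larger on a top set. -/
theorem Decomp.round_unit {lo hi Y : ι → ℤ} {n : ℤ} {S : Finset ι} (hhi : ∀ i, hi i ≤ lo i + 1)
    (hY : ∀ i, lo i ≤ Y i ∧ Y i ≤ hi i) (hS : ∀ i ∈ S, lo i ≠ hi i)
    (hsum : ∑ i, lo i + S.card = ∑ i, Y i)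
    (htop : ∀ i ∈ S, ∀ j, lo j ≠ hi j → j ∉ S → LexLe (lo j) (lo i)) (h : Decomp Y n) :
    Decomp (fun i => lo i + if i ∈ S then 1 else 0) n := by
  have hYval : ∀ i, Y i = lo i + if i ∈ Finset.univ.filter (fun i => Y i ≠ lo i) then 1 else 0 :=
    fun i => by
      have := hY i
      have := hhi i
      simp only [Finset.mem_filter, Finset.mem_univ, true_and]
      split_ifs <;> omega
  have hYsum : ∑ i, Y i = ∑ i, lo i + (Finset.univ.filter fun i => Y i ≠ lo i).card := by
    rw [Finset.sum_congr rfl fun i _ => hYval i, Finset.sum_add_distrib, Finset.sum_boole]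
    simp
  refine Decomp.exchange_set (c := Finset.univ.filter fun i => lo i ≠ hi i)
    (S := Finset.univ.filter fun i => Y i ≠ lo i) (fun i hi => ?_) (fun i hi => ?_) (by omega)
    (fun i hi j hj => ?_) (h.congr fun i => (hYval i).symm)
  · have := hY i
    simp only [Finset.mem_filter, Finset.mem_univ, true_and] at hi ⊢
    omega
  · simpa using hS i hi
  · exact htop i hi j (by simpa using hj)

/-- The lowest even point of `[a, b]`, or the only point of the interval. -/
def evenLo (a b : ℤ) : ℤ := if a = b then a else a + a % 2
/-- The highest even point of `[a, b]`, or the only point of the interval. -/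
def evenHi (a b : ℤ) : ℤ := if a = b then a else b - b % 2

/-- The position of the sum relative to the even points decides. Above the highest even points all
entries can be brought between that point and `b`; below the lowest ones the situation is mirrored;
in between all entries can be made even, and halving leaves two neighbouring values. In each case
the entries to be increased may be taken as a top set of the bit order. -/
theorem Decomp.round_box {a b X lo hi : ι → ℤ} {n inc : ℤ} {S : Finset ι}
    (hab : ∀ i, a i ≤ b i ∧ b i ≤ a i + 3)
    (hO : ∀ j, a j = b j → a j % 2 = 1 → ∀ i, b i ≤ a i + 1)
    (hX : ∀ i, a i ≤ X i ∧ X i ≤ b i) (hpar : (∑ i, X i) % 2 = 0)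
    (hmode :
      ((∀ i, lo i = evenHi (a i) (b i) ∧ hi i = b i) ∧ inc = 1 ∧
        ∑ i, evenHi (a i) (b i) ≤ ∑ i, X i) ∨
      ((∀ i, lo i = a i ∧ hi i = evenLo (a i) (b i)) ∧ inc = 1 ∧
        ∑ i, X i ≤ ∑ i, evenLo (a i) (b i)) ∨
      ((∀ i, lo i = evenLo (a i) (b i) ∧ hi i = evenHi (a i) (b i)) ∧ inc = 2 ∧
        ∑ i, evenLo (a i) (b i) ≤ ∑ i, X i ∧ ∑ i, X i ≤ ∑ i, evenHi (a i) (b i)))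
    (hS : ∀ i ∈ S, lo i ≠ hi i) (hsum : ∑ i, lo i + inc * S.card = ∑ i, X i)
    (htop : ∀ i ∈ S, ∀ j, lo j ≠ hi j → j ∉ S → LexLe (lo j) (lo i)) (h : Decomp X n) :
    Decomp (fun i => lo i + if i ∈ S then inc else 0) n := by
  have high : ∀ S : Finset ι, (∀ i ∈ S, evenHi (a i) (b i) ≠ b i) →
      ∑ i, evenHi (a i) (b i) + S.card = ∑ i, X i →
      (∀ i ∈ S, ∀ j, evenHi (a j) (b j) ≠ b j → j ∉ S →
        LexLe (evenHi (a j) (b j)) (evenHi (a i) (b i))) →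
      Decomp (fun i => evenHi (a i) (b i) + if i ∈ S then 1 else 0) n := by
    intro S hS hsum htop
    obtain ⟨Y, hY, hYs, hYd⟩ := h.exists_beyond (q := fun i => evenHi (a i) (b i)) (e := b) (s := 1)
      (by simp) hX (fun i => by have := hab i; simp only [evenHi]; split_ifs <;> omega)
      (fun i x _ hx => by omega) (fun i => by simp only [evenHi]; split_ifs <;> omega)
      (fun i => by simp only [evenHi]; split_ifs <;> omega)
      (fun j hj i x h1 h2 => by
        have h3 : a j = b j ∧ a j % 2 = 1 := by
          simp only [evenHi] at hj; split_ifs at hj <;> omega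
        have := hO j h3.1 h3.2 i
        simp only [evenHi]; split_ifs <;> omega)
      (by omega) hpar
    exact hYd.round_unit (hi := b) (fun i => by simp only [evenHi]; split_ifs <;> omega)
      (fun i => ⟨by have := hY i; omega, (hY i).2.1⟩) hS (by omega) htop
  rcases hmode with ⟨hlh, rfl, hs⟩ | ⟨hlh, rfl, hs⟩ | ⟨hlh, rfl, hs1, hs2⟩
  · obtain rfl : lo = fun i => evenHi (a i) (b i) := funext fun i => (hlh i).1
    obtain rfl : hi = b := funext fun i => (hlh i).2
    exact high S hS (by simpa using hsum) htop
  · obtain rfl : lo = a := funext fun i => (hlh i).1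
    obtain rfl : hi = fun i => evenLo (lo i) (b i) := funext fun i => (hlh i).2
    obtain ⟨Y, hY, hYs, hYd⟩ := h.exists_beyond (q := fun i => evenLo (lo i) (b i)) (e := lo)
      (s := -1) (by simp) hX (fun i => by have := hab i; simp only [evenLo]; split_ifs <;> omega)
      (fun i x hx _ => by omega) (fun i => by simp only [evenLo]; split_ifs <;> omega)
      (fun i => by simp only [evenLo]; split_ifs <;> omega)
      (fun j hj i x h1 h2 => by
        have h3 : lo j = b j ∧ lo j % 2 = 1 := by
          simp only [evenLo] at hj; split_ifs at hj <;> omega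
        have := hO j h3.1 h3.2 i
        simp only [evenLo]; split_ifs <;> omega)
      (by omega) hpar
    exact hYd.round_unit (fun i => by simp only [evenLo]; split_ifs <;> omega)
      (fun i => ⟨(hY i).1, by have := hY i; omega⟩) hS (by omega) htop
  · obtain rfl : lo = fun i => evenLo (a i) (b i) := funext fun i => (hlh i).1
    obtain rfl : hi = fun i => evenHi (a i) (b i) := funext fun i => (hlh i).2
    -- A box consisting of one odd point has no even point. But then `hO` makes all boxes so short
    -- that the lowest and highest even points coincide, and nothing is left to choose.
    by_cases hOO : ∃ j, a j = b j ∧ a j % 2 = 1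
    · obtain ⟨j, hj1, hj2⟩ := hOO
      have heq : ∀ i, evenLo (a i) (b i) = evenHi (a i) (b i) := fun i => by
        have := hO j hj1 hj2 i
        have := hab i
        simp only [evenLo, evenHi]; split_ifs <;> omega
      have hSe : S = ∅ := Finset.eq_empty_of_forall_notMem fun i hi => hS i hi (heq i)
      subst hSe
      refine (high ∅ (by simp) ?_ (by simp)).congr fun i => by simp [heq]
      simpa [heq] using hsum
    · push Not at hOO
      have hLo : ∀ i, evenLo (a i) (b i) = 2 * ((a i + 1) / 2) := fun i => by
        have := hOO i
        simp only [evenLo]; split_ifs <;> omega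
      have hHi : ∀ i, evenHi (a i) (b i) = 2 * (b i / 2) := fun i => by
        have := hOO i
        simp only [evenHi]; split_ifs <;> omega
      simp only [hLo, hHi] at *
      obtain ⟨Y, hY, hYs, hYd⟩ := h.exists_even (fun i => by have := hab i; have := hOO i; omega) hX hs1
        hs2 hpar
      have hYd' : Decomp (fun i => Y i / 2) n :=
        (hYd.congr (Y := fun i => 2 * (Y i / 2)) fun i => by have := hY i; omega).of_double
      refine (hYd'.round_unit (lo := fun i => (a i + 1) / 2) (hi := fun i => b i / 2) (S := S)
        (fun i => by have := hab i; omega) (fun i => by have := hY i; omega)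
        (fun i hi => by have := hS i hi; omega) ?_ ?_).double.congr fun i => ?_
      · have : ∑ i, Y i = 2 * ∑ i, Y i / 2 := by
          rw [Finset.mul_sum]; exact Finset.sum_congr rfl fun i _ => by have := hY i; omega
        rw [← Finset.mul_sum] at hsum
        omega
      · intro i hi j hj hjS
        have := (htop i hi j (by omega) hjS).half_of_even (by omega)
        simpa using this
      · split_ifs <;> ring

/-- The digits below level `l` of a vector near `p` can be cleared if the tolerance is at least
`2 ^ l`. -/
theorem Decomp.exists_scaled {p A B Q : ι → ℤ} {E n : ℤ} {W l : ℕ} (hl : 2 ^ l ≤ E + 1) (hlW : l ≤ W)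
    (hp : ∀ i, 0 ≤ p i) (hA : ∀ i, A i = max 0 (p i - E)) (hB : ∀ i, B i = p i + E)
    (hsum : ∑ i, p i = 2 ^ W) (hQ : ∀ i, A i ≤ Q i ∧ Q i ≤ B i) (hQs : ∑ i, Q i = 2 ^ W)
    (h : Decomp Q n) :
    ∃ X : ι → ℤ, (∀ i, A i ≤ 2 ^ l * X i ∧ 2 ^ l * X i ≤ B i) ∧ ∑ i, X i = 2 ^ (W - l) ∧
      Decomp X n := by
  induction l with
  | zero => exact ⟨Q, by simpa using hQ, by simpa using hQs, h⟩
  | succ l ih =>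
    have h2l : (0 : ℤ) < 2 ^ l := by positivity
    have hpow : (2 : ℤ) ^ (l + 1) = 2 ^ l * 2 := pow_succ _ _
    obtain ⟨X, hX, hXs, hXd⟩ := ih (by omega) (by omega)
    have hW : (2 : ℤ) ^ W = 2 ^ l * 2 ^ (W - l) := by rw [← pow_add]; congr 1; omega
    have hWl : (2 : ℤ) ^ (W - l) = 2 * 2 ^ (W - (l + 1)) := by
      rw [← pow_succ']; congr 1; omega
    -- Rounding `p` down or up to a multiple of `2 ^ (l + 1)` stays within the tolerance. In units
    -- of `2 ^ l` this gives the even points `2 * u` and `2 * v` of each box, and their sums lie on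
    -- the two sides of the target. These are the conditions of `Decomp.exists_even`.
    set u : ι → ℤ := fun i => p i / 2 ^ (l + 1)
    set v : ι → ℤ := fun i => (p i + (2 ^ (l + 1) - 1)) / 2 ^ (l + 1)
    have hu : ∀ i, 2 ^ l * (2 * u i) ≤ p i ∧ p i < 2 ^ l * (2 * u i) + 2 ^ (l + 1) := fun i => by
      have h1 := Int.mul_ediv_add_emod (p i) (2 ^ (l + 1))
      have h2 := Int.emod_nonneg (p i) (show (2 : ℤ) ^ (l + 1) ≠ 0 by positivity)
      have h3 := Int.emod_lt_of_pos (p i) (show (0 : ℤ) < 2 ^ (l + 1) by positivity)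
      have h4 : (2 : ℤ) ^ l * (2 * u i) = 2 ^ (l + 1) * (p i / 2 ^ (l + 1)) := by
        simp only [u]; rw [hpow]; ring
      constructor <;> linarith
    have hv : ∀ i, p i ≤ 2 ^ l * (2 * v i) ∧ 2 ^ l * (2 * v i) < p i + 2 ^ (l + 1) := fun i => by
      have h1 := Int.mul_ediv_add_emod (p i + (2 ^ (l + 1) - 1)) (2 ^ (l + 1))
      have h2 := Int.emod_nonneg (p i + (2 ^ (l + 1) - 1)) (show (2 : ℤ) ^ (l + 1) ≠ 0 by positivity)
      have h3 := Int.emod_lt_of_pos (p i + (2 ^ (l + 1) - 1)) (show (0 : ℤ) < 2 ^ (l + 1) by positivity)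
      have h4 : (2 : ℤ) ^ l * (2 * v i) =
          2 ^ (l + 1) * ((p i + (2 ^ (l + 1) - 1)) / 2 ^ (l + 1)) := by
        simp only [v]; rw [hpow]; ring
      constructor <;> linarith
    set a : ι → ℤ := fun i => (A i + (2 ^ l - 1)) / 2 ^ l
    set b : ι → ℤ := fun i => B i / 2 ^ l
    have ha : ∀ i x, a i ≤ x ↔ A i ≤ 2 ^ l * x := fun i x => by
      simp only [a]
      rw [← Int.lt_add_one_iff, Int.ediv_lt_iff_lt_mul h2l]
      constructor <;> intro h <;> linarith
    have hb : ∀ i x, x ≤ b i ↔ 2 ^ l * x ≤ B i := fun i x => by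
      simp only [b]
      rw [Int.le_ediv_iff_mul_le h2l, mul_comm]
    have hau : ∀ i, a i ≤ 2 * u i := fun i => by
      rw [ha, hA]
      have := hu i
      have h0 : 0 ≤ u i := Int.ediv_nonneg (hp i) (by positivity)
      have h1 : 0 ≤ 2 ^ l * (2 * u i) := by positivity
      omega
    have hvb : ∀ i, 2 * v i ≤ b i := fun i => by
      rw [hb, hB]
      have := hv i
      omega
    have huv : ∀ i, u i ≤ v i := fun i => by
      refine Int.ediv_le_ediv (by positivity) ?_
      have : (0 : ℤ) < 2 ^ (l + 1) := by positivity
      omega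
    have hsl : ∑ i, 2 * ((a i + 1) / 2) ≤ ∑ i, X i := by
      have h1 : ∑ i, 2 * ((a i + 1) / 2) ≤ ∑ i, 2 * u i :=
        Finset.sum_le_sum fun i _ => by have := hau i; omega
      have h2 : 2 ^ l * ∑ i, 2 * u i ≤ 2 ^ l * 2 ^ (W - l) := by
        rw [← hW, ← hsum, Finset.mul_sum]
        exact Finset.sum_le_sum fun i _ => (hu i).1
      have h3 := le_of_mul_le_mul_left h2 h2l
      omega
    have hsh : ∑ i, X i ≤ ∑ i, 2 * (b i / 2) := by
      have h1 : ∑ i, 2 * v i ≤ ∑ i, 2 * (b i / 2) :=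
        Finset.sum_le_sum fun i _ => by have := hvb i; omega
      have h2 : 2 ^ l * 2 ^ (W - l) ≤ 2 ^ l * ∑ i, 2 * v i := by
        rw [← hW, ← hsum, Finset.mul_sum]
        exact Finset.sum_le_sum fun i _ => (hv i).1
      have h3 := le_of_mul_le_mul_left h2 h2l
      omega
    obtain ⟨Y, hY, hYs, hYd⟩ := hXd.exists_even (a := a) (b := b)
      (fun i => by have := hau i; have := hvb i; have := huv i; omega)
      (fun i => ⟨(ha i _).2 (hX i).1, (hb i _).2 (hX i).2⟩) hsl hsh (by omega)
    have hY2 : ∀ i, Y i = 2 * (Y i / 2) := fun i => by have := hY i; omega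
    refine ⟨fun i => Y i / 2, fun i => ?_, ?_, (hYd.congr fun i => (hY2 i).symm).of_double⟩
    · have h1 := (ha i _).1 (hY i).1
      have h2 := (hb i _).1 (hY i).2.1
      have h3 : (2 : ℤ) ^ (l + 1) * (Y i / 2) = 2 ^ l * Y i := by
        rw [hpow, mul_assoc, ← hY2]
      rw [h3]
      exact ⟨h1, h2⟩
    · have : ∑ i, Y i = 2 * ∑ i, Y i / 2 := by
        rw [Finset.mul_sum]; exact Finset.sum_congr rfl fun i _ => hY2 i
      change ∑ i, Y i / 2 = _
      omega

end Rounding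

/-! ### The rounding theorem in natural numbers, as the program computes it. -/

section RoundingNat
variable {k : ℕ}

theorem linftyDist_lt_iff {P' P : Fin k → ℕ} {e : ℕ} (he : 0 < e) :
    linftyDist P' P < e ↔ ∀ i, P' i < P i + e ∧ P i < P' i + e := by
  rw [linftyDist, Finset.sup_lt_iff (by simpa using he)]
  simp only [Finset.mem_univ, forall_true_left]
  exact forall_congr' fun i => by omega

/-- `Y` is an optimal partition at distance less than `e` from `P`. -/
def IsOptimalRounding (W : ℕ) (P : Fin k → ℕ) (e : ℕ) (Y : Fin k → ℕ) : Prop :=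
  IsPartition W Y ∧ linftyDist Y P < e ∧ ∀ Q : Fin k → ℕ, IsPartition W Q → linftyDist Q P < e →
    ∀ n : ℤ, Decomp (fun i => (Q i : ℤ)) n → Decomp (fun i => (Y i : ℤ)) n

/-- The least multiple of `2 ^ l` at distance less than `e` from `p`, divided by `2 ^ l`. -/
def boxLo (l e p : ℕ) : ℕ := (p - (e - 1) + (2 ^ l - 1)) / 2 ^ l
/-- The largest multiple of `2 ^ l` at distance less than `e` from `p`, divided by `2 ^ l`. -/
def boxHi (l e p : ℕ) : ℕ := (p + (e - 1)) / 2 ^ l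
/-- The least even point from `boxLo` to `boxHi`, or the only point. -/
def boxEvenLo (l e p : ℕ) : ℕ :=
  if boxLo l e p = boxHi l e p then boxLo l e p else boxLo l e p + boxLo l e p % 2
/-- The largest even point from `boxLo` to `boxHi`, or the only point. -/
def boxEvenHi (l e p : ℕ) : ℕ :=
  if boxLo l e p = boxHi l e p then boxLo l e p else boxHi l e p - boxHi l e p % 2

theorem boxLo_le_iff {l e p x : ℕ} : boxLo l e p ≤ x ↔ p - (e - 1) ≤ 2 ^ l * x := by
  have : 0 < 2 ^ l := by positivity
  rw [boxLo, ← Nat.lt_succ_iff, Nat.div_lt_iff_lt_mul this, Nat.succ_mul, mul_comm x]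
  omega

theorem le_boxHi_iff {l e p x : ℕ} : x ≤ boxHi l e p ↔ 2 ^ l * x ≤ p + (e - 1) := by
  have : 0 < 2 ^ l := by positivity
  rw [boxHi, Nat.le_div_iff_mul_le this, mul_comm]

theorem boxLo_le_div {l e p : ℕ} (hl : 2 ^ l ≤ e) : boxLo l e p ≤ p / 2 ^ l := by
  rw [boxLo_le_iff]
  have h1 := Nat.div_add_mod p (2 ^ l)
  have h2 := Nat.mod_lt p (show 2 ^ l > 0 by positivity)
  omega

theorem div_le_boxHi {l e p : ℕ} (hl : 2 ^ l ≤ e) : (p + (2 ^ l - 1)) / 2 ^ l ≤ boxHi l e p :=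
  Nat.div_le_div_right (by omega)

theorem boxLo_le_boxHi {l e p : ℕ} (hl : 2 ^ l ≤ e) : boxLo l e p ≤ boxHi l e p :=
  (boxLo_le_div hl).trans (Nat.div_le_div_right (by omega))

/-- The admissible interval has length at most `2 * (e - 1)`, less than `4 * 2 ^ l`, and thus
contains at most four multiples of `2 ^ l`. -/
theorem boxHi_le_boxLo_add {l e p : ℕ} (hl : 2 ^ l ≤ e) (hl' : e < 2 ^ (l + 1)) :
    boxHi l e p ≤ boxLo l e p + 3 := by
  have h1 := (boxLo_le_iff (l := l) (e := e) (p := p)).1 le_rfl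
  have h2 := (le_boxHi_iff (l := l) (e := e) (p := p)).1 le_rfl
  by_contra hc
  have h3 := Nat.mul_le_mul_left (2 ^ l) (show boxLo l e p + 4 ≤ boxHi l e p by omega)
  rw [pow_succ] at hl'
  rw [mul_add] at h3
  omega

/-- If a box has only one point, and that point is not zero, then both neighbouring multiples are
missed, so `2 * e ≤ 2 * 2 ^ l`; every interval is then too short for three multiples. Oddness only
serves to exclude the point `0`, where the box may be cut off by nonnegativity. -/
theorem boxHi_le_boxLo_add_one {l e p p' : ℕ} (hl : 2 ^ l ≤ e)
    (hp' : boxLo l e p' = boxHi l e p') (hodd : boxLo l e p' % 2 = 1) :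
    boxHi l e p ≤ boxLo l e p + 1 := by
  have h0 := (boxLo_le_iff (l := l) (e := e) (p := p') (x := boxLo l e p' - 1)).not.1 (by omega)
  have h0' := (le_boxHi_iff (l := l) (e := e) (p := p') (x := boxLo l e p' + 1)).not.1 (by omega)
  have h3 : 2 ^ l * (boxLo l e p' + 1) = 2 ^ l * (boxLo l e p' - 1) + 2 * 2 ^ l := by
    rw [show boxLo l e p' + 1 = (boxLo l e p' - 1) + 2 by omega]; ring
  have h1 := (boxLo_le_iff (l := l) (e := e) (p := p)).1 le_rfl
  have h2 := (le_boxHi_iff (l := l) (e := e) (p := p)).1 le_rfl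
  by_contra hc
  have h4 := Nat.mul_le_mul_left (2 ^ l) (show boxLo l e p + 2 ≤ boxHi l e p by omega)
  rw [mul_add] at h4
  omega

theorem boxEven_bounds {l e p : ℕ} (hl : 2 ^ l ≤ e) :
    boxLo l e p ≤ boxEvenLo l e p ∧ boxEvenLo l e p ≤ boxLo l e p + 1 ∧
    boxEvenLo l e p ≤ boxEvenHi l e p ∧
    boxEvenHi l e p ≤ boxHi l e p ∧ boxHi l e p ≤ boxEvenHi l e p + 1 ∧
    (boxEvenLo l e p ≠ boxEvenHi l e p → boxEvenLo l e p % 2 = 0 ∧ boxEvenHi l e p % 2 = 0) := by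
  have h1 := boxLo_le_boxHi (p := p) hl
  simp only [boxEvenLo, boxEvenHi]
  split_ifs <;> omega

/-- The three modes of rounding: the entries `lo` may be increased by `inc` to `hi`. -/
def RoundMode (W : ℕ) (P : Fin k → ℕ) (l e : ℕ) (lo hi : ℕ → ℕ) (inc : ℕ) : Prop :=
  (lo = boxEvenHi l e ∧ hi = boxHi l e ∧ inc = 1 ∧ ∑ i, boxEvenHi l e (P i) ≤ 2 ^ (W - l)) ∨
  (lo = boxLo l e ∧ hi = boxEvenLo l e ∧ inc = 1 ∧ 2 ^ (W - l) ≤ ∑ i, boxEvenLo l e (P i)) ∨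
  (lo = boxEvenLo l e ∧ hi = boxEvenHi l e ∧ inc = 2 ∧ ∑ i, boxEvenLo l e (P i) ≤ 2 ^ (W - l) ∧
    2 ^ (W - l) ≤ ∑ i, boxEvenHi l e (P i))

theorem RoundMode.hi_eq {W : ℕ} {P : Fin k → ℕ} {l e : ℕ} {lo hi : ℕ → ℕ} {inc : ℕ}
    (h : RoundMode W P l e lo hi inc) (hl : 2 ^ l ≤ e) (hl' : e < 2 ^ (l + 1)) (p : ℕ) :
    hi p = lo p + (if lo p ≠ hi p then inc else 0) ∧ boxLo l e p ≤ lo p ∧ hi p ≤ boxHi l e p := by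
  have h1 := boxEven_bounds (p := p) hl
  have h2 := boxHi_le_boxLo_add (p := p) hl hl'
  rcases h with ⟨rfl, rfl, rfl, -⟩ | ⟨rfl, rfl, rfl, -⟩ | ⟨rfl, rfl, rfl, -⟩ <;> split_ifs <;> omega

theorem IsPartition.sum_box_le {W : ℕ} {P : Fin k → ℕ} (hP : IsPartition W P) {l e : ℕ}
    (hl : 2 ^ l ≤ e) (hlW : l ≤ W) :
    ∑ i, boxLo l e (P i) ≤ 2 ^ (W - l) ∧ 2 ^ (W - l) ≤ ∑ i, boxHi l e (P i) := by
  have h2l : 0 < 2 ^ l := by positivity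
  have hW : 2 ^ W = 2 ^ l * 2 ^ (W - l) := by rw [← pow_add]; congr 1; omega
  constructor
  · refine le_of_mul_le_mul_left (a := 2 ^ l) ?_ h2l
    rw [← hW, ← show ∑ i, P i = 2 ^ W from hP, Finset.mul_sum]
    exact Finset.sum_le_sum fun i _ =>
      (Nat.mul_le_mul_left _ (boxLo_le_div hl)).trans (Nat.mul_div_le _ _)
  · refine le_of_mul_le_mul_left (a := 2 ^ l) ?_ h2l
    rw [← hW, ← show ∑ i, P i = 2 ^ W from hP, Finset.mul_sum]
    refine Finset.sum_le_sum fun i _ => le_trans ?_ (Nat.mul_le_mul_left _ (div_le_boxHi hl))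
    have h1 := Nat.div_add_mod (P i + (2 ^ l - 1)) (2 ^ l)
    have h2 := Nat.mod_lt (P i + (2 ^ l - 1)) h2l
    omega

/-- The number of entries to increase exists. -/
theorem RoundMode.exists_count {W : ℕ} {P : Fin k → ℕ} (hP : IsPartition W P) {l e : ℕ}
    {lo hi : ℕ → ℕ} {inc : ℕ} (h : RoundMode W P l e lo hi inc) (hl : 2 ^ l ≤ e)
    (hl' : e < 2 ^ (l + 1)) (hlW : l < W) :
    ∃ r, r ≤ (Finset.univ.filter fun i => lo (P i) ≠ hi (P i)).card ∧
      ∑ i, lo (P i) + inc * r = 2 ^ (W - l) := by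
  have hsum : ∑ i, hi (P i) =
      ∑ i, lo (P i) + inc * (Finset.univ.filter fun i => lo (P i) ≠ hi (P i)).card := by
    rw [Finset.sum_congr rfl fun i _ => (h.hi_eq hl hl' (P i)).1, Finset.sum_add_distrib,
      ← Finset.sum_filter, Finset.sum_const, smul_eq_mul, mul_comm]
  obtain ⟨hb1, hb2⟩ := hP.sum_box_le hl hlW.le
  rcases h with ⟨rfl, rfl, rfl, h1⟩ | ⟨rfl, rfl, rfl, h1⟩ | ⟨rfl, rfl, rfl, h1, h2⟩
  · exact ⟨2 ^ (W - l) - ∑ i, boxEvenHi l e (P i), by omega, by omega⟩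
  · exact ⟨2 ^ (W - l) - ∑ i, boxLo l e (P i), by omega, by omega⟩
  · have hpow : 2 ^ (W - l) = 2 * 2 ^ (W - l - 1) := by rw [← pow_succ']; congr 1; omega
    -- The increment is 2, so the missing amount must be even. A one-point odd box leaves no choice
    -- at all; otherwise all lower values are even, and so is `2 ^ (W - l)` because `l < W`.
    by_cases hev : ∃ j, boxLo l e (P j) = boxHi l e (P j) ∧ boxLo l e (P j) % 2 = 1
    · obtain ⟨j, hj, hj'⟩ := hev
      have heq : ∀ i, boxEvenLo l e (P i) = boxEvenHi l e (P i) := fun i => by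
        have := boxHi_le_boxLo_add_one (p := P i) hl hj hj'
        have := boxEven_bounds (p := P i) hl
        simp only [boxEvenLo, boxEvenHi] at *; split_ifs at * <;> omega
      refine ⟨0, by simp, ?_⟩
      simp only [heq] at h1 ⊢
      omega
    · push Not at hev
      have hpar : (∑ i, boxEvenLo l e (P i)) % 2 = 0 := by
        have h3 : ∀ i, boxEvenLo l e (P i) = 2 * (boxEvenLo l e (P i) / 2) := fun i => by
          have := hev i
          simp only [boxEvenLo]; split_ifs <;> omega
        rw [Finset.sum_congr rfl fun i _ => h3 i, ← Finset.mul_sum]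
        omega
      exact ⟨(2 ^ (W - l) - ∑ i, boxEvenLo l e (P i)) / 2, by omega, by omega⟩

/-- Increasing a top set of the right size gives an optimal rounding. -/
theorem RoundMode.isOptimalRounding {W : ℕ} {P : Fin k → ℕ} (hP : IsPartition W P) {l e : ℕ}
    {lo hi : ℕ → ℕ} {inc : ℕ} (h : RoundMode W P l e lo hi inc) (hl : 2 ^ l ≤ e)
    (hl' : e < 2 ^ (l + 1)) (hlW : l < W) {S : Finset (Fin k)}
    (hS : ∀ i ∈ S, lo (P i) ≠ hi (P i)) (hcard : ∑ i, lo (P i) + inc * S.card = 2 ^ (W - l))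
    (htop : ∀ i ∈ S, ∀ j, lo (P j) ≠ hi (P j) → j ∉ S → LexLe (lo (P j)) (lo (P i))) {Y : Fin k → ℕ}
    (hY : ∀ i, Y i = 2 ^ l * (lo (P i) + if i ∈ S then inc else 0)) :
    IsOptimalRounding W P e Y := by
  have h2l : 0 < 2 ^ l := by positivity
  have he : 0 < e := by omega
  have hW : 2 ^ W = 2 ^ l * 2 ^ (W - l) := by rw [← pow_add]; congr 1; omega
  have hpow : 2 ^ (W - l) = 2 * 2 ^ (W - l - 1) := by rw [← pow_succ']; congr 1; omega
  refine ⟨?_, ?_, ?_⟩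
  · rw [IsPartition, Finset.sum_congr rfl fun i _ => hY i, ← Finset.mul_sum, hW,
      Finset.sum_add_distrib, ← hcard]
    congr 2
    rw [← Finset.sum_filter, Finset.filter_mem_eq_inter, Finset.univ_inter, Finset.sum_const,
      smul_eq_mul, mul_comm]
  · rw [linftyDist_lt_iff he]
    intro i
    obtain ⟨h1, h2, h3⟩ := h.hi_eq hl hl' (P i)
    have h4 := hS i
    have h5 : boxLo l e (P i) ≤ lo (P i) + (if i ∈ S then inc else 0) := by omega
    have h6 : lo (P i) + (if i ∈ S then inc else 0) ≤ boxHi l e (P i) := by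
      by_cases hi : i ∈ S
      · rw [if_pos (h4 hi)] at h1; rw [if_pos hi]; omega
      · rw [if_neg hi]; omega
    rw [boxLo_le_iff, ← hY] at h5
    rw [le_boxHi_iff, ← hY] at h6
    omega
  · intro Q hQ hd n hn
    rw [linftyDist_lt_iff he] at hd
    -- Any competitor is replaced, at no cost, by one whose parts are multiples of `2 ^ l`. The
    -- tolerance is `e - 1` because the distance is required to be strictly below `e`.
    obtain ⟨X, hX, hXs, hXd⟩ := hn.exists_scaled (p := fun i => (P i : ℤ)) (E := (e : ℤ) - 1)
      (A := fun i => max 0 ((P i : ℤ) - (e - 1))) (B := fun i => (P i : ℤ) + (e - 1)) (W := W) (l := l)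
      (by have : ((2 ^ l : ℕ) : ℤ) ≤ e := by exact_mod_cast hl
          push_cast at this; omega) hlW.le (fun i => by positivity)
      (fun i => rfl) (fun i => rfl) hP.sum_cast (fun i => by have := hd i; omega) hQ.sum_cast
    have hX0 : ∀ i, 0 ≤ X i := fun i => by
      have h1 := (hX i).1
      have h2 : (0 : ℤ) ≤ 2 ^ l * X i := le_trans (le_max_left _ _) h1
      exact nonneg_of_mul_nonneg_right h2 (by positivity)
    have hbox : ∀ i, (boxLo l e (P i) : ℤ) ≤ X i ∧ X i ≤ boxHi l e (P i) := fun i => by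
      obtain ⟨x, hx⟩ := Int.eq_ofNat_of_zero_le (hX0 i)
      have h1 := hX i
      rw [hx] at h1 ⊢
      have e1 : ((2 ^ l * x : ℕ) : ℤ) = 2 ^ l * (x : ℤ) := by push_cast; rfl
      rw [← e1] at h1
      have h3 : boxLo l e (P i) ≤ x := boxLo_le_iff.2 (by omega)
      have h4 : x ≤ boxHi l e (P i) := le_boxHi_iff.2 (by omega)
      omega
    have hcastLo : ∀ i, (boxEvenLo l e (P i) : ℤ) = evenLo (boxLo l e (P i)) (boxHi l e (P i)) :=
      fun i => by simp only [boxEvenLo, evenLo, Nat.cast_inj]; split_ifs <;> omega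
    have hcastHi : ∀ i, (boxEvenHi l e (P i) : ℤ) = evenHi (boxLo l e (P i)) (boxHi l e (P i)) :=
      fun i => by simp only [boxEvenHi, evenHi, Nat.cast_inj]; split_ifs <;> omega
    have hpowZ : (2 : ℤ) ^ (W - l) = 2 * 2 ^ (W - l - 1) := by exact_mod_cast hpow
    have hXs' : ∑ i, X i = ((2 ^ (W - l) : ℕ) : ℤ) := by rw [hXs]; push_cast; rfl
    have := hXd.round_box (a := fun i => (boxLo l e (P i) : ℤ)) (b := fun i => (boxHi l e (P i) : ℤ))
      (lo := fun i => (lo (P i) : ℤ)) (hi := fun i => (hi (P i) : ℤ)) (inc := inc) (S := S)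
      (fun i => by
        have := boxLo_le_boxHi (p := P i) hl
        have := boxHi_le_boxLo_add (p := P i) hl hl'
        omega)
      (fun j h1 h2 i => by
        have := boxHi_le_boxLo_add_one (p := P i) (p' := P j) hl (by omega) (by omega)
        omega)
      hbox (by omega)
      (by
        simp only [← hcastLo, ← hcastHi]
        rw [hXs']
        rcases h with ⟨rfl, rfl, rfl, h1⟩ | ⟨rfl, rfl, rfl, h1⟩ | ⟨rfl, rfl, rfl, h1, h2⟩
        · exact Or.inl ⟨fun i => ⟨rfl, rfl⟩, rfl, by exact_mod_cast h1⟩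
        · exact Or.inr (Or.inl ⟨fun i => ⟨rfl, rfl⟩, rfl, by exact_mod_cast h1⟩)
        · exact Or.inr (Or.inr ⟨fun i => ⟨rfl, rfl⟩, rfl, by exact_mod_cast h1, by exact_mod_cast h2⟩))
      (fun i hi => by have := hS i hi; exact_mod_cast this)
      (by rw [hXs', ← hcard]; push_cast; rfl)
      (fun i hi j hj hjS => htop i hi j (by exact_mod_cast hj) hjS)
    refine ((decomp_two_pow_mul_iff l).2 this).congr fun i => ?_
    rw [hY]
    push_cast
    split_ifs <;> simp

theorem Decomp.eq_zero {ι : Type*} [Fintype ι] [DecidableEq ι] {X : ι → ℤ} (h : Decomp X 0) (i : ι) :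
    X i = 0 := by
  suffices key : ∀ (X : ι → ℤ) (n : ℤ), Decomp X n → n = 0 → ∀ i, X i = 0 from key X 0 h rfl i
  intro X n h
  induction h with
  | zero X n hX hn => exact fun _ => hX
  | step X D C n m hD hC hn hX ih =>
    intro h0 i
    have h1 : 0 ≤ ∑ i, |D i| := Finset.sum_nonneg fun i _ => abs_nonneg _
    have h2 := hC.nonneg
    have h3 := (Finset.sum_eq_zero_iff_of_nonneg fun i _ => abs_nonneg (D i)).1
      (show ∑ i, |D i| = 0 by omega) i (Finset.mem_univ _)
    rw [hX, ih (by omega) i, abs_eq_zero.1 h3]; rfl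

/-- With tolerance at least `2 ^ W` everything can go to one part. -/
theorem isOptimalRounding_single {W : ℕ} {P : Fin k → ℕ} (hP : IsPartition W P) {e : ℕ}
    (he : 2 ^ W ≤ e) {j : Fin k} (hj : P j ≠ 0) {Y : Fin k → ℕ}
    (hY : ∀ i, Y i = if i = j then 2 ^ W else 0) : IsOptimalRounding W P e Y := by
  have h2W : 0 < 2 ^ W := by positivity
  have hle : ∀ i, P i ≤ 2 ^ W := fun i => by
    rw [← show ∑ i, P i = 2 ^ W from hP]
    exact Finset.single_le_sum (fun _ _ => Nat.zero_le _) (Finset.mem_univ i)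
  refine ⟨by simp [IsPartition, hY], (linftyDist_lt_iff (by omega)).2 fun i => ?_, fun Q hQ _ n hn => ?_⟩
  · have h1 := hle i
    -- The distance must be strictly below `2 ^ W`. At the receiving part this holds because that
    -- part is nonzero, and at the others because some weight lies outside them.
    have h2 : i ≠ j → P i < 2 ^ W := fun hne => by
      have h3 := Finset.add_le_sum (f := P) (s := Finset.univ) (fun _ _ => Nat.zero_le _)
        (Finset.mem_univ i) (Finset.mem_univ j) hne
      rw [show ∑ i, P i = 2 ^ W from hP] at h3
      omega
    rw [hY]
    split_ifs with hij
    · subst hij; omega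
    · have := h2 hij; omega
  · have h1 : Decomp (fun _ : Fin k => (0 : ℤ)) 0 := .zero _ _ (by simp) le_rfl
    have hn1 : 1 ≤ n := by
      by_contra hc
      have h0 := hn.nonneg
      obtain rfl : n = 0 := by omega
      have h3 := hQ.sum_cast
      rw [Finset.sum_congr rfl fun i _ => hn.eq_zero i, Finset.sum_const_zero] at h3
      have : (0 : ℤ) < 2 ^ W := by positivity
      omega
    refine ((h1.add_top (by simp) W j).mono (n' := n) (by omega)).congr fun i => ?_
    rw [hY]
    split_ifs <;> simp

end RoundingNat
end TrafficSplit

namespace TrafficSplit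

/-! ### A structured language for the word RAM

Programs are written with named registers, sixteen arrays and nested expressions, with exact
natural number arithmetic and side conditions that exclude overflow. They are compiled to the word
RAM: registers from `100` on hold intermediate values, and cell `i` of array `j` is stored at address
`16 * i + j`. -/

/-- Expressions. -/
inductive Expr : Type
  | lit (v : ℕ) : Expr
  | reg (r : ℕ) : Expr
  | arr (j : ℕ) (e : Expr) : Expr
  | bin (op : BinOp) (e₁ e₂ : Expr) : Expr
  | log2 (e : Expr) : Expr

/-- Statements. -/
inductive Stmt : Type
  | skip : Stmt
  | set (r : ℕ) (e : Expr) : Stmt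
  | put (j : ℕ) (e₁ e₂ : Expr) : Stmt
  | seq (s₁ s₂ : Stmt) : Stmt
  | ite (cmp : Cmp) (e₁ e₂ : Expr) (s₁ s₂ : Stmt) : Stmt
  | loop (cmp : Cmp) (e₁ e₂ : Expr) (s : Stmt) : Stmt
  | call (p : ℕ) : Stmt

/-- Registers and arrays. -/
structure Store : Type where
  reg : ℕ → ℕ
  arr : ℕ → ℕ → ℕ

/-- The store with register `r` overwritten by `v`. -/
def Store.set (σ : Store) (r v : ℕ) : Store :=
  { σ with reg := Function.update σ.reg r v }

/-- The store with cell `i` of array `j` overwritten by `v`. -/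
def Store.put (σ : Store) (j i v : ℕ) : Store :=
  { σ with arr := Function.update σ.arr j (Function.update (σ.arr j) i v) }

/-- The exact value of a binary operation. -/
def BinOp.plain : BinOp → ℕ → ℕ → ℕ
  | .add, x, y => x + y
  | .sub, x, y => x - y
  | .mul, x, y => x * y
  | .and, x, y => x &&& y
  | .or, x, y => x ||| y
  | .xor, x, y => x ^^^ y
  | .shl, x, y => x * 2 ^ y
  | .shr, x, y => x / 2 ^ y

/-- The operation does not overflow on words below `B`. -/
def BinOp.Fits (B : ℕ) : BinOp → ℕ → ℕ → Prop
  | .add, x, y => x + y < B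
  | .sub, x, y => y ≤ x
  | .mul, x, y => x * y < B
  | .shl, x, y => x * 2 ^ y < B
  | _, _, _ => True

/-- The exact value of an expression. -/
def Expr.val (σ : Store) : Expr → ℕ
  | .lit v => v
  | .reg r => σ.reg r
  | .arr j e => σ.arr j (e.val σ)
  | .bin op e₁ e₂ => op.plain (e₁.val σ) (e₂.val σ)
  | .log2 e => Nat.log2 (e.val σ)

/-- The expression can be evaluated with words below `B` without overflow. -/
def Expr.Ok (B : ℕ) (σ : Store) : Expr → Prop
  | .lit v => v < B
  | .reg _ => True
  | .arr _ e => e.Ok B σ ∧ 16 * e.val σ + 16 < B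
  | .bin op e₁ e₂ => e₁.Ok B σ ∧ e₂.Ok B σ ∧ op.Fits B (e₁.val σ) (e₂.val σ)
  | .log2 e => e.Ok B σ

/-- `Run B procs s σ t σ'`: statement `s` started in `σ` halts in `σ'`; the time `t` counts
assignments, tests and calls. -/
inductive Run (B : ℕ) (procs : List Stmt) : Stmt → Store → ℕ → Store → Prop
  | skip (σ : Store) : Run B procs .skip σ 1 σ
  | set (σ : Store) (r : ℕ) (e : Expr) (h : e.Ok B σ) :
      Run B procs (.set r e) σ 1 (σ.set r (e.val σ))
  | put (σ : Store) (j : ℕ) (e₁ e₂ : Expr) (h₁ : e₁.Ok B σ) (h₂ : e₂.Ok B σ)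
      (h : 16 * e₁.val σ + 16 < B) :
      Run B procs (.put j e₁ e₂) σ 1 (σ.put j (e₁.val σ) (e₂.val σ))
  | seq {s₁ s₂ : Stmt} {σ σ₁ σ₂ : Store} {t₁ t₂ : ℕ} :
      Run B procs s₁ σ t₁ σ₁ → Run B procs s₂ σ₁ t₂ σ₂ → Run B procs (.seq s₁ s₂) σ (t₁ + t₂) σ₂
  | iteTrue {cmp : Cmp} {e₁ e₂ : Expr} {s₁ s₂ : Stmt} {σ σ' : Store} {t : ℕ} :
      e₁.Ok B σ → e₂.Ok B σ → cmp.Holds (e₁.val σ) (e₂.val σ) → Run B procs s₁ σ t σ' →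
      Run B procs (.ite cmp e₁ e₂ s₁ s₂) σ (t + 1) σ'
  | iteFalse {cmp : Cmp} {e₁ e₂ : Expr} {s₁ s₂ : Stmt} {σ σ' : Store} {t : ℕ} :
      e₁.Ok B σ → e₂.Ok B σ → ¬ cmp.Holds (e₁.val σ) (e₂.val σ) → Run B procs s₂ σ t σ' →
      Run B procs (.ite cmp e₁ e₂ s₁ s₂) σ (t + 1) σ'
  | loopDone {cmp : Cmp} {e₁ e₂ : Expr} {s : Stmt} {σ : Store} :
      e₁.Ok B σ → e₂.Ok B σ → ¬ cmp.Holds (e₁.val σ) (e₂.val σ) →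
      Run B procs (.loop cmp e₁ e₂ s) σ 1 σ
  | loopStep {cmp : Cmp} {e₁ e₂ : Expr} {s : Stmt} {σ σ₁ σ₂ : Store} {t₁ t₂ : ℕ} :
      e₁.Ok B σ → e₂.Ok B σ → cmp.Holds (e₁.val σ) (e₂.val σ) → Run B procs s σ t₁ σ₁ →
      Run B procs (.loop cmp e₁ e₂ s) σ₁ t₂ σ₂ →
      Run B procs (.loop cmp e₁ e₂ s) σ (t₁ + t₂ + 1) σ₂
  | call {p : ℕ} {s : Stmt} {σ σ' : Store} {t : ℕ} :
      procs[p]? = some s → Run B procs s σ t σ' → Run B procs (.call p) σ (t + 1) σ'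

/-! ### Compilation -/

/-- Turns the index in register `d` into the address of the cell of array `j`. -/
def addressCmd (j d : ℕ) : Cmd :=
  .seq (.const (d + 1) 16) (.seq (.binop .mul d d (d + 1))
    (.seq (.const (d + 1) j) (.binop .add d d (d + 1))))

/-- Evaluates the expression into register `d`, using registers from `d` on. -/
def Expr.compile : Expr → ℕ → Cmd
  | .lit v, d => .const d v
  | .reg r, d => .copy d r
  | .arr j e, d => .seq (e.compile d) (.seq (addressCmd j d) (.load d d))
  | .bin op e₁ e₂, d => .seq (e₁.compile d) (.seq (e₂.compile (d + 1)) (.binop op d d (d + 1)))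
  | .log2 e, d => .seq (e.compile d) (.log2 d d)

/-- The time to evaluate an expression. -/
def Expr.size : Expr → ℕ
  | .lit _ => 1
  | .reg _ => 1
  | .arr _ e => e.size + 5
  | .bin _ e₁ e₂ => e₁.size + e₂.size + 1
  | .log2 e => e.size + 1

/-- The expression uses only the registers and arrays of the language. -/
def Expr.wf : Expr → Bool
  | .lit _ => true
  | .reg r => decide (r < 100)
  | .arr j e => decide (j < 16) && e.wf
  | .bin _ e₁ e₂ => e₁.wf && e₂.wf
  | .log2 e => e.wf

/-- Evaluates two expressions into the registers `100` and `101`. -/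
def compilePair (e₁ e₂ : Expr) : Cmd := .seq (e₁.compile 100) (e₂.compile 101)

/-- Compiles a statement. -/
def Stmt.compile : Stmt → Cmd
  | .skip => .skip
  | .set r e => .seq (e.compile 100) (.copy r 100)
  | .put j e₁ e₂ => .seq (e₁.compile 100) (.seq (addressCmd j 100)
      (.seq (e₂.compile 101) (.store 100 101)))
  | .seq s₁ s₂ => .seq s₁.compile s₂.compile
  | .ite cmp e₁ e₂ s₁ s₂ => .seq (compilePair e₁ e₂) (.cond cmp 100 101 s₁.compile s₂.compile)
  | .loop cmp e₁ e₂ s =>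
      .seq (compilePair e₁ e₂) (.loop cmp 100 101 (.seq s.compile (compilePair e₁ e₂)))
  | .call p => .call p

/-- A bound for the time of the single steps of a statement. -/
def Stmt.size : Stmt → ℕ
  | .skip => 1
  | .set _ e => e.size + 1
  | .put _ e₁ e₂ => e₁.size + e₂.size + 5
  | .seq s₁ s₂ => s₁.size + s₂.size
  | .ite _ e₁ e₂ s₁ s₂ => e₁.size + e₂.size + 1 + s₁.size + s₂.size
  | .loop _ e₁ e₂ s => e₁.size + e₂.size + 1 + s.size
  | .call _ => 1

/-- The statement uses only the registers and arrays of the language. -/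
def Stmt.wf : Stmt → Bool
  | .skip => true
  | .set r e => decide (r < 100) && e.wf
  | .put j e₁ e₂ => decide (j < 16) && e₁.wf && e₂.wf
  | .seq s₁ s₂ => s₁.wf && s₂.wf
  | .ite _ e₁ e₂ s₁ s₂ => e₁.wf && e₂.wf && s₁.wf && s₂.wf
  | .loop _ e₁ e₂ s => e₁.wf && e₂.wf && s.wf
  | .call _ => true

/-- The machine state `τ` represents the store `σ`. -/
structure Represents (b : ℕ) (τ : State) (σ : Store) : Prop where
  reg : ∀ r < 100, τ.reg r = σ.reg r
  arr : ∀ j < 16, ∀ i, 16 * i + 16 < 2 ^ b → τ.mem (16 * i + j) = σ.arr j i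
  reg_lt : ∀ r, τ.reg r < 2 ^ b
  mem_lt : ∀ a, τ.mem a < 2 ^ b

/-- Registers from 100 on are scratch space that the store does not see. -/
theorem Represents.of_temp {b : ℕ} {τ τ' : State} {σ : Store} (h : Represents b τ σ)
    (hreg : ∀ r < 100, τ'.reg r = τ.reg r) (hmem : τ'.mem = τ.mem) (hlt : ∀ r, τ'.reg r < 2 ^ b) :
    Represents b τ' σ :=
  ⟨fun r hr => by rw [hreg r hr, h.reg r hr], by rw [hmem]; exact h.arr, hlt,
    by rw [hmem]; exact h.mem_lt⟩

theorem BinOp.eval_lt (b : ℕ) (op : BinOp) (x y : ℕ) : op.eval b x y < 2 ^ b := by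
  cases op <;> exact Nat.mod_lt _ (by positivity)

theorem BinOp.eval_eq_plain {b : ℕ} {op : BinOp} {x y : ℕ} (hx : x < 2 ^ b) (hy : y < 2 ^ b)
    (h : op.Fits (2 ^ b) x y) : op.eval b x y = op.plain x y := by
  cases op <;> simp only [BinOp.eval, BinOp.plain, BinOp.Fits] at *
  · exact Nat.mod_eq_of_lt h
  · rw [show x + (2 ^ b - y) = x - y + 2 ^ b by omega, Nat.add_mod_right]
    exact Nat.mod_eq_of_lt (by omega)
  · exact Nat.mod_eq_of_lt h
  · exact Nat.mod_eq_of_lt (Nat.and_lt_two_pow _ hy)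
  · exact Nat.mod_eq_of_lt (Nat.or_lt_two_pow hx hy)
  · exact Nat.mod_eq_of_lt (Nat.xor_lt_two_pow hx hy)
  · rw [Nat.shiftLeft_eq]
    exact Nat.mod_eq_of_lt h
  · rw [Nat.shiftRight_eq_div_pow]
    exact Nat.mod_eq_of_lt ((Nat.div_le_self _ _).trans_lt hx)

theorem State.setReg_lt {b : ℕ} {τ : State} (h : ∀ r, τ.reg r < 2 ^ b) {d v : ℕ} (hv : v < 2 ^ b)
    (r : ℕ) : (τ.setReg d v).reg r < 2 ^ b := by
  simp only [State.setReg, Function.update_apply]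
  split_ifs
  · exact hv
  · exact h r

theorem exec_addressCmd {b : ℕ} {procs : List Cmd} {τ : State} {j d i : ℕ} (hj : j < 16)
    (hlt : ∀ r, τ.reg r < 2 ^ b) (hi : τ.reg d = i) (hfit : 16 * i + 16 < 2 ^ b) :
    ∃ τ', Exec b procs (addressCmd j d) τ 4 τ' ∧ τ'.reg d = 16 * i + j ∧
      (∀ r < d, τ'.reg r = τ.reg r) ∧ τ'.mem = τ.mem ∧ ∀ r, τ'.reg r < 2 ^ b := by
  refine ⟨_, .seq (.const _ _ _) (.seq (.binop _ _ _ _ _) (.seq (.const _ _ _) (.binop _ _ _ _ _))),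
    ?_, ?_, rfl, ?_⟩
  · simp [State.setReg, hi, BinOp.eval, Nat.mod_eq_of_lt (show 16 < 2 ^ b by omega),
      Nat.mod_eq_of_lt (show j < 2 ^ b by omega), Nat.mod_eq_of_lt (show i * 16 < 2 ^ b by omega)]
    rw [Nat.mod_eq_of_lt (by omega)]
    omega
  · intro r hr
    simp only [State.setReg, Function.update_apply]
    rw [if_neg (by omega), if_neg (by omega), if_neg (by omega), if_neg (by omega)]
  · exact State.setReg_lt (State.setReg_lt (State.setReg_lt (State.setReg_lt hlt
      (Nat.mod_lt _ (by positivity))) (BinOp.eval_lt _ _ _ _)) (Nat.mod_lt _ (by positivity)))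
      (BinOp.eval_lt _ _ _ _)

theorem Expr.exec_compile {b : ℕ} {procs : List Cmd} {σ : Store} (e : Expr) (hwf : e.wf = true)
    (hok : e.Ok (2 ^ b) σ) {d : ℕ} (hd : 100 ≤ d) {τ : State} (h : Represents b τ σ) :
    ∃ τ', Exec b procs (e.compile d) τ e.size τ' ∧ τ'.reg d = e.val σ ∧
      (∀ r < d, τ'.reg r = τ.reg r) ∧ τ'.mem = τ.mem ∧ ∀ r, τ'.reg r < 2 ^ b := by
  induction e generalizing d τ with
  | lit v =>
    refine ⟨_, .const _ _ _, ?_, fun r hr => ?_, rfl, State.setReg_lt h.reg_lt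
      (Nat.mod_lt _ (by positivity))⟩
    · simp [State.setReg, Expr.val, Nat.mod_eq_of_lt (show v < 2 ^ b from hok)]
    · simp [State.setReg, show r ≠ d by omega]
  | reg r =>
    simp only [Expr.wf, decide_eq_true_eq] at hwf
    refine ⟨_, .copy _ _ _, ?_, fun r hr => ?_, rfl, State.setReg_lt h.reg_lt (h.reg_lt _)⟩
    · simp [State.setReg, Expr.val, h.reg r hwf]
    · simp [State.setReg, show r ≠ d by omega]
  | arr j e ih =>
    simp only [Expr.wf, Bool.and_eq_true, decide_eq_true_eq] at hwf
    obtain ⟨τ₁, h1, h2, h3, h4, h5⟩ := ih hwf.2 hok.1 hd h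
    obtain ⟨τ₂, k1, k2, k3, k4, k5⟩ := exec_addressCmd (procs := procs) hwf.1 h5 h2 hok.2
    refine ⟨_, .seq h1 (.seq k1 (.load _ _ _)), ?_, fun r hr => ?_, ?_, State.setReg_lt k5 ?_⟩
    · simp [State.setReg, Expr.val, k2, k4, h4, h.arr j hwf.1 _ hok.2]
    · simp [State.setReg, show r ≠ d by omega, k3 r hr, h3 r hr]
    · simp [State.setReg, k4, h4]
    · rw [k4, h4]; exact h.mem_lt _
  | bin op e₁ e₂ ih₁ ih₂ =>
    simp only [Expr.wf, Bool.and_eq_true] at hwf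
    obtain ⟨τ₁, h1, h2, h3, h4, h5⟩ := ih₁ hwf.1 hok.1 hd h
    obtain ⟨τ₂, k1, k2, k3, k4, k5⟩ := ih₂ hwf.2 hok.2.1 (d := d + 1) (by omega)
      (h.of_temp (fun r hr => h3 r (by omega)) h4 h5)
    have e1 : τ₂.reg d = e₁.val σ := by rw [k3 d (by omega), h2]
    have run := Exec.seq h1 (.seq k1 (.binop τ₂ op d d (d + 1)))
    rw [← add_assoc] at run
    refine ⟨_, run, ?_, fun r hr => ?_, ?_,
      State.setReg_lt k5 (BinOp.eval_lt _ _ _ _)⟩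
    · simp only [State.setReg, Function.update_self, Expr.val]
      rw [BinOp.eval_eq_plain (k5 _) (k5 _) (by rw [e1, k2]; exact hok.2.2), e1, k2]
    · simp [State.setReg, show r ≠ d by omega, k3 r (by omega), h3 r hr]
    · simp [State.setReg, k4, h4]
  | log2 e ih =>
    obtain ⟨τ₁, h1, h2, h3, h4, h5⟩ := ih hwf hok hd h
    refine ⟨_, .seq h1 (.log2 _ _ _), ?_, fun r hr => ?_, h4, State.setReg_lt h5 ?_⟩
    · simp [State.setReg, Expr.val, h2]
    · simp [State.setReg, show r ≠ d by omega, h3 r hr]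
    · exact (Nat.log2_le_self _).trans_lt (h5 _)

theorem exec_compilePair {b : ℕ} {procs : List Cmd} {σ : Store} {e₁ e₂ : Expr}
    (hwf₁ : e₁.wf = true) (hwf₂ : e₂.wf = true) (hok₁ : e₁.Ok (2 ^ b) σ) (hok₂ : e₂.Ok (2 ^ b) σ)
    {τ : State} (h : Represents b τ σ) :
    ∃ τ', Exec b procs (compilePair e₁ e₂) τ (e₁.size + e₂.size) τ' ∧ τ'.reg 100 = e₁.val σ ∧
      τ'.reg 101 = e₂.val σ ∧ Represents b τ' σ := by
  obtain ⟨τ₁, h1, h2, h3, h4, h5⟩ := e₁.exec_compile (procs := procs) hwf₁ hok₁ le_rfl h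
  have r1 := h.of_temp h3 h4 h5
  obtain ⟨τ₂, k1, k2, k3, k4, k5⟩ := e₂.exec_compile (procs := procs) hwf₂ hok₂ (d := 101) (by omega) r1
  exact ⟨τ₂, .seq h1 k1, by rw [k3 _ (by omega), h2], k2,
    r1.of_temp (fun r hr => k3 r (by omega)) k4 k5⟩

theorem Represents.set {b : ℕ} {τ : State} {σ : Store} (h : Represents b τ σ) {r v : ℕ}
    (hv : v < 2 ^ b) : Represents b (τ.setReg r v) (σ.set r v) := by
  refine ⟨fun r' hr' => ?_, h.arr, State.setReg_lt h.reg_lt hv, h.mem_lt⟩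
  simp only [State.setReg, Store.set, Function.update_apply]
  split_ifs
  · rfl
  · exact h.reg r' hr'

theorem Represents.put {b : ℕ} {τ : State} {σ : Store} (h : Represents b τ σ) {j i v : ℕ}
    (hj : j < 16) (hv : v < 2 ^ b) : Represents b (τ.setMem (16 * i + j) v) (σ.put j i v) := by
  refine ⟨h.reg, fun j' hj' i' hi' => ?_, h.reg_lt, fun a => ?_⟩
  · simp only [State.setMem, Store.put, Function.update_apply]
    by_cases hjj : j' = j
    · subst hjj
      by_cases hii : i' = i
      · subst hii; simp
      · simp only [if_true, Function.update_apply, hii, if_false]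
        rw [if_neg (by omega)]; exact h.arr _ hj' _ hi'
    · rw [if_neg (by omega), if_neg hjj]; exact h.arr _ hj' _ hi'
  · simp only [State.setMem, Function.update_apply]
    split_ifs
    · exact hv
    · exact h.mem_lt a

/-- Compiled programs do what the source does, with constant slowdown. -/
theorem Run.exec {b K : ℕ} {procs : List Stmt} (hprocs : ∀ s ∈ procs, s.wf = true ∧ s.size ≤ K)
    {s : Stmt} {σ σ' : Store} {t : ℕ} (h : Run (2 ^ b) procs s σ t σ') (hwf : s.wf = true)
    (hK : s.size ≤ K) (hK0 : 1 ≤ K) {τ : State} (hτ : Represents b τ σ) :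
    ∃ t' τ', Exec b (procs.map Stmt.compile) s.compile τ t' τ' ∧ Represents b τ' σ' ∧ t' ≤ K * t := by
  induction h generalizing τ with
  | skip σ => exact ⟨1, τ, .skip _, hτ, by omega⟩
  | set σ r e hok =>
    simp only [Stmt.wf, Bool.and_eq_true, decide_eq_true_eq] at hwf
    obtain ⟨τ₁, h1, h2, h3, h4, h5⟩ := e.exec_compile (procs := procs.map Stmt.compile) hwf.2 hok le_rfl hτ
    refine ⟨_, _, .seq h1 (.copy _ _ _), ?_, by simpa [Stmt.size] using hK⟩
    rw [h2]
    exact (hτ.of_temp h3 h4 h5).set (h2 ▸ h5 100)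
  | put σ j e₁ e₂ hok₁ hok₂ hfit =>
    simp only [Stmt.wf, Bool.and_eq_true, decide_eq_true_eq] at hwf
    obtain ⟨τ₁, h1, h2, h3, h4, h5⟩ :=
      e₁.exec_compile (procs := procs.map Stmt.compile) hwf.1.2 hok₁ le_rfl hτ
    obtain ⟨τ₂, k1, k2, k3, k4, k5⟩ :=
      exec_addressCmd (procs := procs.map Stmt.compile) hwf.1.1 h5 h2 hfit
    have r2 := (hτ.of_temp h3 h4 h5).of_temp k3 k4 k5
    obtain ⟨τ₃, l1, l2, l3, l4, l5⟩ :=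
      e₂.exec_compile (procs := procs.map Stmt.compile) hwf.2 hok₂ (d := 101) (by omega) r2
    refine ⟨_, _, .seq h1 (.seq k1 (.seq l1 (.store _ _ _))), ?_, by
      simp only [Stmt.size] at hK; omega⟩
    rw [l3 _ (by omega), k2, l2]
    exact (r2.of_temp (fun r hr => l3 r (by omega)) l4 l5).put hwf.1.1 (l2 ▸ l5 101)
  | seq _ _ ih₁ ih₂ =>
    simp only [Stmt.wf, Bool.and_eq_true] at hwf
    simp only [Stmt.size] at hK
    obtain ⟨t₁, τ₁, h1, h2, h3⟩ := ih₁ hwf.1 (by omega) hτ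
    obtain ⟨t₂, τ₂, k1, k2, k3⟩ := ih₂ hwf.2 (by omega) h2
    exact ⟨_, τ₂, .seq h1 k1, k2, by rw [mul_add]; omega⟩
  | iteTrue hok₁ hok₂ hc _ ih =>
    simp only [Stmt.wf, Bool.and_eq_true] at hwf
    simp only [Stmt.size] at hK
    obtain ⟨τ₁, h1, h2, h3, h4⟩ :=
      exec_compilePair (procs := procs.map Stmt.compile) hwf.1.1.1 hwf.1.1.2 hok₁ hok₂ hτ
    obtain ⟨t₂, τ₂, k1, k2, k3⟩ := ih hwf.1.2 (by omega) h4
    exact ⟨_, τ₂, .seq h1 (.condTrue (by rwa [h2, h3]) k1), k2, by rw [mul_add]; omega⟩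
  | iteFalse hok₁ hok₂ hc _ ih =>
    simp only [Stmt.wf, Bool.and_eq_true] at hwf
    simp only [Stmt.size] at hK
    obtain ⟨τ₁, h1, h2, h3, h4⟩ :=
      exec_compilePair (procs := procs.map Stmt.compile) hwf.1.1.1 hwf.1.1.2 hok₁ hok₂ hτ
    obtain ⟨t₂, τ₂, k1, k2, k3⟩ := ih hwf.2 (by omega) h4
    exact ⟨_, τ₂, .seq h1 (.condFalse (by rwa [h2, h3]) k1), k2, by rw [mul_add]; omega⟩
  | loopDone hok₁ hok₂ hc =>
    simp only [Stmt.wf, Bool.and_eq_true] at hwf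
    simp only [Stmt.size] at hK
    obtain ⟨τ₁, h1, h2, h3, h4⟩ :=
      exec_compilePair (procs := procs.map Stmt.compile) hwf.1.1 hwf.1.2 hok₁ hok₂ hτ
    exact ⟨_, τ₁, .seq h1 (.loopDone (by rwa [h2, h3])), h4, by omega⟩
  | loopStep hok₁ hok₂ hc _ _ ih₁ ih₂ =>
    have hwf' := hwf
    have hK' := hK
    simp only [Stmt.wf, Bool.and_eq_true] at hwf'
    simp only [Stmt.size] at hK'
    obtain ⟨τ₁, h1, h2, h3, h4⟩ :=
      exec_compilePair (procs := procs.map Stmt.compile) hwf'.1.1 hwf'.1.2 hok₁ hok₂ hτ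
    obtain ⟨t₂, τ₂, k1, k2, k3⟩ := ih₁ hwf'.2 (by omega) h4
    obtain ⟨t₃, τ₃, l1, l2, l3⟩ := ih₂ hwf hK k2
    -- A compiled loop evaluates its test before the loop and again at the end of each body. The
    -- remaining iterations come as such an evaluation followed by a loop; splitting them lets the
    -- evaluation be absorbed into the body just executed.
    cases l1 with
    | seq l1 l1' =>
      exact ⟨_, τ₃, .seq h1 (.loopStep (by rwa [h2, h3]) (.seq k1 l1) l1'), l2, by
        rw [mul_add, mul_add]; omega⟩
  | @call p s σ σ' t hp _ ih =>
    have hs := hprocs s (List.mem_of_getElem? hp)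
    obtain ⟨t₂, τ₂, k1, k2, k3⟩ := ih hs.1 hs.2 hτ
    exact ⟨_, τ₂, .call (by simp [hp]) k1, k2, by rw [mul_add]; omega⟩

end TrafficSplit

namespace TrafficSplit

/-! ### Input and output -/

/-- Moves the input to array `0`, from the last entry to the first. -/
def inputCmd : Cmd :=
  .seq (.copy 103 0) (.loop .lt 104 103 (.seq (.const 102 1) (.seq (.binop .sub 103 103 102)
    (.seq (.load 105 103) (.seq (.const 106 16) (.seq (.binop .mul 106 103 106) (.store 106 105)))))))

/-- Moves array `1` to the output cells. -/
def outputCmd : Cmd :=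
  .seq (.const 103 0) (.loop .lt 103 0 (.seq (.const 104 16) (.seq (.binop .mul 105 103 104)
    (.seq (.const 104 1) (.seq (.binop .add 105 105 104) (.seq (.load 105 105)
      (.seq (.store 103 105) (.binop .add 103 103 104))))))))

theorem State.setMem_lt {b : ℕ} {τ : State} (h : ∀ a, τ.mem a < 2 ^ b) {d v : ℕ} (hv : v < 2 ^ b)
    (a : ℕ) : (τ.setMem d v).mem a < 2 ^ b := by
  simp only [State.setMem, Function.update_apply]
  split_ifs
  · exact hv
  · exact h a

/-- Entry `i` moves to address `16 * i`, which is at least `i`; working downwards therefore never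
overwrites an unread entry. -/
theorem exec_inputLoop {b : ℕ} {procs : List Cmd} {k : ℕ} {p : ℕ → ℕ} (hk : 16 * k + 16 < 2 ^ b)
    (n : ℕ) (hn : n ≤ k) (τ : State) (h103 : τ.reg 103 = n) (h104 : τ.reg 104 = 0)
    (hlo : ∀ i < n, τ.mem i = p i) (hhi : ∀ i, n ≤ i → i < k → τ.mem (16 * i) = p i)
    (hr : ∀ r, τ.reg r < 2 ^ b) (hm : ∀ a, τ.mem a < 2 ^ b) :
    ∃ τ', Exec b procs (.loop .lt 104 103 (.seq (.const 102 1) (.seq (.binop .sub 103 103 102)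
        (.seq (.load 105 103) (.seq (.const 106 16) (.seq (.binop .mul 106 103 106)
          (.store 106 105))))))) τ (7 * n + 1) τ' ∧ (∀ r < 100, τ'.reg r = τ.reg r) ∧
      (∀ i < k, τ'.mem (16 * i) = p i) ∧ (∀ r, τ'.reg r < 2 ^ b) ∧ ∀ a, τ'.mem a < 2 ^ b := by
  induction n generalizing τ with
  | zero =>
    exact ⟨τ, .loopDone (by simp [Cmp.Holds, h103, h104]), fun _ _ => rfl,
      fun i hi => hhi i (by omega) hi, hr, hm⟩
  | succ n ih =>
    set τ₁ := ((((τ.setReg 102 1).setReg 103 n).setReg 105 (p n)).setReg 106 16).setReg 106 (n * 16)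
      with hτ₁
    have run : Exec b procs (.seq (.const 102 1) (.seq (.binop .sub 103 103 102)
        (.seq (.load 105 103) (.seq (.const 106 16) (.seq (.binop .mul 106 103 106)
          (.store 106 105)))))) τ (1 + (1 + (1 + (1 + (1 + 1))))) (τ₁.setMem (n * 16) (p n)) := by
      have e0 : τ.setReg 102 (1 % 2 ^ b) = τ.setReg 102 1 := by
        rw [Nat.mod_eq_of_lt (by omega)]
      have c1 := Exec.const (b := b) (procs := procs) τ 102 1
      rw [e0] at c1
      have c2 := Exec.binop (b := b) (procs := procs) (τ.setReg 102 1) .sub 103 103 102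
      have e2 : BinOp.eval b .sub ((τ.setReg 102 1).reg 103) ((τ.setReg 102 1).reg 102) = n := by
        simp only [BinOp.eval, State.setReg, Function.update_apply]
        simp only [show ¬ ((103 : ℕ) = 102) by omega, if_true, if_false, h103]
        rw [show n + 1 + (2 ^ b - 1) = n + 2 ^ b by omega, Nat.add_mod_right]
        exact Nat.mod_eq_of_lt (by omega)
      rw [e2] at c2
      have c3 := Exec.load (b := b) (procs := procs) ((τ.setReg 102 1).setReg 103 n) 105 103
      have e3 : ((τ.setReg 102 1).setReg 103 n).mem (((τ.setReg 102 1).setReg 103 n).reg 103) = p n := by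
        simp [State.setReg, hlo n (by omega)]
      rw [e3] at c3
      have c4 := Exec.const (b := b) (procs := procs)
        (((τ.setReg 102 1).setReg 103 n).setReg 105 (p n)) 106 16
      rw [Nat.mod_eq_of_lt (show 16 < 2 ^ b by omega)] at c4
      have c5 := Exec.binop (b := b) (procs := procs)
        ((((τ.setReg 102 1).setReg 103 n).setReg 105 (p n)).setReg 106 16) .mul 106 103 106
      have e5 : BinOp.eval b .mul
          (((((τ.setReg 102 1).setReg 103 n).setReg 105 (p n)).setReg 106 16).reg 103)
          (((((τ.setReg 102 1).setReg 103 n).setReg 105 (p n)).setReg 106 16).reg 106) = n * 16 := by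
        simp only [BinOp.eval, State.setReg, Function.update_apply]
        simp
        exact Nat.mod_eq_of_lt (by omega)
      rw [e5] at c5
      have c6 := Exec.store (b := b) (procs := procs) τ₁ 106 105
      have e6 : τ₁.reg 106 = n * 16 := by simp [τ₁, State.setReg]
      have e6' : τ₁.reg 105 = p n := by simp [τ₁, State.setReg]
      rw [e6, e6'] at c6
      exact .seq c1 (.seq c2 (.seq c3 (.seq c4 (.seq c5 c6))))
    have hpn : p n < 2 ^ b := by rw [← hlo n (by omega)]; exact hm n
    have hr₁ : ∀ r, τ₁.reg r < 2 ^ b :=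
      State.setReg_lt (State.setReg_lt (State.setReg_lt (State.setReg_lt (State.setReg_lt hr
        (by omega)) (by omega)) hpn) (by omega)) (by omega)
    obtain ⟨τ', h1, h2, h3, h4, h5⟩ := ih (by omega) (τ₁.setMem (n * 16) (p n))
      (by simp [State.setMem, τ₁, State.setReg]) (by simp [State.setMem, τ₁, State.setReg, h104])
      (fun i hi => by
        simp only [State.setMem, τ₁, State.setReg, Function.update_apply]
        rw [if_neg (by omega)]; exact hlo i (by omega))
      (fun i hi hik => by
        simp only [State.setMem, τ₁, State.setReg, Function.update_apply]
        split_ifs with hc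
        · congr 1; omega
        · exact hhi i (by omega) hik)
      (fun r => hr₁ r) (State.setMem_lt hm hpn)
    refine ⟨τ', ?_, fun r hr => ?_, h3, h4, h5⟩
    · have := Exec.loopStep (cmp := .lt) (x := 104) (y := 103) (by simp [Cmp.Holds, h103, h104]) run h1
      convert this using 1
      ring
    · rw [h2 r hr]
      simp only [State.setMem, τ₁, State.setReg, Function.update_apply]
      repeat rw [if_neg (by omega)]

/-- Entry `i` is read from address `16 * i + 1`, which exceeds `i`; working upwards, a write to
address `i` cannot damage an entry still to be read. -/
theorem exec_outputLoop {b : ℕ} {procs : List Cmd} {k : ℕ} {y : ℕ → ℕ} (hk : 16 * k + 16 < 2 ^ b)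
    (m n : ℕ) (hn : m + n = k) (τ : State) (h103 : τ.reg 103 = m) (h0 : τ.reg 0 = k)
    (hlo : ∀ i < m, τ.mem i = y i) (hhi : ∀ i, m ≤ i → i < k → τ.mem (16 * i + 1) = y i) :
    ∃ τ', Exec b procs (.loop .lt 103 0 (.seq (.const 104 16) (.seq (.binop .mul 105 103 104)
    (.seq (.const 104 1) (.seq (.binop .add 105 105 104) (.seq (.load 105 105)
      (.seq (.store 103 105) (.binop .add 103 103 104)))))))) τ (8 * n + 1) τ' ∧
      (∀ i < k, τ'.mem i = y i) := by
  induction n generalizing τ m with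
  | zero =>
    exact ⟨τ, .loopDone (by simp [Cmp.Holds, h103, h0]; omega), fun i hi => hlo i (by omega)⟩
  | succ n ih =>
    obtain ⟨τ₁, hreg0, hreg103, hmem, run⟩ : ∃ τ₁ : State, τ₁.reg 0 = k ∧ τ₁.reg 103 = m + 1 ∧
        τ₁.mem = Function.update τ.mem m (y m) ∧
        Exec b procs (.seq (.const 104 16) (.seq (.binop .mul 105 103 104)
          (.seq (.const 104 1) (.seq (.binop .add 105 105 104) (.seq (.load 105 105)
            (.seq (.store 103 105) (.binop .add 103 103 104))))))) τ
          (1 + (1 + (1 + (1 + (1 + (1 + 1)))))) τ₁ := by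
      refine ⟨_, ?_, ?_, ?_, .seq (.const _ _ _) (.seq (.binop _ _ _ _ _) (.seq (.const _ _ _)
        (.seq (.binop _ _ _ _ _) (.seq (.load _ _ _) (.seq (.store _ _ _) (.binop _ _ _ _ _))))))⟩
      · simp [State.setReg, State.setMem, h0]
      · simp [State.setReg, State.setMem, h103, BinOp.eval,
          Nat.mod_eq_of_lt (show 1 < 2 ^ b by omega)]
        exact Nat.mod_eq_of_lt (by omega)
      · simp [State.setReg, State.setMem, h103, BinOp.eval,
          Nat.mod_eq_of_lt (show 1 < 2 ^ b by omega), Nat.mod_eq_of_lt (show 16 < 2 ^ b by omega),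
          Nat.mod_eq_of_lt (show m * 16 + 1 < 2 ^ b by omega)]
        rw [mul_comm, hhi m le_rfl (by omega)]
    obtain ⟨τ', h1, h2⟩ := ih (m + 1) (by omega) τ₁ hreg103 hreg0
      (fun i hi => by
        rw [hmem, Function.update_apply]
        split_ifs with hc
        · rw [hc]
        · exact hlo i (by omega))
      (fun i hi hik => by
        rw [hmem, Function.update_apply, if_neg (by omega)]
        exact hhi i (by omega) hik)
    refine ⟨τ', ?_, h2⟩
    have := Exec.loopStep (cmp := .lt) (x := 103) (y := 0) (by simp [Cmp.Holds, h103, h0]; omega) run h1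
    convert this using 1
    ring

/-- The word RAM program of a statement with input in array `0` and output in array `1`. -/
def toProgram (procs : List Stmt) (s : Stmt) : Program where
  main := .seq inputCmd (.seq s.compile outputCmd)
  procs := procs.map Stmt.compile

/-- The specification `h` must hold for every store with the right input, since the other arrays
start with whatever the transfer of the input left in memory. The two transfers take `15 * k + 4`
steps, which `20 * k` covers because `k` is positive. -/
theorem toProgram_outputs {procs : List Stmt} {s : Stmt} {K : ℕ}
    (hprocs : ∀ s ∈ procs, s.wf = true ∧ s.size ≤ K) (hwf : s.wf = true) (hK : s.size ≤ K)
    (hK0 : 1 ≤ K) {b k W a T : ℕ} {P : Fin k → ℕ}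
    {Q : (Fin k → ℕ) → Prop} (hb : 16 * k + 16 < 2 ^ b) (hW : W < 2 ^ b)
    (ha : a < 2 ^ b) (hP : ∀ i, P i < 2 ^ b) (hk : 0 < k)
    (h : ∀ σ : Store, σ.reg 0 = k → σ.reg 1 = W → σ.reg 2 = a → (∀ i : Fin k, σ.arr 0 i = P i) →
      ∃ t σ', Run (2 ^ b) procs s σ t σ' ∧ t ≤ T ∧ σ'.reg 0 = k ∧ Q fun i : Fin k => σ'.arr 1 i) :
    ∃ t P', (toProgram procs s).Outputs b k W a P t P' ∧ Q P' ∧ t ≤ 20 * k + K * T := by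
  set τ₀ := initState k W a P with hτ₀
  have hr₀ : ∀ r, τ₀.reg r < 2 ^ b := fun r => by
    simp only [τ₀, initState]
    split_ifs <;> omega
  have hm₀ : ∀ i, τ₀.mem i < 2 ^ b := fun i => by
    simp only [τ₀, initState]
    split_ifs with h
    · exact hP _
    · omega
  obtain ⟨τ₁, h1, h2, h3, h4, h5⟩ := exec_inputLoop (procs := procs.map Stmt.compile)
    (p := fun i => if h : i < k then P ⟨i, h⟩ else 0) hb k le_rfl (τ₀.setReg 103 (τ₀.reg 0))
    (by simp [State.setReg, τ₀, initState]) (by simp [State.setReg, τ₀, initState])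
    (fun i hi => by simp [State.setReg, τ₀, initState]) (fun i h1 h2 => by omega)
    (State.setReg_lt hr₀ (hr₀ 0)) hm₀
  have hrep : Represents b τ₁ ⟨τ₁.reg, fun j i => τ₁.mem (16 * i + j)⟩ :=
    ⟨fun _ _ => rfl, fun _ _ _ _ => rfl, h4, h5⟩
  obtain ⟨t, σ', run, ht, k0, kY⟩ := h ⟨τ₁.reg, fun j i => τ₁.mem (16 * i + j)⟩
    (by simp only; rw [h2 _ (by omega)]; simp [State.setReg, τ₀, initState])
    (by simp only; rw [h2 _ (by omega)]; simp [State.setReg, τ₀, initState])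
    (by simp only; rw [h2 _ (by omega)]; simp [State.setReg, τ₀, initState])
    (fun i => by simp only [add_zero]; rw [h3 i i.2]; simp)
  obtain ⟨t', τ₂, run₂, rep₂, ht'⟩ := run.exec hprocs hwf hK hK0 hrep
  obtain ⟨τ₃, l1, l2⟩ := exec_outputLoop (procs := procs.map Stmt.compile)
    (y := σ'.arr 1) hb 0 k (by omega) (τ₂.setReg 103 (0 % 2 ^ b))
    (by simp [State.setReg]) (by simp [State.setReg]; rw [rep₂.reg _ (by omega), k0])
    (fun i hi => by omega)
    (fun i _ hi => by
      simp only [State.setReg]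
      rw [rep₂.arr 1 (by omega) i (by omega)])
  refine ⟨_, _, ⟨τ₃, .seq (.seq (.copy _ _ _) h1) (.seq run₂ (.seq (.const _ _ _) l1)), fun i => l2 i i.2⟩, kY, ?_⟩
  · have := Nat.mul_le_mul_left K ht
    omega

/-! ### Weakest preconditions with time -/

/-- Statement `s` started in `σ` halts with time and final store satisfying `Q`. -/
def WP (B : ℕ) (procs : List Stmt) (s : Stmt) (Q : ℕ → Store → Prop) (σ : Store) : Prop :=
  ∃ t σ', Run B procs s σ t σ' ∧ Q t σ'

instance (n : ℕ) : OfNat Expr n := ⟨.lit n⟩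
instance : Add Expr := ⟨.bin .add⟩
instance : Sub Expr := ⟨.bin .sub⟩
instance : Mul Expr := ⟨.bin .mul⟩

infix:50 " ≔ " => Stmt.set
infixr:45 " ;; " => Stmt.seq

section WP
variable {B : ℕ} {procs : List Stmt} {Q R : ℕ → Store → Prop} {σ : Store}

@[simp] theorem val_lit (n : ℕ) : (ofNat(n) : Expr).val σ = n := rfl
@[simp] theorem val_reg (r : ℕ) : (Expr.reg r).val σ = σ.reg r := rfl
@[simp] theorem val_arr (j : ℕ) (e : Expr) : (Expr.arr j e).val σ = σ.arr j (e.val σ) := rfl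
@[simp] theorem val_add (e f : Expr) : (e + f).val σ = e.val σ + f.val σ := rfl
@[simp] theorem val_sub (e f : Expr) : (e - f).val σ = e.val σ - f.val σ := rfl
@[simp] theorem val_mul (e f : Expr) : (e * f).val σ = e.val σ * f.val σ := rfl
@[simp] theorem val_and (e f : Expr) : (Expr.bin .and e f).val σ = e.val σ &&& f.val σ := rfl
@[simp] theorem val_or (e f : Expr) : (Expr.bin .or e f).val σ = e.val σ ||| f.val σ := rfl
@[simp] theorem val_xor (e f : Expr) : (Expr.bin .xor e f).val σ = e.val σ ^^^ f.val σ := rfl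
@[simp] theorem val_shl (e f : Expr) : (Expr.bin .shl e f).val σ = e.val σ * 2 ^ f.val σ := rfl
@[simp] theorem val_shr (e f : Expr) : (Expr.bin .shr e f).val σ = e.val σ / 2 ^ f.val σ := rfl
@[simp] theorem val_log2 (e : Expr) : (Expr.log2 e).val σ = Nat.log2 (e.val σ) := rfl

@[simp] theorem ok_lit (n : ℕ) : (ofNat(n) : Expr).Ok B σ ↔ n < B := Iff.rfl
@[simp] theorem ok_reg (r : ℕ) : (Expr.reg r).Ok B σ ↔ True := Iff.rfl
@[simp] theorem ok_arr (j : ℕ) (e : Expr) :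
    (Expr.arr j e).Ok B σ ↔ e.Ok B σ ∧ 16 * e.val σ + 16 < B := Iff.rfl
@[simp] theorem ok_add (e f : Expr) :
    (e + f).Ok B σ ↔ e.Ok B σ ∧ f.Ok B σ ∧ e.val σ + f.val σ < B := Iff.rfl
@[simp] theorem ok_sub (e f : Expr) :
    (e - f).Ok B σ ↔ e.Ok B σ ∧ f.Ok B σ ∧ f.val σ ≤ e.val σ := Iff.rfl
@[simp] theorem ok_mul (e f : Expr) :
    (e * f).Ok B σ ↔ e.Ok B σ ∧ f.Ok B σ ∧ e.val σ * f.val σ < B := Iff.rfl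
@[simp] theorem ok_and (e f : Expr) : (Expr.bin .and e f).Ok B σ ↔ e.Ok B σ ∧ f.Ok B σ := by
  simp [Expr.Ok, BinOp.Fits]
@[simp] theorem ok_or (e f : Expr) : (Expr.bin .or e f).Ok B σ ↔ e.Ok B σ ∧ f.Ok B σ := by
  simp [Expr.Ok, BinOp.Fits]
@[simp] theorem ok_xor (e f : Expr) : (Expr.bin .xor e f).Ok B σ ↔ e.Ok B σ ∧ f.Ok B σ := by
  simp [Expr.Ok, BinOp.Fits]
@[simp] theorem ok_shl (e f : Expr) :
    (Expr.bin .shl e f).Ok B σ ↔ e.Ok B σ ∧ f.Ok B σ ∧ e.val σ * 2 ^ f.val σ < B := Iff.rfl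
@[simp] theorem ok_shr (e f : Expr) : (Expr.bin .shr e f).Ok B σ ↔ e.Ok B σ ∧ f.Ok B σ := by
  simp [Expr.Ok, BinOp.Fits]
@[simp] theorem ok_log2 (e : Expr) : (Expr.log2 e).Ok B σ ↔ e.Ok B σ := Iff.rfl

@[simp] theorem reg_set (r v r' : ℕ) :
    (σ.set r v).reg r' = if r' = r then v else σ.reg r' := by
  simp [Store.set, Function.update_apply]
@[simp] theorem arr_set (r v : ℕ) : (σ.set r v).arr = σ.arr := rfl
@[simp] theorem reg_put (j i v : ℕ) : (σ.put j i v).reg = σ.reg := rfl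
@[simp] theorem arr_put (j i v j' : ℕ) :
    (σ.put j i v).arr j' = if j' = j then Function.update (σ.arr j) i v else σ.arr j' := by
  simp [Store.put, Function.update_apply]

@[simp] theorem holds_lt (x y : ℕ) : Cmp.lt.Holds x y ↔ x < y := Iff.rfl
@[simp] theorem holds_le (x y : ℕ) : Cmp.le.Holds x y ↔ x ≤ y := Iff.rfl
@[simp] theorem holds_eq (x y : ℕ) : Cmp.eq.Holds x y ↔ x = y := Iff.rfl
@[simp] theorem holds_ne (x y : ℕ) : Cmp.ne.Holds x y ↔ x ≠ y := Iff.rfl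

theorem WP.mono {s : Stmt} (h : WP B procs s Q σ) (hQ : ∀ t σ', Q t σ' → R t σ') :
    WP B procs s R σ := by
  obtain ⟨t, σ', h1, h2⟩ := h
  exact ⟨t, σ', h1, hQ _ _ h2⟩

@[simp] theorem wp_skip : WP B procs .skip Q σ ↔ Q 1 σ := by
  constructor
  · rintro ⟨t, σ', h, hQ⟩; cases h; exact hQ
  · exact fun h => ⟨_, _, .skip _, h⟩

@[simp] theorem wp_set (r : ℕ) (e : Expr) :
    WP B procs (r ≔ e) Q σ ↔ e.Ok B σ ∧ Q 1 (σ.set r (e.val σ)) := by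
  constructor
  · rintro ⟨t, σ', h, hQ⟩; cases h with | set _ _ _ h => exact ⟨h, hQ⟩
  · exact fun h => ⟨_, _, .set _ _ _ h.1, h.2⟩

@[simp] theorem wp_put (j : ℕ) (e f : Expr) :
    WP B procs (.put j e f) Q σ ↔ e.Ok B σ ∧ f.Ok B σ ∧ 16 * e.val σ + 16 < B ∧
      Q 1 (σ.put j (e.val σ) (f.val σ)) := by
  constructor
  · rintro ⟨t, σ', h, hQ⟩; cases h with | put _ _ _ _ h1 h2 h3 => exact ⟨h1, h2, h3, hQ⟩
  · exact fun h => ⟨_, _, .put _ _ _ _ h.1 h.2.1 h.2.2.1, h.2.2.2⟩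

@[simp] theorem wp_seq (s₁ s₂ : Stmt) :
    WP B procs (s₁ ;; s₂) Q σ ↔
      WP B procs s₁ (fun t₁ σ₁ => WP B procs s₂ (fun t₂ σ₂ => Q (t₁ + t₂) σ₂) σ₁) σ := by
  constructor
  · rintro ⟨t, σ', h, hQ⟩; cases h with | seq h1 h2 => exact ⟨_, _, h1, _, _, h2, hQ⟩
  · rintro ⟨t₁, σ₁, h1, t₂, σ₂, h2, hQ⟩; exact ⟨_, _, .seq h1 h2, hQ⟩

@[simp] theorem wp_ite (cmp : Cmp) (e f : Expr) (s₁ s₂ : Stmt) :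
    WP B procs (.ite cmp e f s₁ s₂) Q σ ↔ e.Ok B σ ∧ f.Ok B σ ∧
      (cmp.Holds (e.val σ) (f.val σ) → WP B procs s₁ (fun t => Q (t + 1)) σ) ∧
      (¬ cmp.Holds (e.val σ) (f.val σ) → WP B procs s₂ (fun t => Q (t + 1)) σ) := by
  constructor
  · rintro ⟨t, σ', h, hQ⟩
    cases h with
    | iteTrue h1 h2 h3 h4 => exact ⟨h1, h2, fun _ => ⟨_, _, h4, hQ⟩, fun h => absurd h3 h⟩
    | iteFalse h1 h2 h3 h4 => exact ⟨h1, h2, fun h => absurd h h3, fun _ => ⟨_, _, h4, hQ⟩⟩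
  · rintro ⟨h1, h2, h3, h4⟩
    by_cases hc : cmp.Holds (e.val σ) (f.val σ)
    · obtain ⟨t, σ', h, hQ⟩ := h3 hc
      exact ⟨_, _, .iteTrue h1 h2 hc h, hQ⟩
    · obtain ⟨t, σ', h, hQ⟩ := h4 hc
      exact ⟨_, _, .iteFalse h1 h2 hc h, hQ⟩

theorem WP.call {p : ℕ} {s : Stmt} (hp : procs[p]? = some s)
    (h : WP B procs s (fun t => Q (t + 1)) σ) : WP B procs (.call p) Q σ := by
  obtain ⟨t, σ', h1, h2⟩ := h
  exact ⟨_, _, .call hp h1, h2⟩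

/-- Loops with an invariant indexed by ghost data and a bound for the remaining time. -/
theorem WP.loop {α : Type*} {cmp : Cmp} {e f : Expr} {s : Stmt} (Inv : α → Store → Prop) (Φ : α → ℕ)
    (hok : ∀ x σ, Inv x σ → e.Ok B σ ∧ f.Ok B σ ∧ 1 ≤ Φ x)
    (hstep : ∀ x σ, Inv x σ → cmp.Holds (e.val σ) (f.val σ) →
      WP B procs s (fun t σ' => ∃ y, Inv y σ' ∧ t + 1 + Φ y ≤ Φ x) σ)
    {x : α} (h : Inv x σ) :
    WP B procs (.loop cmp e f s)
      (fun t σ' => t ≤ Φ x ∧ ∃ y, Inv y σ' ∧ ¬ cmp.Holds (e.val σ') (f.val σ')) σ := by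
  -- The bound for the remaining time doubles as the termination measure.
  obtain ⟨N, hN⟩ : ∃ N, Φ x = N := ⟨_, rfl⟩
  induction N using Nat.strong_induction_on generalizing x σ with
  | _ N ih =>
    obtain ⟨h1, h2, h3⟩ := hok x σ h
    by_cases hc : cmp.Holds (e.val σ) (f.val σ)
    · obtain ⟨t, σ₁, r1, y, hy, ht⟩ := hstep x σ h hc
      obtain ⟨t₂, σ₂, r2, ht2, z, hz, hz'⟩ := ih (Φ y) (by omega) hy rfl
      exact ⟨_, _, .loopStep h1 h2 hc r1 r2, by omega, z, hz, hz'⟩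
    · exact ⟨_, _, .loopDone h1 h2 hc, by omega, x, h, hc⟩

/-- Loops that count up to `N`. -/
theorem WP.forLoop {cmp : Cmp} {e f : Expr} {s : Stmt} (Inv : ℕ → Store → Prop) (N T : ℕ)
    (hok : ∀ i σ, i ≤ N → Inv i σ → e.Ok B σ ∧ f.Ok B σ ∧ (cmp.Holds (e.val σ) (f.val σ) ↔ i < N))
    (hstep : ∀ i σ, i < N → Inv i σ → WP B procs s (fun t σ' => t ≤ T ∧ Inv (i + 1) σ') σ)
    (h : Inv 0 σ) :
    WP B procs (.loop cmp e f s) (fun t σ' => t ≤ N * (T + 1) + 1 ∧ Inv N σ') σ := by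
  refine (WP.loop (Inv := fun i σ => i ≤ N ∧ Inv i σ) (Φ := fun i => (N - i) * (T + 1) + 1)
    (fun i σ hi => ⟨(hok i σ hi.1 hi.2).1, (hok i σ hi.1 hi.2).2.1, by omega⟩)
    (fun i σ hi hc => ?_) (x := 0) ⟨Nat.zero_le _, h⟩).mono ?_
  · have hlt := (hok i σ hi.1 hi.2).2.2.1 hc
    refine (hstep i σ hlt hi.2).mono fun t σ' ht => ⟨i + 1, ⟨hlt, ht.2⟩, ?_⟩
    have : (N - i) * (T + 1) = (N - (i + 1)) * (T + 1) + (T + 1) := by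
      rw [show N - i = N - (i + 1) + 1 by omega]; ring
    omega
  · rintro t σ' ⟨ht, i, hi, hc⟩
    refine ⟨by simpa using ht, ?_⟩
    have := (hok i σ' hi.1 hi.2).2.2.not.1 hc
    obtain rfl : i = N := by omega
    exact hi.2

end WP
end TrafficSplit

namespace TrafficSplit

/-! ### The bit order on words -/

/-- The lowest `s` bits of `x` in reversed order. -/
def rev : ℕ → ℕ → ℕ
  | 0, _ => 0
  | s + 1, x => (x % 2) * 2 ^ s + rev s (x / 2)

theorem rev_lt (s x : ℕ) : rev s x < 2 ^ s := by
  induction s generalizing x with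
  | zero => simp [rev]
  | succ s ih =>
    have := ih (x / 2)
    have h2 : x % 2 = 0 ∨ x % 2 = 1 := by omega
    rw [rev, pow_succ]
    rcases h2 with h | h <;> rw [h] <;> omega

/-- Reversing the bits turns the bit order into the usual order of numbers, so that selection can be
specified by numerical keys. The programs only compare these keys and never compute them. -/
theorem lexLe_of_rev_le {s x y : ℕ} (hx : x < 2 ^ s) (hy : y < 2 ^ s) (h : rev s x ≤ rev s y) :
    LexLe x y := by
  induction s generalizing x y with
  | zero =>
    obtain rfl : x = y := by omega
    exact .refl _
  | succ s ih =>
    simp only [rev] at h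
    have h1 := rev_lt s (x / 2)
    have h2 := rev_lt s (y / 2)
    have hx2 : x % 2 = 0 ∨ x % 2 = 1 := by omega
    have hy2 : y % 2 = 0 ∨ y % 2 = 1 := by omega
    by_cases hlt : x % 2 = 0 ∧ y % 2 = 1
    · exact .parity _ _ (by omega) (by omega)
    · have heq : x % 2 = y % 2 := by
        rcases hx2 with hx2 | hx2 <;> rcases hy2 with hy2 | hy2 <;> rw [hx2, hy2] at h <;> omega
      rw [heq] at h
      have := ih (x := x / 2) (y := y / 2) (by omega) (by omega) (by omega)
      refine .half _ _ (by omega) ?_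
      exact_mod_cast this

theorem two_mul_land_two_mul (x y : ℕ) : (2 * x) &&& (2 * y) = 2 * (x &&& y) := by
  have h1 : ((2 * x) &&& (2 * y)) / 2 = x &&& y := by
    rw [Nat.and_div_two]; congr 1 <;> omega
  have h2 : ((2 * x) &&& (2 * y)) % 2 = 0 := by
    have := (Nat.and_mod_two_eq_one (a := 2 * x) (b := 2 * y)).not.2 (by omega)
    omega
  omega

theorem land_two_pow_sub_of_odd {s z : ℕ} (hz : z < 2 ^ s) (hodd : z % 2 = 1) :
    z &&& (2 ^ s - z) = 1 := by
  obtain ⟨s, rfl⟩ : ∃ s', s = s' + 1 := Nat.exists_eq_succ_of_ne_zero (by rintro rfl; omega)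
  have hz' : z / 2 < 2 ^ s := by rw [pow_succ] at hz; omega
  have h0 : z / 2 &&& (2 ^ s - (z / 2 + 1)) = 0 := by
    refine Nat.eq_of_testBit_eq fun i => ?_
    rw [Nat.testBit_and, Nat.testBit_two_pow_sub_succ hz', Nat.zero_testBit]
    cases (z / 2).testBit i <;> simp
  have h1 : (z &&& (2 ^ (s + 1) - z)) / 2 = 0 := by
    rw [Nat.and_div_two, ← h0]
    congr 1
    rw [pow_succ] at hz ⊢
    omega
  have h2 : (z &&& (2 ^ (s + 1) - z)) % 2 = 1 :=
    Nat.and_mod_two_eq_one.2 ⟨hodd, by rw [pow_succ] at hz ⊢; omega⟩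
  omega

/-- `z &&& (2 ^ s - z)` is the lowest bit of `z`. -/
theorem land_two_pow_sub {s t c : ℕ} (hz : 2 ^ t * (2 * c + 1) < 2 ^ s) :
    2 ^ t * (2 * c + 1) &&& (2 ^ s - 2 ^ t * (2 * c + 1)) = 2 ^ t := by
  induction t generalizing s with
  | zero =>
    rw [pow_zero, one_mul] at *
    exact land_two_pow_sub_of_odd hz (by omega)
  | succ t ih =>
    have hpos : 0 < 2 ^ (t + 1) * (2 * c + 1) := by positivity
    obtain ⟨s, rfl⟩ : ∃ s', s = s' + 1 :=
      Nat.exists_eq_succ_of_ne_zero (by rintro rfl; rw [pow_zero] at hz; omega)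
    rw [pow_succ' 2 t, mul_assoc, pow_succ' 2 s] at *
    rw [← Nat.mul_sub, two_mul_land_two_mul, ih (by omega)]

theorem exists_eq_two_pow_mul_odd {z : ℕ} (hz : z ≠ 0) : ∃ t c, z = 2 ^ t * (2 * c + 1) := by
  obtain ⟨t, m, hm, rfl⟩ := Nat.exists_eq_two_pow_mul_odd hz
  obtain ⟨c, rfl⟩ := hm
  exact ⟨t, c, rfl⟩

/-- A word that is nonzero if and only if `x` is smaller than `y` in the bit order. -/
def ltWord (M x y : ℕ) : ℕ := y &&& ((x ^^^ y) &&& (M - (x ^^^ y)))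

/-- The lowest set bit of `x ^^^ y` marks the first position where the words differ, and the larger
word is the one with a `1` there. Hence a comparison in the bit order takes constantly many
operations. -/
theorem ltWord_ne_zero_iff {s x y : ℕ} (hx : x < 2 ^ s) (hy : y < 2 ^ s) :
    ltWord (2 ^ s) x y ≠ 0 ↔ rev s x < rev s y := by
  induction s generalizing x y with
  | zero =>
    obtain rfl : x = 0 := by omega
    obtain rfl : y = 0 := by omega
    simp [ltWord, rev]
  | succ s ih =>
    have hx2 : x / 2 < 2 ^ s := by rw [pow_succ] at hx; omega
    have hy2 : y / 2 < 2 ^ s := by rw [pow_succ] at hy; omega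
    have hxy : (x ^^^ y) < 2 ^ (s + 1) := Nat.xor_lt_two_pow hx hy
    have hdiv : (x ^^^ y) / 2 = x / 2 ^^^ y / 2 := Nat.xor_div_two
    have hmod : (x ^^^ y) % 2 = (x + y) % 2 := Nat.xor_mod_two_eq
    have h1 := rev_lt s (x / 2)
    have h2 := rev_lt s (y / 2)
    by_cases heq : x % 2 = y % 2
    · have e1 : x ^^^ y = 2 * (x / 2 ^^^ y / 2) := by omega
      have e2 : ltWord (2 ^ (s + 1)) x y = 2 * ltWord (2 ^ s) (x / 2) (y / 2) := by
        have e3 : (x ^^^ y) &&& (2 ^ (s + 1) - (x ^^^ y)) =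
            2 * ((x / 2 ^^^ y / 2) &&& (2 ^ s - (x / 2 ^^^ y / 2))) := by
          rw [e1, pow_succ', ← Nat.mul_sub, two_mul_land_two_mul]
        rw [ltWord, e3, ltWord]
        generalize (x / 2 ^^^ y / 2) &&& (2 ^ s - (x / 2 ^^^ y / 2)) = w
        have h3 : (y &&& 2 * w) / 2 = y / 2 &&& w := by
          rw [Nat.and_div_two]; congr 1; omega
        have h4 := (Nat.and_mod_two_eq_one (a := y) (b := 2 * w)).not.2 (by omega)
        omega
      rw [e2, rev, rev, heq]
      have := ih hx2 hy2
      constructor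
      · intro h
        have := this.1 (by omega)
        omega
      · intro h
        have := this.2 (by omega)
        omega
    · rw [ltWord, land_two_pow_sub_of_odd hxy (by omega), Nat.and_one_is_mod, rev, rev]
      have hx3 : x % 2 = 0 ∨ x % 2 = 1 := by omega
      rcases hx3 with h | h
      · rw [h, show y % 2 = 1 by omega]; omega
      · rw [h, show y % 2 = 0 by omega]; omega

/-! ### Ranks -/

/-- The entries `f s, …, f (s + m - 1)`. -/
def seg (f : ℕ → ℕ) (s m : ℕ) : List ℕ := (List.range m).map fun i => f (s + i)

theorem seg_zero (f : ℕ → ℕ) (s : ℕ) : seg f s 0 = [] := rfl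

theorem seg_succ (f : ℕ → ℕ) (s m : ℕ) : seg f s (m + 1) = seg f s m ++ [f (s + m)] := by
  simp [seg, List.range_succ]

@[simp] theorem length_seg (f : ℕ → ℕ) (s m : ℕ) : (seg f s m).length = m := by simp [seg]

theorem mem_seg {f : ℕ → ℕ} {s m x : ℕ} : x ∈ seg f s m ↔ ∃ i < m, f (s + i) = x := by simp [seg]

theorem seg_congr {f g : ℕ → ℕ} {s m : ℕ} (h : ∀ i < m, f (s + i) = g (s + i)) :
    seg f s m = seg g s m :=
  List.map_congr_left fun i hi => h i (List.mem_range.1 hi)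

theorem seg_add (f : ℕ → ℕ) (s m n : ℕ) : seg f s (m + n) = seg f s m ++ seg f (s + m) n := by
  induction n with
  | zero => simp [seg_zero]
  | succ n ih => rw [← add_assoc, seg_succ, ih, seg_succ, List.append_assoc, add_assoc]

variable (κ : ℕ → ℕ)

/-- The number of entries below `x`. -/
def cntLt (L : List ℕ) (x : ℕ) : ℕ := L.countP fun y => decide (κ y < κ x)
/-- The number of entries up to `x`. -/
def cntLe (L : List ℕ) (x : ℕ) : ℕ := L.countP fun y => decide (κ y ≤ κ x)

/-- `x` is the entry of `L` with index `r` in sorted order. -/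
def IsRank (L : List ℕ) (r x : ℕ) : Prop := x ∈ L ∧ cntLt κ L x ≤ r ∧ r < cntLe κ L x

variable {κ}

/-- Among the entries with at most `r` smaller ones take one of largest key. If its own count
`cntLe` were still at most `r`, the entry with the next larger key would also qualify. -/
theorem exists_isRank {L : List ℕ} {r : ℕ} (hr : r < L.length) : ∃ x, IsRank κ L r x := by
  classical
  have hne : ∃ x ∈ L, cntLt κ L x ≤ r := by
    obtain ⟨x, hx, hmin⟩ := L.toFinset.exists_min_image κ
      ⟨L[0], List.mem_toFinset.2 (List.getElem_mem (by omega))⟩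
    refine ⟨x, List.mem_toFinset.1 hx, ?_⟩
    rw [cntLt, List.countP_eq_zero.2 fun y hy => by simpa using hmin y (List.mem_toFinset.2 hy)]
    omega
  obtain ⟨x, hx, hmax⟩ := (L.toFinset.filter fun x => cntLt κ L x ≤ r).exists_max_image κ (by
    obtain ⟨x, h1, h2⟩ := hne
    exact ⟨x, by simp [h1, h2]⟩)
  simp only [Finset.mem_filter, List.mem_toFinset] at hx hmax
  refine ⟨x, hx.1, hx.2, ?_⟩
  by_contra hc
  have hgt : ∃ y ∈ L, κ x < κ y := by
    by_contra! hall
    refine hc ?_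
    rw [cntLe, List.countP_eq_length.2 fun y hy => by simpa using hall y hy]
    exact hr
  obtain ⟨y, hy, hmin⟩ := (L.toFinset.filter fun y => κ x < κ y).exists_min_image κ (by
    obtain ⟨y, h1, h2⟩ := hgt
    exact ⟨y, by simp [h1, h2]⟩)
  simp only [Finset.mem_filter, List.mem_toFinset] at hy hmin
  have hle : cntLt κ L y ≤ cntLe κ L x := by
    refine List.countP_mono_left fun z hz h => ?_
    simp only [decide_eq_true_eq] at h ⊢
    by_contra hlt
    have := hmin z ⟨hz, by omega⟩
    omega
  have := hmax y ⟨hy.1, by omega⟩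
  omega

theorem IsRank.of_filter_lt {L : List ℕ} {r x p : ℕ}
    (h : IsRank κ (L.filter fun y => decide (κ y < κ p)) r x) : IsRank κ L r x := by
  obtain ⟨h1, h2, h3⟩ := h
  simp only [List.mem_filter, decide_eq_true_eq] at h1
  refine ⟨h1.1, ?_, ?_⟩
  · rw [cntLt, List.countP_filter] at h2
    rw [cntLt]
    convert h2 using 3
    grind
  · rw [cntLe, List.countP_filter] at h3
    rw [cntLe]
    convert h3 using 3
    grind

theorem countP_add_countP_not {L : List ℕ} (p : ℕ → Bool) :
    L.countP p + L.countP (fun x => !p x) = L.length := by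
  have := List.length_eq_countP_add_countP (l := L) p
  simpa using this.symm

theorem countP_eq_add {L : List ℕ} {p q r : ℕ → Bool}
    (h : ∀ x ∈ L, (p x).toNat = (q x).toNat + (r x).toNat) :
    L.countP p = L.countP q + L.countP r := by
  induction L with
  | nil => simp
  | cons a L ih =>
    have h1 := h a (by simp)
    have h2 := ih fun x hx => h x (by simp [hx])
    rw [List.countP_cons, List.countP_cons, List.countP_cons, h2]
    cases hp : p a <;> cases hq : q a <;> cases hr : r a <;> simp [hp, hq, hr] at h1 ⊢ <;> omega

theorem IsRank.of_filter_gt {L : List ℕ} {r x p : ℕ} (hr : cntLe κ L p ≤ r)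
    (h : IsRank κ (L.filter fun y => decide (κ p < κ y)) (r - cntLe κ L p) x) : IsRank κ L r x := by
  obtain ⟨h1, h2, h3⟩ := h
  simp only [List.mem_filter, decide_eq_true_eq] at h1
  rw [cntLt, List.countP_filter] at h2
  rw [show cntLe κ (L.filter fun y => decide (κ p < κ y)) x = _ from List.countP_filter] at h3
  have e1 : cntLt κ L x = cntLe κ L p +
      L.countP fun a => decide (κ a < κ x) && decide (κ p < κ a) := by
    refine countP_eq_add fun y _ => ?_
    by_cases ha : κ y < κ x <;> by_cases hb : κ y ≤ κ p <;> by_cases hc : κ p < κ y <;>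
      simp [ha, hb, hc] <;> omega
  have e2 : cntLe κ L x = cntLe κ L p +
      L.countP fun a => decide (κ a ≤ κ x) && decide (κ p < κ a) := by
    refine countP_eq_add fun y _ => ?_
    by_cases ha : κ y ≤ κ x <;> by_cases hb : κ y ≤ κ p <;> by_cases hc : κ p < κ y <;>
      simp [ha, hb, hc] <;> omega
  exact ⟨h1.1, by omega, by omega⟩

theorem length_filter_gt {L : List ℕ} {p : ℕ} :
    cntLe κ L p + (L.filter fun y => decide (κ p < κ y)).length = L.length := by
  rw [← List.countP_eq_length_filter, cntLe, ← countP_add_countP_not (L := L) fun y => decide (κ y ≤ κ p)]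
  congr 2
  funext y
  by_cases h : κ y ≤ κ p <;> simp [h]; omega

/-- If every group of eight with a marked representative contains four good entries, there are four
times as many good entries as marked representatives. -/
theorem four_mul_countP_le {f g : ℕ → ℕ} {s s' q m : ℕ} {good marked : ℕ → Bool} (hq : 8 * q ≤ m)
    (h : ∀ i < q, marked (g (s' + i)) = true → 4 ≤ (seg f (s + 8 * i) 8).countP good) :
    4 * (seg g s' q).countP marked ≤ (seg f s m).countP good := by
  have h1 : 4 * (seg g s' q).countP marked ≤ (seg f s (8 * q)).countP good := by
    clear hq
    induction q with
    | zero => simp [seg_zero]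
    | succ q ih =>
      have h2 := ih fun i hi => h i (by omega)
      have h3 := h q (by omega)
      rw [show 8 * (q + 1) = 8 * q + 8 by ring, seg_add f, List.countP_append, seg_succ g,
        List.countP_append, List.countP_singleton]
      split_ifs with hm
      · have := h3 hm; omega
      · omega
  refine h1.trans ?_
  obtain ⟨d, rfl⟩ := Nat.exists_eq_add_of_le hq
  rw [seg_add, List.countP_append]
  omega

/-- The median of the medians of groups of eight is a good pivot. -/
theorem pivot_bounds {f g : ℕ → ℕ} {s s' q m p : ℕ} (hq : 8 * q ≤ m)
    (hg : ∀ i < q, IsRank κ (seg f (s + 8 * i) 8) 4 (g (s' + i)))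
    (hp : IsRank κ (seg g s' q) (q / 2) p) :
    cntLt κ (seg f s m) p + 2 * q ≤ m ∧ m ≤ cntLe κ (seg f s m) p + (m - 2 * q) := by
  obtain ⟨-, hp1, hp2⟩ := hp
  constructor
  -- A group whose representative is not below `p` contains at least four entries not below `p`. At
  -- least half of the `q` groups are of this kind, which gives `2 * q` entries. The second half of
  -- the proof counts the entries up to `p` in the same way.
  · have h1 : 4 * (seg g s' q).countP (fun y => !decide (κ y < κ p)) ≤
        (seg f s m).countP fun y => !decide (κ y < κ p) := by
      refine four_mul_countP_le hq fun i hi hm => ?_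
      obtain ⟨-, h2, -⟩ := hg i hi
      have h3 := countP_add_countP_not (L := seg f (s + 8 * i) 8)
        fun y => decide (κ y < κ (g (s' + i)))
      have h4 : (seg f (s + 8 * i) 8).countP (fun y => !decide (κ y < κ (g (s' + i)))) ≤
          (seg f (s + 8 * i) 8).countP (fun y => !decide (κ y < κ p)) :=
        List.countP_mono_left fun y _ hy => by simp at hm hy ⊢; omega
      rw [length_seg] at h3
      rw [cntLt] at h2
      omega
    have h2 := countP_add_countP_not (L := seg f s m) fun y => decide (κ y < κ p)
    have h3 := countP_add_countP_not (L := seg g s' q) fun y => decide (κ y < κ p)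
    rw [length_seg] at h2 h3
    rw [cntLt] at hp1 ⊢
    omega
  · have h1 : 4 * (seg g s' q).countP (fun y => decide (κ y ≤ κ p)) ≤
        (seg f s m).countP fun y => decide (κ y ≤ κ p) := by
      refine four_mul_countP_le hq fun i hi hm => ?_
      obtain ⟨-, -, h2⟩ := hg i hi
      have h4 : (seg f (s + 8 * i) 8).countP (fun y => decide (κ y ≤ κ (g (s' + i)))) ≤
          (seg f (s + 8 * i) 8).countP (fun y => decide (κ y ≤ κ p)) :=
        List.countP_mono_left fun y _ hy => by simp at hm hy ⊢; omega
      rw [cntLe] at h2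
      omega
    rw [cntLe] at hp2 ⊢
    omega

end TrafficSplit

namespace TrafficSplit

/-! ### Selection -/

/-- Outside of the registers `[lo, hi)` and the arrays in `l` nothing has changed. -/
structure Frame (lo hi : ℕ) (l : List ℕ) (σ σ' : Store) : Prop where
  reg : ∀ r, r < lo ∨ hi ≤ r → σ'.reg r = σ.reg r
  arr : ∀ j, j ∉ l → σ'.arr j = σ.arr j

section Frame
variable {lo hi : ℕ} {l : List ℕ} {σ σ' σ'' : Store}

theorem Frame.refl (lo hi : ℕ) (l : List ℕ) (σ : Store) : Frame lo hi l σ σ :=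
  ⟨fun _ _ => rfl, fun _ _ => rfl⟩

theorem Frame.trans {lo' hi' : ℕ} {l' : List ℕ} (h : Frame lo hi l σ σ') (h' : Frame lo' hi' l' σ' σ'')
    (h1 : lo ≤ lo') (h2 : hi' ≤ hi) (h3 : l' ⊆ l) : Frame lo hi l σ σ'' :=
  ⟨fun r hr => (h'.reg r (by omega)).trans (h.reg r hr),
    fun j hj => (h'.arr j fun hj' => hj (h3 hj')).trans (h.arr j hj)⟩

@[simp] theorem frame_set_iff {r v : ℕ} (hr : lo ≤ r ∧ r < hi) :
    Frame lo hi l σ (σ'.set r v) ↔ Frame lo hi l σ σ' := by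
  refine ⟨fun h => ⟨fun r' hr' => ?_, h.arr⟩, fun h => ⟨fun r' hr' => ?_, h.arr⟩⟩
  · rw [← h.reg r' hr', reg_set, if_neg (by omega)]
  · rw [reg_set, if_neg (by omega), h.reg r' hr']

@[simp] theorem frame_put_iff {j i v : ℕ} (hj : j ∈ l) :
    Frame lo hi l σ (σ'.put j i v) ↔ Frame lo hi l σ σ' := by
  refine ⟨fun h => ⟨h.reg, fun j' hj' => ?_⟩, fun h => ⟨h.reg, fun j' hj' => ?_⟩⟩
  · rw [← h.arr j' hj', arr_put, if_neg (by rintro rfl; exact hj' hj)]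
  · rw [arr_put, if_neg (by rintro rfl; exact hj' hj), h.arr j' hj']

end Frame

/-- A word that is nonzero if and only if `e` is smaller than `f` in the bit order. -/
def ltE (e f : Expr) : Expr := .bin .and f (.bin .and (.bin .xor e f) (.reg 3 - .bin .xor e f))

@[simp] theorem val_ltE (σ : Store) (e f : Expr) :
    (ltE e f).val σ = ltWord (σ.reg 3) (e.val σ) (f.val σ) := rfl

@[simp] theorem ok_ltE (B : ℕ) (σ : Store) (e f : Expr) :
    (ltE e f).Ok B σ ↔ e.Ok B σ ∧ f.Ok B σ ∧ e.val σ ^^^ f.val σ ≤ σ.reg 3 := by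
  simp only [ltE, ok_and, ok_sub, ok_xor, ok_reg, val_xor, val_reg]
  tauto

theorem xor_le_two_pow {w x y : ℕ} (hx : x < 2 ^ w) (hy : y < 2 ^ w) : x ^^^ y ≤ 2 ^ w :=
  (Nat.xor_lt_two_pow hx hy).le

theorem cntLt_seg_succ (κ f : ℕ → ℕ) (s m x : ℕ) :
    cntLt κ (seg f s (m + 1)) x = cntLt κ (seg f s m) x + if κ (f (s + m)) < κ x then 1 else 0 := by
  simp [cntLt, seg_succ]

theorem cntLe_seg_succ (κ f : ℕ → ℕ) (s m x : ℕ) :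
    cntLe κ (seg f s (m + 1)) x = cntLe κ (seg f s m) x + if κ (f (s + m)) ≤ κ x then 1 else 0 := by
  simp [cntLe, seg_succ]

/-- Counts the entries of the segment of length `r₅₁` at `r₅₀` below, and up to, `r₅₈`. -/
def countLoop : Stmt :=
  .loop .lt (.reg 55) (.reg 51) (
    59 ≔ .arr 2 (.reg 50 + .reg 55) ;;
    .ite .ne (ltE (.reg 59) (.reg 58)) 0 (56 ≔ .reg 56 + 1) .skip ;;
    .ite .eq (ltE (.reg 58) (.reg 59)) 0 (57 ≔ .reg 57 + 1) .skip ;;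
    55 ≔ .reg 55 + 1)

/-- Finds the entry of rank `r₅₂` of the segment of length `r₅₁` at `r₅₀` in quadratic time. -/
def bruteRank : Stmt :=
  54 ≔ 0 ;;
  .loop .lt (.reg 54) (.reg 51) (
    58 ≔ .arr 2 (.reg 50 + .reg 54) ;; 55 ≔ 0 ;; 56 ≔ 0 ;; 57 ≔ 0 ;;
    countLoop ;;
    .ite .le (.reg 56) (.reg 52) (.ite .lt (.reg 52) (.reg 57) (53 ≔ .reg 58) .skip) .skip ;;
    54 ≔ .reg 54 + 1)

/-- Appends the entries of rank four of the blocks of length eight to the segment. -/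
def groupLoop : Stmt :=
  .loop .lt (.reg 45) (.reg 46) (
    50 ≔ .reg 40 + .reg 45 * 8 ;; 51 ≔ 8 ;; 52 ≔ 4 ;; bruteRank ;;
    .put 2 (.reg 40 + .reg 41 + .reg 45) (.reg 53) ;; 45 ≔ .reg 45 + 1)

/-- Appends the entries `r₄₈` with `e` below `f` to the segment. -/
def filterLoop (e f : Expr) : Stmt :=
  .loop .lt (.reg 45) (.reg 41) (
    48 ≔ .arr 2 (.reg 40 + .reg 45) ;;
    .ite .ne (ltE e f) 0
      (.put 2 (.reg 40 + .reg 41 + .reg 46) (.reg 48) ;; 46 ≔ .reg 46 + 1) .skip ;;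
    45 ≔ .reg 45 + 1)

/-- Narrows the search down to one side of the pivot `r₄₃`. -/
def selectSide : Stmt :=
  50 ≔ .reg 40 ;; 51 ≔ .reg 41 ;; 58 ≔ .reg 43 ;; 55 ≔ 0 ;; 56 ≔ 0 ;; 57 ≔ 0 ;; countLoop ;;
  .ite .le (.reg 56) (.reg 42)
    (.ite .lt (.reg 42) (.reg 57) .skip
      (45 ≔ 0 ;; 46 ≔ 0 ;; filterLoop (.reg 43) (.reg 48) ;; 42 ≔ .reg 42 - .reg 57 ;;
        40 ≔ .reg 40 + .reg 41 ;; 41 ≔ .reg 46 ;; .call 0))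
    (45 ≔ 0 ;; 46 ≔ 0 ;; filterLoop (.reg 48) (.reg 43) ;;
      40 ≔ .reg 40 + .reg 41 ;; 41 ≔ .reg 46 ;; .call 0)

/-- Finds the entry of rank `r₄₂` of the segment of length `r₄₁` at `r₄₀` in linear time, by the
median of medians of blocks. The result is in `r₄₃`; array `3` is a stack with top `r₄₄`. -/
def selectProc : Stmt :=
  .ite .lt (.reg 41) 32
    (50 ≔ .reg 40 ;; 51 ≔ .reg 41 ;; 52 ≔ .reg 42 ;; bruteRank ;; 43 ≔ .reg 53)
    (45 ≔ 0 ;; 46 ≔ .bin .shr (.reg 41) 3 ;; groupLoop ;;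
      .put 3 (.reg 44) (.reg 40) ;; .put 3 (.reg 44 + 1) (.reg 41) ;;
      .put 3 (.reg 44 + 2) (.reg 42) ;; 44 ≔ .reg 44 + 3 ;;
      40 ≔ .reg 40 + .reg 41 ;; 41 ≔ .reg 46 ;; 42 ≔ .bin .shr (.reg 46) 1 ;; .call 0 ;;
      44 ≔ .reg 44 - 3 ;; 40 ≔ .arr 3 (.reg 44) ;; 41 ≔ .arr 3 (.reg 44 + 1) ;;
      42 ≔ .arr 3 (.reg 44 + 2) ;; selectSide)

section Select
variable {B : ℕ} {procs : List Stmt} {w : ℕ}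

theorem countLoop_spec {σ : Store} {s m x : ℕ} (h3 : σ.reg 3 = 2 ^ w) (h50 : σ.reg 50 = s)
    (h51 : σ.reg 51 = m) (h58 : σ.reg 58 = x) (h55 : σ.reg 55 = 0) (h56 : σ.reg 56 = 0)
    (h57 : σ.reg 57 = 0) (hx : x < 2 ^ w) (hA : ∀ i < m, σ.arr 2 (s + i) < 2 ^ w)
    (hB : 16 * (s + m) + 100 < B) :
    WP B procs countLoop (fun t σ' => t ≤ m * 9 + 1 ∧ Frame 55 60 [] σ σ' ∧ σ'.reg 58 = x ∧
      σ'.reg 56 = cntLt (rev w) (seg (σ.arr 2) s m) x ∧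
      σ'.reg 57 = cntLe (rev w) (seg (σ.arr 2) s m) x) σ := by
  refine (WP.forLoop (fun i τ => Frame 55 60 [] σ τ ∧ τ.reg 55 = i ∧ τ.reg 58 = x ∧
      τ.reg 56 = cntLt (rev w) (seg (σ.arr 2) s i) x ∧
      τ.reg 57 = cntLe (rev w) (seg (σ.arr 2) s i) x) m 8 ?_ ?_ ?_).mono ?_
  · rintro i τ hi ⟨hF, h1, h2, h4, h5⟩
    simp [hF.reg, h1, h51]
  · rintro i τ hi ⟨hF, h1, h2, h4, h5⟩
    have hy := hA i hi
    have hxy := xor_le_two_pow hx hy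
    have hyx := xor_le_two_pow hy hx
    have k1 := ltWord_ne_zero_iff hy hx
    have k2 := ltWord_ne_zero_iff hx hy
    have c1 : cntLt (rev w) (seg (σ.arr 2) s i) x ≤ i :=
      List.countP_le_length.trans (length_seg _ _ _).le
    have c2 : cntLe (rev w) (seg (σ.arr 2) s i) x ≤ i :=
      List.countP_le_length.trans (length_seg _ _ _).le
    simp [hF.reg, hF.arr, h1, h2, h3, h50, h4, h5, hxy, hyx, cntLt_seg_succ, cntLe_seg_succ]
    generalize ltWord (2 ^ w) (σ.arr 2 (s + i)) x = u1 at *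
    generalize ltWord (2 ^ w) x (σ.arr 2 (s + i)) = u2 at *
    repeat' with_reducible first | intro _ | refine And.intro ?_ ?_
    all_goals omega
  · refine ⟨Frame.refl _ _ _ _, h55, h58, ?_, ?_⟩ <;> simp [cntLt, cntLe, seg_zero, h56, h57]
  · rintro t τ ⟨ht, hF, h1, h2, h4, h5⟩
    exact ⟨ht, hF, h2, h4, h5⟩

/-- Inside the loop register 53 is only overwritten by entries of rank `r`, so it suffices that some
entry of the segment has this rank. -/
theorem bruteRank_spec {σ : Store} {s m r : ℕ} (h3 : σ.reg 3 = 2 ^ w) (h50 : σ.reg 50 = s)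
    (h51 : σ.reg 51 = m) (h52 : σ.reg 52 = r) (hr : r < m) (hA : ∀ i < m, σ.arr 2 (s + i) < 2 ^ w)
    (hB : 16 * (s + m) + 100 < B) :
    WP B procs bruteRank (fun t σ' => t ≤ m * (m * 9 + 11 + 1) + 2 ∧ Frame 53 60 [] σ σ' ∧
      IsRank (rev w) (seg (σ.arr 2) s m) r (σ'.reg 53)) σ := by
  obtain ⟨x, hx⟩ := exists_isRank (κ := rev w) (L := seg (σ.arr 2) s m) (r := r)
    (by rwa [length_seg])
  have ⟨j, hj, hjx⟩ := mem_seg.1 hx.1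
  simp only [bruteRank, wp_seq, wp_set]
  refine ⟨by simp; omega, (WP.forLoop (fun i τ => Frame 53 60 [] σ τ ∧ τ.reg 54 = i ∧
      ((∃ j < i, IsRank (rev w) (seg (σ.arr 2) s m) r (σ.arr 2 (s + j))) →
        IsRank (rev w) (seg (σ.arr 2) s m) r (τ.reg 53))) m (m * 9 + 11) ?_ ?_ ?_).mono ?_⟩
  · rintro i τ hi ⟨hF, h1, h2⟩
    simp [hF.reg, h1, h51]
  · rintro i σ₀ hi ⟨hF, h1, h2⟩
    have hy := hA i hi
    simp [hF.reg, hF.arr, h1, h50]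
    refine ⟨by omega, by omega, ?_⟩
    refine (countLoop_spec (w := w) (s := s) (m := m) (x := σ.arr 2 (s + i)) (by simp [hF.reg, h3])
      (by simp [hF.reg, h50]) (by simp [hF.reg, h51]) (by simp) (by simp) (by simp) (by simp) hy
      (by simpa [hF.arr] using hA) hB).mono ?_
    rintro t τ' ⟨ht, hF', k1, k2, k3⟩
    have hF2 : Frame 53 60 [] σ τ' := Frame.trans (by simpa using hF) hF' (by omega) le_rfl (List.Subset.refl _)
    have e1 := hF'.reg 54 (by simp)
    have e2 := hF'.reg 53 (by simp)
    simp [hF.arr, h1] at k2 k3 e1 e2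
    have hmem : σ.arr 2 (s + i) ∈ seg (σ.arr 2) s m := mem_seg.2 ⟨i, hi, rfl⟩
    simp [hF2.reg, h52, k1, k2, k3, e1, e2]
    have key : ∀ j ≤ i, IsRank (rev w) (seg (σ.arr 2) s m) r (σ.arr 2 (s + j)) →
        ¬ IsRank (rev w) (seg (σ.arr 2) s m) r (σ.arr 2 (s + i)) →
        IsRank (rev w) (seg (σ.arr 2) s m) r (σ₀.reg 53) := by
      intro j hj hjr hn
      rcases Nat.lt_or_eq_of_le hj with hj | rfl
      · exact h2 ⟨j, hj, hjr⟩
      · exact absurd hjr hn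
    have hdef : IsRank (rev w) (seg (σ.arr 2) s m) r (σ.arr 2 (s + i)) ↔ _ := and_iff_right hmem
    repeat' with_reducible first | intro _ | refine And.intro ?_ ?_
    all_goals first | omega | exact (by simp [hF2]) | skip
    all_goals first | exact hdef.2 ⟨by assumption, by assumption⟩ |
      exact key _ (by assumption) (by assumption) (by rw [hdef]; omega)
  · simp [Frame.refl]
  · rintro t τ ⟨ht, hF, h1, h2⟩
    exact ⟨by omega, hF, h2 ⟨j, hj, by rwa [hjx]⟩⟩

theorem groupLoop_spec {σ : Store} {s m q : ℕ} (h3 : σ.reg 3 = 2 ^ w) (h40 : σ.reg 40 = s)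
    (h41 : σ.reg 41 = m) (h45 : σ.reg 45 = 0) (h46 : σ.reg 46 = q) (hq : 8 * q ≤ m)
    (hA : ∀ i < m, σ.arr 2 (s + i) < 2 ^ w) (hB : 16 * (s + 2 * m) + 200 < B) :
    WP B procs groupLoop (fun t σ' => t ≤ q * 680 + 1 ∧ Frame 45 60 [2] σ σ' ∧ σ'.reg 46 = q ∧
      (∀ i < s + m, σ'.arr 2 i = σ.arr 2 i) ∧
      ∀ i < q, IsRank (rev w) (seg (σ.arr 2) (s + 8 * i) 8) 4 (σ'.arr 2 (s + m + i))) σ := by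
  refine (WP.forLoop (fun i τ => Frame 45 60 [2] σ τ ∧ τ.reg 45 = i ∧ τ.reg 46 = q ∧
      (∀ i < s + m, τ.arr 2 i = σ.arr 2 i) ∧
      ∀ j < i, IsRank (rev w) (seg (σ.arr 2) (s + 8 * j) 8) 4 (τ.arr 2 (s + m + j))) q 679
      ?_ ?_ ?_).mono ?_
  · rintro i τ hi ⟨hF, h1, h2, h4⟩
    simp [h1, h2]
  · rintro i τ hi ⟨hF, h1, h2, h4, h5⟩
    simp only [wp_seq, wp_set]
    refine ⟨by simp [hF.reg, h40, h1]; omega, by simp; omega, by simp; omega, ?_⟩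
    have hseg : seg (τ.arr 2) (s + 8 * i) 8 = seg (σ.arr 2) (s + 8 * i) 8 :=
      seg_congr fun j hj => h4 _ (by omega)
    refine (bruteRank_spec (w := w) (s := s + 8 * i) (m := 8) (r := 4) (by simp [hF.reg, h3])
      (by simp [hF.reg, h40, h1, mul_comm]) (by simp) (by simp) (by omega) (fun j hj => ?_)
      (by omega)).mono ?_
    · simp only [arr_set]
      rw [h4 _ (by omega), add_assoc]
      exact hA _ (by omega)
    · rintro t τ' ⟨ht, hF', hx⟩
      simp only [arr_set, hseg] at hx
      have hF2 : Frame 45 60 [2] σ τ' := Frame.trans (by simpa using hF) hF' (by omega) le_rfl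
        (by simp)
      have e1 := hF'.reg 45 (by simp)
      have e2 := hF'.reg 46 (by simp)
      have e3 := hF'.arr 2 (by simp)
      simp [h1, h2] at e1 e2 e3
      simp [hF2.reg, hF2, e1, e2, e3, h40, h41]
      refine ⟨by omega, by omega, by omega, by omega, fun j hj => ?_, fun j hj => ?_⟩
      · rw [Function.update_of_ne (by omega), h4 j hj]
      · rcases Nat.lt_or_eq_of_le hj with hj | rfl
        · rw [Function.update_of_ne (by omega)]
          exact h5 j hj
        · simpa using hx
  · exact ⟨Frame.refl _ _ _ _, h45, h46, fun _ _ => rfl, fun j hj => absurd hj (by omega)⟩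
  · rintro t τ ⟨ht, hF, h1, h2, h4⟩
    exact ⟨ht, hF, h2, h4⟩

/-- The comparison is abstracted to a predicate through `hef`, so that one proof serves both sides
of the pivot. -/
theorem filterLoop_spec {σ : Store} {s m p : ℕ} {e f : Expr} {pred : ℕ → Bool}
    (h40 : σ.reg 40 = s) (h41 : σ.reg 41 = m) (h43 : σ.reg 43 = p)
    (h45 : σ.reg 45 = 0) (h46 : σ.reg 46 = 0) (hA : ∀ i < m, σ.arr 2 (s + i) < 2 ^ w)
    (hef : ∀ τ : Store, τ.reg 3 = σ.reg 3 → τ.reg 43 = p → τ.reg 48 < 2 ^ w →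
      (ltE e f).Ok B τ ∧ ((ltE e f).val τ ≠ 0 ↔ pred (τ.reg 48) = true))
    (hB : 16 * (s + 2 * m) + 200 < B) :
    WP B procs (filterLoop e f) (fun t σ' => t ≤ m * 6 + 1 ∧ Frame 45 49 [2] σ σ' ∧
      (∀ i < s + m, σ'.arr 2 i = σ.arr 2 i) ∧
      σ'.reg 46 = ((seg (σ.arr 2) s m).filter pred).length ∧
      seg (σ'.arr 2) (s + m) (σ'.reg 46) = (seg (σ.arr 2) s m).filter pred) σ := by
  refine (WP.forLoop (fun i τ => Frame 45 49 [2] σ τ ∧ τ.reg 45 = i ∧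
      (∀ i < s + m, τ.arr 2 i = σ.arr 2 i) ∧
      τ.reg 46 = ((seg (σ.arr 2) s i).filter pred).length ∧
      seg (τ.arr 2) (s + m) (τ.reg 46) = (seg (σ.arr 2) s i).filter pred) m 5 ?_ ?_ ?_).mono ?_
  · rintro i τ hi ⟨hF, h1, h2⟩
    simp [hF.reg, h1, h41]
  · rintro i τ hi ⟨hF, h1, h2, h4, h5⟩
    have hle : τ.reg 46 ≤ i := by
      rw [h4]
      exact (List.length_filter_le _ _).trans (length_seg _ _ _).le
    obtain ⟨ok, hval⟩ := hef (τ.set 48 (σ.arr 2 (s + i))) (by simp [hF.reg])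
      (by simp [hF.reg, h43]) (by simpa using hA i hi)
    have hval' : (ltE e f).val (τ.set 48 (σ.arr 2 (s + i))) = 0 ↔
        pred (σ.arr 2 (s + i)) = false := by
      rw [← not_iff_not]; simpa using hval
    have e40 := (hF.reg 40 (by simp)).trans h40
    have e41 := (hF.reg 41 (by simp)).trans h41
    simp [-val_ltE, -ok_ltE, e40, e41, h1, h2 (s + i) (by omega), hF, ok, hval', seg_succ,
      List.filter_append]
    refine ⟨⟨by omega, by omega⟩, by omega, fun hc => ⟨by omega, by omega, by omega, by omega, ?_, ?_, ?_⟩,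
      fun hc => ⟨by omega, ?_, ?_, ?_⟩⟩
    · intro j hj
      rw [Function.update_of_ne (by omega), h2 j hj]
    · simp [hc, h4]
    · rw [seg_congr (g := τ.arr 2), h5]
      · simp [hc]
      · intro j hj
        rw [Function.update_of_ne (by omega)]
    · exact h2
    · simp [hc, h4]
    · simp [hc, h5]
  · exact ⟨Frame.refl _ _ _ _, h45, fun _ _ => rfl, by simp [seg_zero, h46], by simp [h46, seg_zero]⟩
  · rintro t τ ⟨ht, hF, h1, h2, h4⟩
    exact ⟨ht, hF, h2, h4⟩

end Select
end TrafficSplit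

/-! ### Correctness and linear running time of selection. -/

namespace TrafficSplit

section Select
variable {B : ℕ} {procs : List Stmt} {w : ℕ}

/-- Selection in linear time from segments of length `m`. -/
def SelectSpec (B : ℕ) (procs : List Stmt) (w m : ℕ) : Prop :=
  ∀ (σ : Store) (s r sp : ℕ), σ.reg 3 = 2 ^ w → σ.reg 40 = s → σ.reg 41 = m → σ.reg 42 = r →
    σ.reg 44 = sp → r < m → (∀ i < m, σ.arr 2 (s + i) < 2 ^ w) →
    16 * (s + 8 * m) + 16 * (sp + m) + 1000 < B →
    WP B procs selectProc (fun t σ' => t ≤ 2000 * m ∧ Frame 40 60 [2, 3] σ σ' ∧ σ'.reg 44 = sp ∧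
      IsRank (rev w) (seg (σ.arr 2) s m) r (σ'.reg 43) ∧
      (∀ i < s + m, σ'.arr 2 i = σ.arr 2 i) ∧ ∀ i < sp, σ'.arr 3 i = σ.arr 3 i) σ

/-- The pivot leaves at most `m - 2 * q` entries on either side. Besides making this a proper
reduction, `m ≤ 16 * q` is a bound on memory: the filtered segment is written behind the current
one, and `m + 8 * (m - 2 * q) ≤ 8 * m` keeps the recursive call inside the workspace of this one.
The call is the last action, so nothing is put on the stack. -/
theorem selectSide_spec (hp0 : procs[0]? = some selectProc) {σ : Store} {s m r sp p q : ℕ}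
    (ih : ∀ m' < m, SelectSpec B procs w m')
    (h3 : σ.reg 3 = 2 ^ w) (h40 : σ.reg 40 = s) (h41 : σ.reg 41 = m) (h42 : σ.reg 42 = r)
    (h43 : σ.reg 43 = p) (h44 : σ.reg 44 = sp) (hr : r < m)
    (hA : ∀ i < m, σ.arr 2 (s + i) < 2 ^ w) (hp : p ∈ seg (σ.arr 2) s m)
    (hq : m ≤ 16 * q)
    (hlt : cntLt (rev w) (seg (σ.arr 2) s m) p + 2 * q ≤ m)
    (hle : m ≤ cntLe (rev w) (seg (σ.arr 2) s m) p + (m - 2 * q))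
    (hB : 16 * (s + 8 * m) + 16 * (sp + m) + 1000 < B) :
    WP B procs selectSide (fun t σ' => t ≤ 15 * m + 30 + 2000 * (m - 2 * q) ∧
      Frame 40 60 [2, 3] σ σ' ∧ σ'.reg 44 = sp ∧
      IsRank (rev w) (seg (σ.arr 2) s m) r (σ'.reg 43) ∧
      (∀ i < s + m, σ'.arr 2 i = σ.arr 2 i) ∧ ∀ i < sp, σ'.arr 3 i = σ.arr 3 i) σ := by
  have hpw : p < 2 ^ w := by
    obtain ⟨i, hi, rfl⟩ := mem_seg.1 hp
    exact hA i hi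
  simp only [selectSide, wp_seq, wp_set]
  refine ⟨by simp, by simp, by simp, by simp; omega, by simp; omega, by simp; omega, ?_⟩
  refine (countLoop_spec (w := w) (s := s) (m := m) (x := p) (by simp [h3])
    (by simp [h40]) (by simp [h41]) (by simp [h43]) (by simp) (by simp) (by simp) hpw
    (by simpa using hA) (by omega)).mono ?_
  rintro t τ ⟨ht, hF, h58, h56, h57⟩
  simp only [arr_set] at h56 h57
  have hF2 : Frame 50 60 [] σ τ := Frame.trans (by simp [Frame.refl]) hF (by omega) le_rfl
    (by simp)
  clear hF
  have g3 := (hF2.reg 3 (by simp)).trans h3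
  have g40 := (hF2.reg 40 (by simp)).trans h40
  have g41 := (hF2.reg 41 (by simp)).trans h41
  have g42 := (hF2.reg 42 (by simp)).trans h42
  have g43 := (hF2.reg 43 (by simp)).trans h43
  have g44 := (hF2.reg 44 (by simp)).trans h44
  have gA := hF2.arr 2 (by simp)
  have gB := hF2.arr 3 (by simp)
  have hFτ : Frame 40 60 [2, 3] σ τ := ⟨fun i hi => hF2.reg i (by omega), fun j hj => hF2.arr j (by simp)⟩
  -- the recursive call on a filtered segment
  have main : ∀ (pred : ℕ → Bool) (e f : Expr) (r' : ℕ) (τ' : Store),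
      (∀ τ : Store, τ.reg 3 = 2 ^ w → τ.reg 43 = p → τ.reg 48 < 2 ^ w →
        (ltE e f).Ok B τ ∧ ((ltE e f).val τ ≠ 0 ↔ pred (τ.reg 48) = true)) →
      ((seg (σ.arr 2) s m).filter pred).length ≤ m - 2 * q →
      r' < ((seg (σ.arr 2) s m).filter pred).length →
      (∀ x, IsRank (rev w) ((seg (σ.arr 2) s m).filter pred) r' x →
        IsRank (rev w) (seg (σ.arr 2) s m) r x) →
      Frame 45 49 [2] τ τ' → (∀ i < s + m, τ'.arr 2 i = σ.arr 2 i) →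
      τ'.reg 46 = ((seg (σ.arr 2) s m).filter pred).length →
      seg (τ'.arr 2) (s + m) (τ'.reg 46) = (seg (σ.arr 2) s m).filter pred →
      WP B procs selectProc (fun t σ' => t ≤ 2000 * (m - 2 * q) ∧
        Frame 40 60 [2, 3] σ σ' ∧ σ'.reg 44 = sp ∧
        IsRank (rev w) (seg (σ.arr 2) s m) r (σ'.reg 43) ∧
        (∀ i < s + m, σ'.arr 2 i = σ.arr 2 i) ∧ ∀ i < sp, σ'.arr 3 i = σ.arr 3 i)
        (((τ'.set 42 r').set 40 (s + m)).set 41 (τ'.reg 46)) := by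
    intro pred e f r' τ' hef hlen hr' hrank hF' hA' h46 hseg
    rw [← h46] at hlen hr'
    refine (ih (τ'.reg 46) (by omega) _ (s + m) r' sp (by simp [hF'.reg, g3]) (by simp) (by simp)
      (by simp) (by simp [hF'.reg, g44]) hr' ?_ (by omega)).mono ?_
    · intro i hi
      have : τ'.arr 2 (s + m + i) ∈ (seg (σ.arr 2) s m).filter pred := by
        rw [← hseg]
        exact mem_seg.2 ⟨i, hi, rfl⟩
      obtain ⟨j, hj, hj'⟩ := mem_seg.1 (List.mem_of_mem_filter this)
      simp only [arr_set, ← hj']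
      exact hA j hj
    · rintro t' σ' ⟨k1, k2, k3, k4, k5, k6⟩
      simp only [arr_set] at k4 k5 k6
      rw [hseg] at k4
      refine ⟨by omega, ?_, k3, hrank _ k4, fun i hi => ?_, fun i hi => ?_⟩
      · have h1 : Frame 40 60 [2, 3] σ τ' := hFτ.trans hF' (by omega) (by omega) (by simp)
        exact Frame.trans (by simpa using h1) k2 le_rfl le_rfl (by simp)
      · rw [k5 i (by omega), hA' i hi]
      · rw [k6 i hi, hF'.arr 3 (by simp), gB]
  simp only [wp_ite, val_reg, holds_le, h56, g42, ok_reg, true_and, holds_lt, h57, wp_skip]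
  refine ⟨fun hc => ⟨fun hc' => ?_, fun hc' => ?_⟩, fun hc => ?_⟩
  · refine ⟨by omega, hFτ, g44, ?_, fun i _ => by rw [gA], fun i _ => by rw [gB]⟩
    rw [g43]
    exact ⟨hp, hc, hc'⟩
  · have hlen := length_filter_gt (κ := rev w) (L := seg (σ.arr 2) s m) (p := p)
    rw [length_seg] at hlen
    have hef : ∀ τ : Store, τ.reg 3 = 2 ^ w → τ.reg 43 = p → τ.reg 48 < 2 ^ w →
        (ltE (.reg 43) (.reg 48)).Ok B τ ∧ ((ltE (.reg 43) (.reg 48)).val τ ≠ 0 ↔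
          decide (rev w p < rev w (τ.reg 48)) = true) := by
      intro τ k1 k2 k3
      rw [ok_ltE, val_ltE, val_reg, val_reg, k1, k2, decide_eq_true_iff]
      exact ⟨⟨trivial, trivial, xor_le_two_pow hpw k3⟩, ltWord_ne_zero_iff hpw k3⟩
    simp only [wp_seq, wp_set]
    refine ⟨by simp; omega, by simp; omega, ?_⟩
    refine (filterLoop_spec (w := w) (s := s) (m := m) (p := p)
      (pred := fun y => decide (rev w p < rev w y)) (by simp [g40]) (by simp [g41])
      (by simp [g43]) (by simp) (by simp) (by simpa [gA] using hA)
      (fun τ₀ h => hef τ₀ (by simpa [g3] using h)) (by omega)).mono ?_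
    rintro t₂ τ' ⟨k1, k2, k3, k4, k5⟩
    simp only [arr_set, gA] at k3 k4 k5
    have e57 := (k2.reg 57 (by simp))
    have e42 := (k2.reg 42 (by simp))
    have e40 := (k2.reg 40 (by simp))
    have e41 := (k2.reg 41 (by simp))
    simp [h57, g42, g40, g41] at e57 e42 e40 e41
    simp only [val_sub, val_reg, val_add, reg_set, e42, e57, e40, e41]
    refine ⟨by simp [e42, e57]; omega, by simp [e40, e41]; omega, by simp, WP.call hp0 ?_⟩
    simp only [Nat.reduceEqDiff, if_false]
    refine (main _ _ _ (r - cntLe (rev w) (seg (σ.arr 2) s m) p) τ' hef (by omega) (by omega)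
      (fun x hx => hx.of_filter_gt (by omega)) ?_ k3 k4 k5).mono ?_
    · exact Frame.trans (by simp [Frame.refl]) k2 le_rfl le_rfl (by simp)
    · rintro t' σ' ⟨l1, l2⟩
      exact ⟨by omega, l2⟩
  · have hef : ∀ τ : Store, τ.reg 3 = 2 ^ w → τ.reg 43 = p → τ.reg 48 < 2 ^ w →
        (ltE (.reg 48) (.reg 43)).Ok B τ ∧ ((ltE (.reg 48) (.reg 43)).val τ ≠ 0 ↔
          decide (rev w (τ.reg 48) < rev w p) = true) := by
      intro τ k1 k2 k3
      rw [ok_ltE, val_ltE, val_reg, val_reg, k1, k2, decide_eq_true_iff]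
      exact ⟨⟨trivial, trivial, xor_le_two_pow k3 hpw⟩, ltWord_ne_zero_iff k3 hpw⟩
    have hlen : cntLt (rev w) (seg (σ.arr 2) s m) p = _ := List.countP_eq_length_filter
    simp only [wp_seq, wp_set]
    refine ⟨by simp; omega, by simp; omega, ?_⟩
    refine (filterLoop_spec (w := w) (s := s) (m := m) (p := p)
      (pred := fun y => decide (rev w y < rev w p)) (by simp [g40]) (by simp [g41])
      (by simp [g43]) (by simp) (by simp) (by simpa [gA] using hA)
      (fun τ₀ h => hef τ₀ (by simpa [g3] using h)) (by omega)).mono ?_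
    rintro t₂ τ' ⟨k1, k2, k3, k4, k5⟩
    simp only [arr_set, gA] at k3 k4 k5
    have e42 := (k2.reg 42 (by simp))
    have e40 := (k2.reg 40 (by simp))
    have e41 := (k2.reg 41 (by simp))
    simp [g42, g40, g41] at e42 e40 e41
    have hset : τ'.set 42 r = τ' := by
      simp [Store.set, ← e42]
    simp only [val_reg, val_add, reg_set, e40, e41]
    refine ⟨by simp [e40, e41]; omega, by simp, WP.call hp0 ?_⟩
    simp only [Nat.reduceEqDiff, if_false]
    have hmain := main _ _ _ r τ' hef (by omega) (by omega)
      (fun x hx => hx.of_filter_lt) (Frame.trans (by simp [Frame.refl]) k2 le_rfl le_rfl (by simp))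
      k3 k4 k5
    rw [hset] at hmain
    refine hmain.mono ?_
    rintro t' σ' ⟨l1, l2⟩
    exact ⟨by omega, l2⟩

/-- With `q = m / 8` the recursive calls have sizes `q` and at most `m - 2 * q`. Under the bound
`2000 * m` they leave `2000 * q` steps unused, and for `m ≥ 32` these pay for grouping, counting and
filtering. The call for the pivot needs three stack cells; cells of array 2 from `s + m` on are
scratch. -/
theorem selectProc_spec (hp0 : procs[0]? = some selectProc) (m : ℕ) : SelectSpec B procs w m := by
  induction m using Nat.strong_induction_on with
  | _ m ih =>
  intro σ s r sp h3 h40 h41 h42 h44 hr hA hB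
  rw [selectProc, wp_ite]
  refine ⟨by simp, by simp; omega, fun hc => ?_, fun hc => ?_⟩
  · replace hc : m < 32 := by simpa [h41] using hc
    simp only [wp_seq, wp_set]
    refine ⟨by simp, by simp, by simp, ?_⟩
    refine (bruteRank_spec (w := w) (s := s) (m := m) (r := r) (by simp [h3]) (by simp [h40])
      (by simp [h41]) (by simp [h42]) hr (by simpa using hA) (by omega)).mono ?_
    rintro t τ ⟨ht, hF, hx⟩
    have hF2 : Frame 40 60 [2, 3] σ τ := Frame.trans (by simp [Frame.refl]) hF (by omega) le_rfl
      (by simp)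
    have e2 := hF.arr 2 (by simp)
    have e3 := hF.arr 3 (by simp)
    have e44 := hF.reg 44 (by simp)
    simp [h44] at e2 e3 e44
    -- For fewer than 32 entries the quadratic search is within the linear bound.
    have := Nat.mul_le_mul_left m (show m * 9 + 11 + 1 ≤ 300 by omega)
    simp [hF2, e2, e3, e44]
    exact ⟨by omega, by simpa using hx⟩
  · replace hc : 32 ≤ m := by simpa [h41] using hc
    obtain ⟨q, hq⟩ : ∃ q, m / 8 = q := ⟨_, rfl⟩
    simp only [wp_seq, wp_set]
    refine ⟨by simp; omega, by simp; omega, ?_⟩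
    refine (groupLoop_spec (w := w) (s := s) (m := m) (q := q) (by simp [h3]) (by simp [h40])
      (by simp [h41]) (by simp) (by simp [h41, hq]) (by omega) (by simpa using hA) (by omega)).mono ?_
    rintro t τ ⟨ht, hF, h46, hlow, hrank⟩
    simp only [arr_set] at hlow hrank
    have hF2 : Frame 45 60 [2] σ τ := Frame.trans (by simp [Frame.refl]) hF (by omega) le_rfl
      (by simp)
    clear hF
    have g3 := (hF2.reg 3 (by simp)).trans h3
    have g40 := (hF2.reg 40 (by simp)).trans h40
    have g41 := (hF2.reg 41 (by simp)).trans h41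
    have g42 := (hF2.reg 42 (by simp)).trans h42
    have g44 := (hF2.reg 44 (by simp)).trans h44
    have gB := hF2.arr 3 (by simp)
    have hA2 : ∀ i < q, τ.arr 2 (s + m + i) < 2 ^ w := fun i hi => by
      obtain ⟨j, hj, hj'⟩ := mem_seg.1 (hrank i hi).1
      rw [← hj', add_assoc]
      exact hA _ (by omega)
    simp only [wp_put, val_reg, val_add, val_lit, g40, g44]
    refine ⟨by simp, by simp, by omega, by simp [g44]; omega, by simp, by simp [g44]; omega,
      by simp [g44]; omega, by simp, by simp [g44]; omega, by simp [g44]; omega,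
      by simp [g40, g41]; omega, by simp, by simp; omega, WP.call hp0 ?_⟩
    refine (ih q (by omega) _ (s + m) (q / 2) (sp + 3) (by simp [g3]) (by simp [g40, g41])
      (by simp [h46]) (by simp [h46]) (by simp [g44]) (by omega) (by simpa using hA2)
      (by omega)).mono ?_
    rintro t₂ τ₂ ⟨ht₂, hF, k44, hp, kA, kB⟩
    have hF3 : Frame 40 60 [2, 3] σ τ₂ := by
      have : Frame 40 60 [2, 3] σ τ := ⟨fun i hi => hF2.reg i (by omega), fun j hj => hF2.arr j (by simp at hj ⊢; exact hj.1)⟩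
      exact Frame.trans (by simpa using this) hF le_rfl le_rfl (by simp)
    clear hF
    have l3 := (hF3.reg 3 (by simp)).trans h3
    have kB0 := kB sp (by omega)
    have kB1 := kB (sp + 1) (by omega)
    have kB2 := kB (sp + 2) (by omega)
    simp [g44, g40, g41, g42] at kA kB0 kB1 kB2 hp
    refine ⟨by simp [k44]; omega, by simp [k44]; omega, by simp [k44]; omega, by simp [k44]; omega, ?_⟩
    have hpb := pivot_bounds (κ := rev w) (m := m) (q := q) (by omega) hrank hp
    have hpm : (τ₂.reg 43) ∈ seg (σ.arr 2) s m := by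
      obtain ⟨i, hi, hi'⟩ := mem_seg.1 hp.1
      obtain ⟨j, hj, hj'⟩ := mem_seg.1 (hrank i hi).1
      exact mem_seg.2 ⟨8 * i + j, by omega, by rw [← hi', ← hj', add_assoc]⟩
    have hA3 : ∀ i < s + m, τ₂.arr 2 i = σ.arr 2 i := fun i hi => by
      rw [kA i (by omega), hlow i hi]
    have hseg : seg (τ₂.arr 2) s m = seg (σ.arr 2) s m := seg_congr fun i hi => hA3 _ (by omega)
    refine (selectSide_spec (w := w) (q := q) (p := τ₂.reg 43) (s := s) (m := m) (r := r) (sp := sp)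
      hp0 ih (by simp [l3]) (by simp [k44, kB0]) (by simp [k44, kB1]) (by simp [k44, kB2])
      (by simp) (by simp [k44]) hr ?_ ?_ (by omega) ?_ ?_ hB).mono ?_
    · intro i hi
      simp only [arr_set]
      rw [hA3 _ (by omega)]
      exact hA i hi
    · simpa [hseg] using hpm
    · simpa [hseg] using hpb.1
    · simpa [hseg] using hpb.2
    · rintro t₃ σ' ⟨ht₃, m1, m2, m3, m4, m5⟩
      simp only [arr_set, hseg] at m3 m4 m5
      refine ⟨by omega, Frame.trans (by simpa using hF3) m1 le_rfl le_rfl (by simp), m2, m3,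
        fun i hi => by rw [m4 i hi, hA3 i hi], fun i hi => ?_⟩
      have := kB i (by omega)
      simp [Function.update_apply, gB, g44] at this
      rw [m5 i hi, this, if_neg (by omega), if_neg (by omega), if_neg (by omega)]

end Select
end TrafficSplit

namespace TrafficSplit
open Finset

/-! ### The largest entries of a list -/

/-- Flags in array `5` the `r₃₁` largest of the `r₃₀` entries of array `2`. -/
def choose : Stmt :=
  32 ≔ 0 ;; .loop .lt (.reg 32) (.reg 30) (.put 5 (.reg 32) 0 ;; 32 ≔ .reg 32 + 1) ;;
  .ite .eq (.reg 31) 0 .skip (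
    40 ≔ 0 ;; 41 ≔ .reg 30 ;; 42 ≔ .reg 30 - .reg 31 ;; 44 ≔ 0 ;; .call 0 ;;
    33 ≔ 0 ;; 32 ≔ 0 ;;
    .loop .lt (.reg 32) (.reg 30) (
      .ite .ne (ltE (.reg 43) (.arr 2 (.reg 32))) 0 (.put 5 (.reg 32) 1 ;; 33 ≔ .reg 33 + 1)
        .skip ;;
      32 ≔ .reg 32 + 1) ;;
    32 ≔ 0 ;;
    .loop .lt (.reg 32) (.reg 30) (
      .ite .lt (.reg 33) (.reg 31)
        (.ite .eq (ltE (.arr 2 (.reg 32)) (.reg 43)) 0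
          (.ite .eq (.arr 5 (.reg 32)) 0 (.put 5 (.reg 32) 1 ;; 33 ≔ .reg 33 + 1) .skip)
          .skip)
        .skip ;;
      32 ≔ .reg 32 + 1))

theorem sum_update_one {F : ℕ → ℕ} {i m : ℕ} (hi : i < m) (h : F i = 0) :
    ∑ j ∈ range m, Function.update F i 1 j = ∑ j ∈ range m, F j + 1 := by
  rw [Finset.sum_update_of_mem (mem_range.2 hi), add_comm,
    ← Finset.sum_sdiff (Finset.singleton_subset_iff.2 (mem_range.2 hi)), sum_singleton, h, add_zero]

theorem cntLe_add_sum (κ f : ℕ → ℕ) (m x : ℕ) :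
    cntLe κ (seg f 0 m) x + ∑ i ∈ range m, (if κ x < κ (f i) then 1 else 0) = m := by
  induction m with
  | zero => simp [cntLe, seg_zero]
  | succ m ih =>
    rw [cntLe_seg_succ, sum_range_succ, zero_add]
    split_ifs <;> omega

theorem cntLt_add_sum (κ f : ℕ → ℕ) (m x : ℕ) :
    cntLt κ (seg f 0 m) x + ∑ i ∈ range m, (if κ x ≤ κ (f i) then 1 else 0) = m := by
  induction m with
  | zero => simp [cntLt, seg_zero]
  | succ m ih =>
    rw [cntLt_seg_succ, sum_range_succ, zero_add]
    split_ifs <;> omega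

section Choose
variable {B : ℕ} {procs : List Stmt} {w : ℕ}

/-- Let `x` have rank `m - r`. Fewer than `r` entries are above `x` and at least `r` are not below
it; flagging the former and then filling up with entries tied with `x` gives a top set of size `r`.
For `r = 0` no entry of rank `m` exists, hence the separate case. -/
theorem choose_spec (hp0 : procs[0]? = some selectProc) {σ : Store} {m r : ℕ}
    (h3 : σ.reg 3 = 2 ^ w) (h30 : σ.reg 30 = m) (h31 : σ.reg 31 = r) (hr : r ≤ m)
    (hA : ∀ i < m, σ.arr 2 i < 2 ^ w) (hB : 144 * m + 1000 < B) :
    WP B procs choose (fun t σ' => t ≤ 2020 * m + 30 ∧ Frame 32 60 [2, 3, 5] σ σ' ∧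
      (∀ i < m, σ'.arr 2 i = σ.arr 2 i) ∧ (∀ i < m, σ'.arr 5 i ≤ 1) ∧
      ∑ i ∈ range m, σ'.arr 5 i = r ∧
      ∀ i < m, ∀ j < m, σ'.arr 5 i = 1 → σ'.arr 5 j = 0 →
        rev w (σ.arr 2 j) ≤ rev w (σ.arr 2 i)) σ := by
  simp only [choose, wp_seq, wp_set]
  refine ⟨by simp; omega, (WP.forLoop (fun i τ => Frame 32 60 [2, 3, 5] σ τ ∧ τ.reg 32 = i ∧
    τ.arr 2 = σ.arr 2 ∧ ∀ j < i, τ.arr 5 j = 0) m 2 ?_ ?_ ?_).mono ?_⟩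
  · rintro i τ hi ⟨hF, h1, h2⟩
    simp [hF.reg, h1, h30]
  · rintro i τ hi ⟨hF, h1, h2, h4⟩
    simp [hF, h1, h2]
    refine ⟨by omega, by omega, by omega, fun j hj => ?_⟩
    rcases Nat.lt_or_eq_of_le hj with hj | rfl
    · rw [Function.update_of_ne (by omega), h4 j hj]
    · simp
  · simp [Frame.refl]
  rintro t₁ σ₁ ⟨ht₁, hF₁, -, hA₁, hz⟩
  rw [wp_ite]
  refine ⟨by simp, by simp; omega, fun hc => ?_, fun hc => ?_⟩
  · replace hc : r = 0 := by simpa [hF₁.reg, h31] using hc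
    rw [wp_skip]
    refine ⟨by omega, hF₁, fun i _ => by rw [hA₁], fun i hi => by rw [hz i hi]; omega, ?_, ?_⟩
    · rw [hc]; exact sum_eq_zero fun i hi => hz i (mem_range.1 hi)
    · intro i hi j hj h; rw [hz i hi] at h; omega
  replace hc : r ≠ 0 := by simpa [hF₁.reg, h31] using hc
  have e3 := (hF₁.reg 3 (by simp)).trans h3
  have e30 := (hF₁.reg 30 (by simp)).trans h30
  have e31 := (hF₁.reg 31 (by simp)).trans h31
  simp only [wp_seq, wp_set]
  refine ⟨by simp; omega, by simp, by simp [e30, e31, hr], by simp; omega, WP.call hp0 ?_⟩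
  refine (selectProc_spec hp0 m (w := w) _ 0 (m - r) 0 (by simp [e3]) (by simp)
    (by simp [e30]) (by simp [e30, e31]) (by simp) (by omega) (by simpa [hA₁] using hA)
    (by omega)).mono ?_
  rintro t₂ σ₂ ⟨ht₂, hF₂, -, hx, kA, -⟩
  have f5 := hF₂.arr 5 (by simp)
  simp [hA₁] at hx kA f5
  have hF : Frame 32 60 [2, 3, 5] σ σ₂ := Frame.trans (by simpa using hF₁) hF₂ (by omega) le_rfl
    (by simp)
  clear hF₁ hF₂
  obtain ⟨x, hxx⟩ : ∃ x, σ₂.reg 43 = x := ⟨_, rfl⟩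
  rw [hxx] at hx
  have hxw : x < 2 ^ w := by
    obtain ⟨i, hi, rfl⟩ := mem_seg.1 hx.1
    simpa using hA i hi
  refine ⟨by simp; omega, by simp; omega, (WP.forLoop (fun i τ => Frame 32 60 [2, 3, 5] σ τ ∧
    τ.reg 32 = i ∧ τ.reg 43 = x ∧ τ.arr 2 = σ₂.arr 2 ∧
    τ.reg 33 = ∑ j ∈ range i, (if rev w x < rev w (σ.arr 2 j) then 1 else 0) ∧
    ∀ j < m, τ.arr 5 j = if j < i ∧ rev w x < rev w (σ.arr 2 j) then 1 else 0) m 5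
      ?_ ?_ ?_).mono ?_⟩
  · rintro i τ hi ⟨hF, h1, h2⟩
    simp [hF.reg, h1, h30]
  · rintro i τ hi ⟨hF, h1, h2, h4, h5, h6⟩
    have hy := hA i hi
    have k1 := ltWord_ne_zero_iff hxw hy
    have k2 := xor_le_two_pow hxw hy
    have hle : τ.reg 33 ≤ i := by
      rw [h5]
      refine (sum_le_card_nsmul _ _ 1 fun j _ => ?_).trans (by simp)
      split_ifs <;> omega
    have hF3 := (hF.reg 3 (by simp)).trans h3
    simp [hF, hF3, h1, h2, h4, kA i hi, k2, sum_range_succ, -sum_boole]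
    generalize ltWord (2 ^ w) x (σ.arr 2 i) = u at *
    refine ⟨by omega, by omega, fun hu => ⟨by omega, by omega, by omega, by omega, ?_, ?_⟩,
      fun hu => ⟨by omega, ?_, ?_⟩⟩
    · rw [h5, if_pos (k1.1 hu)]
    · intro j hj
      have := k1.1 hu
      rw [Function.update_apply]
      split_ifs with q1 q2 q2
      · rfl
      · exact absurd ⟨by omega, by rw [q1]; exact this⟩ q2
      · rw [h6 j hj, if_pos ⟨by omega, q2.2⟩]
      · rw [h6 j hj, if_neg (fun h => q2 ⟨by omega, h.2⟩)]
    · rw [h5, if_neg (by omega)]; rfl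
    · intro j hj
      have : ¬ rev w x < rev w (σ.arr 2 i) := by omega
      rw [h6 j hj]
      refine if_congr ⟨fun h => ⟨by omega, h.2⟩, fun h => ⟨?_, h.2⟩⟩ rfl rfl
      rcases Nat.lt_or_eq_of_le h.1 with h' | rfl
      · exact h'
      · exact absurd h.2 this
  · simp [hF, hxx, f5]
    exact hz
  rintro t₃ σ₃ ⟨ht₃, hF₃, -, h43, hA₃, hs₃, hf₃⟩
  have hgt := cntLe_add_sum (rev w) (σ.arr 2) m x
  have hge := cntLt_add_sum (rev w) (σ.arr 2) m x
  have hseg : seg (σ.arr 2) 0 m = seg (σ.arr 2) 0 m := rfl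
  obtain ⟨-, hx1, hx2⟩ := hx
  refine ⟨by simp; omega, (WP.forLoop (fun i τ => Frame 32 60 [2, 3, 5] σ τ ∧
    τ.reg 32 = i ∧ τ.reg 43 = x ∧ τ.arr 2 = σ₂.arr 2 ∧
    τ.reg 33 = ∑ j ∈ range m, τ.arr 5 j ∧ τ.reg 33 ≤ r ∧ (∀ j < m, τ.arr 5 j ≤ 1) ∧
    (∀ j < m, τ.arr 5 j = 1 → rev w x ≤ rev w (σ.arr 2 j)) ∧
    (∀ j < m, rev w x < rev w (σ.arr 2 j) → τ.arr 5 j = 1) ∧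
    (τ.reg 33 = r ∨ ∀ j < i, rev w x ≤ rev w (σ.arr 2 j) → τ.arr 5 j = 1)) m 7
      ?_ ?_ ?_).mono ?_⟩
  · rintro i τ hi ⟨hF, h1, h2⟩
    simp [hF.reg, h1, h30]
  · rintro i τ hi ⟨hF, h1, h2, h4, h5, h6, h7, h8, h9, h10⟩
    have hy := hA i hi
    have k1 := ltWord_ne_zero_iff hy hxw
    have k2 := xor_le_two_pow hy hxw
    have hF3 := (hF.reg 3 (by simp)).trans h3
    have hF31 := (hF.reg 31 (by simp)).trans h31
    have hi1 := h7 i hi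
    simp [hF, hF3, hF31, h1, h2, h4, kA i hi, k2]
    generalize ltWord (2 ^ w) (σ.arr 2 i) x = u at *
    refine ⟨fun hc1 => ⟨by omega, by omega, fun hu => ⟨by omega, by omega, fun h0 =>
      ⟨by omega, by omega, by omega, by omega, ?_, by omega, ?_, ?_, ?_, ?_⟩,
      fun h0 => ⟨by omega, h5, h6, h7, h8, h9, ?_⟩⟩, fun hu => ⟨by omega, h5, h6, h7, h8, h9, ?_⟩⟩,
      fun hc1 => ⟨by omega, h5, h6, h7, h8, h9, Or.inl (by omega)⟩⟩
    · rw [sum_update_one hi h0, h5]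
    · intro j hj
      rw [Function.update_apply]
      split_ifs
      · rfl
      · exact h7 j hj
    · intro j hj
      rw [Function.update_apply]
      split_ifs with hji
      · intro _; rw [hji]; omega
      · exact h8 j hj
    · intro j hj
      rw [Function.update_apply]
      split_ifs with hji
      · intro _; rfl
      · exact h9 j hj
    · refine Or.inr fun j hj hxj => ?_
      rw [Function.update_apply]
      split_ifs with hji
      · rfl
      · exact (h10.resolve_left (by omega)) j (by omega) hxj
    · refine Or.inr fun j hj hxj => ?_
      rcases Nat.lt_or_eq_of_le hj with hj | rfl
      · exact (h10.resolve_left (by omega)) j hj hxj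
      · omega
    · refine Or.inr fun j hj hxj => ?_
      rcases Nat.lt_or_eq_of_le hj with hj | rfl
      · exact (h10.resolve_left (by omega)) j hj hxj
      · omega
  · simp [hF₃, h43, hA₃]
    have hsum : ∑ j ∈ range m, σ₃.arr 5 j =
        ∑ j ∈ range m, (if rev w x < rev w (σ.arr 2 j) then 1 else 0) :=
      sum_congr rfl fun j hj => by rw [hf₃ j (mem_range.1 hj)]; simp [mem_range.1 hj]
    refine ⟨by rw [hs₃, hsum], by omega, fun j hj => ?_, fun j hj => ?_, fun j hj hj' => ?_⟩
    · rw [hf₃ j hj]; split_ifs <;> omega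
    · intro h01
      by_contra hcon
      rw [hf₃ j hj, if_neg fun h => hcon h.2.le] at h01
      exact zero_ne_one h01
    · rw [hf₃ j hj, if_pos ⟨hj, hj'⟩]
  rintro t₄ τ ⟨ht₄, hF, h1, h2, h4, h5, h6, h7, h8, h9, h10⟩
  refine ⟨by omega, hF, fun i hi => by rw [h4, kA i hi], h7, ?_, ?_⟩
  · rcases h10 with h | h
    · omega
    · have hsum : ∑ j ∈ range m, (if rev w x ≤ rev w (σ.arr 2 j) then 1 else 0) ≤
          ∑ j ∈ range m, τ.arr 5 j := by
        refine sum_le_sum fun j hj => ?_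
        split_ifs with hc
        · rw [h j (mem_range.1 hj) hc]
        · omega
      omega
  · intro i hi j hj hi' hj'
    refine le_trans ?_ (h8 i hi hi')
    by_contra hcon
    have := h9 j hj (by omega)
    omega

end Choose
end TrafficSplit

namespace TrafficSplit
open Finset

/-! ### Enumerated sets -/

/-- The values `I 0, …, I (c - 1)` enumerate `S` without repetition. -/
structure Enumerates (I : ℕ → ℕ) (c : ℕ) (S : Finset ℕ) : Prop where
  mem : ∀ j < c, I j ∈ S
  inj : ∀ j < c, ∀ j' < c, I j = I j' → j = j'
  card : S.card = c

namespace Enumerates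
variable {I : ℕ → ℕ} {c : ℕ} {S : Finset ℕ}

theorem empty (I : ℕ → ℕ) : Enumerates I 0 ∅ :=
  ⟨fun _ h => absurd h (Nat.not_lt_zero _), fun _ h => absurd h (Nat.not_lt_zero _), rfl⟩

theorem snoc (h : Enumerates I c S) {x : ℕ} (hx : x ∉ S) :
    Enumerates (Function.update I c x) (c + 1) (insert x S) := by
  refine ⟨fun j hj => ?_, fun j hj j' hj' hjj => ?_, by rw [card_insert_of_notMem hx, h.card]⟩
  · rw [Function.update_apply]
    split_ifs with hc
    · exact mem_insert_self _ _
    · exact mem_insert_of_mem (h.mem j (by omega))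
  · simp only [Function.update_apply] at hjj
    split_ifs at hjj with h1 h2 h2
    · omega
    · exact absurd (hjj ▸ h.mem j' (by omega)) hx
    · exact absurd (hjj ▸ h.mem j (by omega)) hx
    · exact h.inj j (by omega) j' (by omega) hjj

theorem image_eq (h : Enumerates I c S) : (range c).image I = S := by
  refine eq_of_subset_of_card_le (fun x hx => ?_) ?_
  · obtain ⟨j, hj, rfl⟩ := mem_image.1 hx
    exact h.mem j (mem_range.1 hj)
  · rw [card_image_of_injOn fun j hj j' hj' hjj => h.inj j (by simpa using hj) j' (by simpa using hj') hjj, h.card,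
      card_range]

theorem surj (h : Enumerates I c S) {x : ℕ} (hx : x ∈ S) : ∃ j < c, I j = x := by
  rw [← h.image_eq] at hx
  obtain ⟨j, hj, rfl⟩ := mem_image.1 hx
  exact ⟨j, mem_range.1 hj, rfl⟩

end Enumerates

section Round
variable {B : ℕ} {procs : List Stmt} {w : ℕ}

/-- The flags refer to positions in the candidate list. Since the list has no repetitions they
describe a set of indices of parts, the form in which the rounding and matching theorems ask for a
top set. -/
theorem choose_enumerates (hp0 : procs[0]? = some selectProc) {σ : Store} {c r : ℕ}
    {S : Finset ℕ} {key : ℕ → ℕ} (hS : Enumerates (σ.arr 4) c S)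
    (h3 : σ.reg 3 = 2 ^ w) (h30 : σ.reg 30 = c) (h31 : σ.reg 31 = r) (hr : r ≤ c)
    (hA : ∀ j < c, σ.arr 2 j = key (σ.arr 4 j)) (hkey : ∀ x ∈ S, key x < 2 ^ w)
    (hB : 144 * c + 1000 < B) :
    WP B procs choose (fun t σ' => t ≤ 2020 * c + 30 ∧ Frame 32 60 [2, 3, 5] σ σ' ∧
      ∃ U ⊆ S, U.card = r ∧ (∀ j < c, σ'.arr 5 j = 1 ↔ σ.arr 4 j ∈ U) ∧
        ∀ x ∈ U, ∀ y ∈ S, y ∉ U → rev w (key y) ≤ rev w (key x)) σ := by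
  refine (choose_spec (w := w) hp0 h3 h30 h31 hr
    (fun i hi => by rw [hA i hi]; exact hkey _ (hS.mem i hi)) hB).mono ?_
  rintro t σ' ⟨ht, hF, -, h1, hsum, htop⟩
  have hiff : ∀ j < c, σ'.arr 5 j = 1 ↔
      σ.arr 4 j ∈ ((range c).filter fun j => σ'.arr 5 j = 1).image (σ.arr 4) := fun j hj => by
    rw [mem_image]
    constructor
    · exact fun h => ⟨j, by simp [hj, h], rfl⟩
    · rintro ⟨j', hj', h⟩
      rw [mem_filter, mem_range] at hj'
      rw [← hS.inj j' hj'.1 j hj h, hj'.2]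
  refine ⟨ht, hF, _, fun x hx => ?_, ?_, hiff, ?_⟩
  · obtain ⟨j, hj, rfl⟩ := mem_image.1 hx
    exact hS.mem j (mem_range.1 (mem_filter.1 hj).1)
  · rw [card_image_of_injOn fun j hj j' hj' hjj => ?_, card_filter, ← hsum]
    · refine sum_congr rfl fun j hj => ?_
      have := h1 j (mem_range.1 hj)
      split_ifs <;> omega
    · simp only [coe_filter, mem_range, Set.mem_ofPred_eq] at hj hj'
      exact hS.inj j hj.1 j' hj'.1 hjj
  · intro x hx y hy hyU
    obtain ⟨i, hi, rfl⟩ := hS.surj hy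
    rw [mem_image] at hx
    obtain ⟨j, hj, rfl⟩ := hx
    rw [mem_filter, mem_range] at hj
    rw [← hA i hi, ← hA j hj.1]
    have := h1 i hi
    refine htop j hj.1 i hi hj.2 ?_
    rw [← hiff i hi] at hyU
    omega

/-! ### Optimal rounding -/

/-- Computes `boxLo`, `boxHi`, `boxEvenLo`, `boxEvenHi` of `r₁₄` for the error `r₄` at the level
`r₁₀`. -/
def roundBox : Stmt :=
  .ite .lt (.reg 14) (.reg 4) (15 ≔ 0)
    (15 ≔ .bin .shr (.reg 14 + .reg 11 - .reg 4) (.reg 10)) ;;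
  16 ≔ .bin .shr (.reg 14 + .reg 4 - 1) (.reg 10) ;;
  .ite .eq (.reg 15) (.reg 16) (17 ≔ .reg 15 ;; 18 ≔ .reg 15)
    (17 ≔ .reg 15 + .bin .and (.reg 15) 1 ;; 18 ≔ .reg 16 - .bin .and (.reg 16) 1)

/-- Computes the sums of the lower and upper even roundings. -/
def roundSums : Stmt :=
  21 ≔ 0 ;; 22 ≔ 0 ;; 13 ≔ 0 ;;
  .loop .lt (.reg 13) (.reg 0) (
    14 ≔ .arr 0 (.reg 13) ;; roundBox ;; 21 ≔ .reg 21 + .reg 17 ;; 22 ≔ .reg 22 + .reg 18 ;;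
    13 ≔ .reg 13 + 1)

/-- Selects the two roundings of the mode `r₂₄`. -/
def roundItem : Stmt :=
  roundBox ;;
  .ite .eq (.reg 24) 0 (19 ≔ .reg 18 ;; 20 ≔ .reg 16)
    (.ite .eq (.reg 24) 1 (19 ≔ .reg 15 ;; 20 ≔ .reg 17) (19 ≔ .reg 17 ;; 20 ≔ .reg 18))

/-- Rounds down in the mode `r₂₄` and collects the parts that can be rounded up. -/
def roundCandidates : Stmt :=
  26 ≔ 0 ;; 30 ≔ 0 ;; 13 ≔ 0 ;;
  .loop .lt (.reg 13) (.reg 0) (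
    14 ≔ .arr 0 (.reg 13) ;; roundItem ;;
    .put 1 (.reg 13) (.bin .shl (.reg 19) (.reg 10)) ;; 26 ≔ .reg 26 + .reg 19 ;;
    .ite .eq (.reg 19) (.reg 20) .skip
      (.put 2 (.reg 30) (.reg 19) ;; .put 4 (.reg 30) (.reg 13) ;; 30 ≔ .reg 30 + 1) ;;
    13 ≔ .reg 13 + 1)

/-- Rounds up the chosen candidates. -/
def roundAdd : Stmt :=
  13 ≔ 0 ;;
  .loop .lt (.reg 13) (.reg 30) (
    .ite .eq (.arr 5 (.reg 13)) 1
      (.put 1 (.arr 4 (.reg 13))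
        (.arr 1 (.arr 4 (.reg 13)) + .bin .shl (.reg 25) (.reg 10))) .skip ;;
    13 ≔ .reg 13 + 1)

theorem boxHi_le_add_two {l e p : ℕ} (hl' : e < 2 ^ (l + 1)) : boxHi l e p ≤ p / 2 ^ l + 2 := by
  rw [boxHi]
  have h0 : 0 < 2 ^ l := by positivity
  rw [pow_succ] at hl'
  calc (p + (e - 1)) / 2 ^ l ≤ (p + 2 ^ l * 2) / 2 ^ l := Nat.div_le_div_right (by omega)
    _ = p / 2 ^ l + 2 := Nat.add_mul_div_left _ _ h0

theorem roundBox_spec {σ : Store} {l e p : ℕ} (h4 : σ.reg 4 = e) (h10 : σ.reg 10 = l)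
    (h11 : σ.reg 11 = 2 ^ l) (h14 : σ.reg 14 = p) (hl : 2 ^ l ≤ e) (hB : 2 * p + 2 * e + 10 < B) :
    WP B procs roundBox (fun t σ' => t ≤ 7 ∧ Frame 15 19 [] σ σ' ∧ σ'.reg 15 = boxLo l e p ∧
      σ'.reg 16 = boxHi l e p ∧ σ'.reg 17 = boxEvenLo l e p ∧ σ'.reg 18 = boxEvenHi l e p) σ := by
  have h2l : 0 < 2 ^ l := by positivity
  have e1 : (p + e - 1) / 2 ^ l = boxHi l e p := by
    rw [boxHi]; congr 1; omega
  -- The branch on `p < e` avoids a negative difference: there the truncated lower end `p - (e - 1)`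
  -- is `0`, and so is its rounding.
  have e2 : p < e → boxLo l e p = 0 := fun h => by
    rw [boxLo]; exact Nat.div_eq_of_lt (by omega)
  have e3 : ¬ p < e → (p + 2 ^ l - e) / 2 ^ l = boxLo l e p := fun h => by
    rw [boxLo]; congr 1; omega
  have hlo : boxLo l e p ≤ p := (boxLo_le_div hl).trans (Nat.div_le_self _ _)
  have hmod := Nat.mod_le (boxHi l e p) 2
  simp only [roundBox, wp_seq, wp_ite, wp_set, val_reg, holds_lt, h14, h4, ok_reg, true_and]
  refine ⟨fun hc => ?_, fun hc => ?_⟩ <;>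
  · simp [h14, h4, h10, h11, e1, e2, e3, hc, Frame.refl, Nat.and_one_is_mod, boxEvenLo, boxEvenHi]
    repeat' with_reducible first | intro _ | refine And.intro ?_ ?_
    all_goals first | omega

theorem roundItem_spec {σ : Store} {l e p : ℕ} {lo hi : ℕ → ℕ} (h4 : σ.reg 4 = e)
    (h10 : σ.reg 10 = l) (h11 : σ.reg 11 = 2 ^ l) (h14 : σ.reg 14 = p) (hl : 2 ^ l ≤ e)
    (hmode : (σ.reg 24 = 0 ∧ lo = boxEvenHi l e ∧ hi = boxHi l e) ∨
      (σ.reg 24 = 1 ∧ lo = boxLo l e ∧ hi = boxEvenLo l e) ∨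
      (σ.reg 24 = 2 ∧ lo = boxEvenLo l e ∧ hi = boxEvenHi l e)) (hB : 2 * p + 2 * e + 10 < B) :
    WP B procs roundItem (fun t σ' => t ≤ 11 ∧ Frame 15 21 [] σ σ' ∧ σ'.reg 19 = lo p ∧
      σ'.reg 20 = hi p) σ := by
  rw [roundItem, wp_seq]
  refine (roundBox_spec h4 h10 h11 h14 hl hB).mono ?_
  rintro t τ ⟨ht, hF, h1, h2, h5, h6⟩
  have hF' : Frame 15 21 [] σ τ := ⟨fun r hr => hF.reg r (by omega), hF.arr⟩
  rcases hmode with ⟨h, rfl, rfl⟩ | ⟨h, rfl, rfl⟩ | ⟨h, rfl, rfl⟩ <;>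
  · simp [hF'.reg, hF', h, h1, h2, h5, h6]
    omega

/-- Each rounded value exceeds its part by at most 2, so the partial sums computed by the program
stay below the word size. -/
theorem sum_range_le_of_le {k i : ℕ} {f p : ℕ → ℕ} (hi : i ≤ k) (hf : ∀ x, f x ≤ x + 2) :
    ∑ x ∈ range i, f (p x) ≤ ∑ x ∈ range k, p x + 2 * k := by
  calc ∑ x ∈ range i, f (p x) ≤ ∑ x ∈ range k, f (p x) :=
        sum_le_sum_of_subset (range_subset_range.2 hi)
    _ ≤ ∑ x ∈ range k, (p x + 2) := sum_le_sum fun x _ => hf _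
    _ = _ := by simp [sum_add_distrib, mul_comm]

theorem roundSums_spec {σ : Store} {k l e N : ℕ} (h0 : σ.reg 0 = k) (h4 : σ.reg 4 = e)
    (h10 : σ.reg 10 = l) (h11 : σ.reg 11 = 2 ^ l) (hl : 2 ^ l ≤ e) (hl' : e < 2 ^ (l + 1))
    (he : e ≤ N) (hN : ∑ x ∈ range k, σ.arr 0 x = N) (hB : 10 * N + 16 * k + 100 < B) :
    WP B procs roundSums (fun t σ' => t ≤ 12 * k + 4 ∧ Frame 13 23 [] σ σ' ∧
      σ'.reg 21 = ∑ x ∈ range k, boxEvenLo l e (σ.arr 0 x) ∧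
      σ'.reg 22 = ∑ x ∈ range k, boxEvenHi l e (σ.arr 0 x)) σ := by
  have hhi : ∀ p, boxEvenHi l e p ≤ p + 2 := fun p => by
    have h1 := boxEven_bounds (p := p) hl
    have h2 := boxHi_le_add_two (p := p) hl'
    have h3 := Nat.div_le_self p (2 ^ l)
    omega
  have hlo : ∀ p, boxEvenLo l e p ≤ p + 2 := fun p => by
    have h1 := boxEven_bounds (p := p) hl
    have h2 := hhi p
    omega
  simp only [roundSums, wp_seq, wp_set]
  refine ⟨by simp; omega, by simp; omega, by simp; omega,
    (WP.forLoop (fun i τ => Frame 13 23 [] σ τ ∧ τ.reg 13 = i ∧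
      τ.reg 21 = ∑ x ∈ range i, boxEvenLo l e (σ.arr 0 x) ∧
      τ.reg 22 = ∑ x ∈ range i, boxEvenHi l e (σ.arr 0 x)) k 11 ?_ ?_ ?_).mono ?_⟩
  · rintro i τ hi ⟨hF, h1, h2⟩
    simp [hF.reg, h1, h0]
  · rintro i τ hi ⟨hF, h1, h2, h5⟩
    have hp : σ.arr 0 i ≤ N := by
      rw [← hN]
      exact single_le_sum (f := σ.arr 0) (fun _ _ => Nat.zero_le _) (mem_range.2 hi)
    rw [wp_seq, wp_set]
    refine ⟨by simp [h1]; omega, ?_⟩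
    rw [wp_seq]
    refine (roundBox_spec (l := l) (e := e) (p := σ.arr 0 i) (by simp [hF.reg, h4])
      (by simp [hF.reg, h10]) (by simp [hF.reg, h11]) (by simp [hF.arr, h1]) hl (by omega)).mono ?_
    rintro t τ' ⟨ht, hF', -, -, h6, h7⟩
    have hF2 : Frame 13 23 [] σ τ' := Frame.trans (by simpa using hF) hF' (by omega) (by omega)
      (by simp)
    have e13 := hF'.reg 13 (by simp)
    have e21 := hF'.reg 21 (by simp)
    have e22 := hF'.reg 22 (by simp)
    have b1 := sum_range_le_of_le (f := boxEvenLo l e) (p := σ.arr 0) (show i + 1 ≤ k by omega) hlo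
    have b2 := sum_range_le_of_le (f := boxEvenHi l e) (p := σ.arr 0) (show i + 1 ≤ k by omega) hhi
    rw [sum_range_succ, hN] at b1 b2
    simp [h1, h2, h5] at e13 e21 e22
    simp [hF2, e13, e21, e22, h6, h7, sum_range_succ]
    omega
  · simp [Frame.refl]
  · rintro t τ ⟨ht, hF, -, h1, h2⟩
    exact ⟨by omega, hF, h1, h2⟩

theorem roundCandidates_spec {σ : Store} {k l e N : ℕ} {lo hi : ℕ → ℕ} (h0 : σ.reg 0 = k)
    (h4 : σ.reg 4 = e) (h10 : σ.reg 10 = l) (h11 : σ.reg 11 = 2 ^ l) (hl : 2 ^ l ≤ e)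
    (hl' : e < 2 ^ (l + 1)) (he : e ≤ N) (hN : ∑ x ∈ range k, σ.arr 0 x = N)
    (hmode : (σ.reg 24 = 0 ∧ lo = boxEvenHi l e ∧ hi = boxHi l e) ∨
      (σ.reg 24 = 1 ∧ lo = boxLo l e ∧ hi = boxEvenLo l e) ∨
      (σ.reg 24 = 2 ∧ lo = boxEvenLo l e ∧ hi = boxEvenHi l e))
    (hlo : ∀ p, lo p ≤ boxHi l e p) (hB : 10 * N + 16 * k + 100 < B) :
    WP B procs roundCandidates (fun t σ' => t ≤ 22 * k + 4 ∧ Frame 13 31 [1, 2, 4] σ σ' ∧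
      σ'.reg 23 = σ.reg 23 ∧ σ'.reg 25 = σ.reg 25 ∧
      σ'.reg 26 = ∑ x ∈ range k, lo (σ.arr 0 x) ∧
      Enumerates (σ'.arr 4) (σ'.reg 30)
        ((range k).filter fun x => lo (σ.arr 0 x) ≠ hi (σ.arr 0 x)) ∧
      (∀ j < σ'.reg 30, σ'.arr 2 j = lo (σ.arr 0 (σ'.arr 4 j))) ∧
      ∀ x < k, σ'.arr 1 x = lo (σ.arr 0 x) * 2 ^ l) σ := by
  have hlo2 : ∀ p, lo p ≤ p + 2 := fun p => by
    have h2 := boxHi_le_add_two (p := p) hl'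
    have h3 := Nat.div_le_self p (2 ^ l)
    have := hlo p
    omega
  have hloM : ∀ p, lo p * 2 ^ l ≤ p + e := fun p => by
    have h1 := Nat.mul_le_mul_right (2 ^ l) (hlo p)
    have h2 := Nat.div_mul_le_self (p + (e - 1)) (2 ^ l)
    rw [boxHi] at h1
    omega
  simp only [roundCandidates, wp_seq, wp_set]
  refine ⟨by simp; omega, by simp; omega, by simp; omega,
    (WP.forLoop (fun i τ => Frame 13 31 [1, 2, 4] σ τ ∧ τ.reg 13 = i ∧
      τ.reg 23 = σ.reg 23 ∧ τ.reg 24 = σ.reg 24 ∧ τ.reg 25 = σ.reg 25 ∧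
      τ.reg 26 = ∑ x ∈ range i, lo (σ.arr 0 x) ∧
      Enumerates (τ.arr 4) (τ.reg 30)
        ((range i).filter fun x => lo (σ.arr 0 x) ≠ hi (σ.arr 0 x)) ∧
      (∀ j < τ.reg 30, τ.arr 2 j = lo (σ.arr 0 (τ.arr 4 j))) ∧
      ∀ x < i, τ.arr 1 x = lo (σ.arr 0 x) * 2 ^ l) k 21 ?_ ?_ ?_).mono ?_⟩
  · rintro i τ hi ⟨hF, h1, h2⟩
    simp [hF.reg, h1, h0]
  · rintro i τ hi' ⟨hF, h1, h23, h24, h25, h26, hE, hA, hY⟩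
    have hp : σ.arr 0 i ≤ N := by
      rw [← hN]
      exact single_le_sum (f := σ.arr 0) (fun _ _ => Nat.zero_le _) (mem_range.2 hi')
    rw [wp_seq, wp_set]
    refine ⟨by simp [h1]; omega, ?_⟩
    rw [wp_seq]
    refine (roundItem_spec (l := l) (e := e) (p := σ.arr 0 i) (lo := lo) (hi := hi)
      (by simp [hF.reg, h4]) (by simp [hF.reg, h10]) (by simp [hF.reg, h11])
      (by simp [hF.arr, h1]) hl (by simpa [h24] using hmode) (by omega)).mono ?_
    rintro t τ' ⟨ht, hF', h19, h20⟩
    have hF2 : Frame 13 31 [1, 2, 4] σ τ' := Frame.trans (by simpa using hF) hF' (by omega)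
      (by omega) (by simp)
    have e13 := hF'.reg 13 (by simp)
    have e23 := hF'.reg 23 (by simp)
    have e24 := hF'.reg 24 (by simp)
    have e25 := hF'.reg 25 (by simp)
    have e26 := hF'.reg 26 (by simp)
    have e30 := hF'.reg 30 (by simp)
    have a1 := hF'.arr 1 (by simp)
    have a2 := hF'.arr 2 (by simp)
    have a4 := hF'.arr 4 (by simp)
    simp [h1, h23, h24, h25, h26] at e13 e23 e24 e25 e26 e30 a1 a2 a4
    have b1 := sum_range_le_of_le (f := lo) (p := σ.arr 0) (show i + 1 ≤ k by omega) hlo2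
    rw [sum_range_succ, hN] at b1
    have hc : τ.reg 30 ≤ i := by
      rw [← hE.card]
      exact (card_filter_le _ _).trans (card_range i).le
    have hM := hloM (σ.arr 0 i)
    have hni : i ∉ (range i).filter fun x => lo (σ.arr 0 x) ≠ hi (σ.arr 0 x) := by simp
    have hYi : ∀ x ≤ i, Function.update (τ.arr 1) i (lo (σ.arr 0 i) * 2 ^ l) x =
        lo (σ.arr 0 x) * 2 ^ l := fun x hx => by
      rw [Function.update_apply]
      split_ifs with h
      · rw [h]
      · exact hY x (by omega)
    have hAi : ∀ j ≤ τ.reg 30, Function.update (τ.arr 2) (τ.reg 30) (lo (σ.arr 0 i)) j =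
        lo (σ.arr 0 (Function.update (τ.arr 4) (τ.reg 30) i j)) := fun j hj => by
      simp only [Function.update_apply]
      split_ifs with h
      · rfl
      · exact hA j (by omega)
    have hEi := hE.snoc hni
    simp [-ne_eq, hF2.reg, hF2, e13, e23, e24, e25, e26, e30, a1, a2, a4, h19, h20, h10,
      range_add_one, filter_insert]
    refine ⟨by omega, by omega, by omega, fun hq => ?_, fun hq => ?_⟩
    · rw [if_pos hq]
      exact ⟨by omega, by omega, by omega, hE, hA, hYi⟩
    · rw [if_neg hq]
      exact ⟨by omega, by omega, by omega, by omega, by omega, hEi, hAi, hYi⟩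
  · simp [Frame.refl, Enumerates.empty]
  · rintro t τ ⟨ht, hF, -, h23, -, h25, h26, hE, hA, hY⟩
    exact ⟨by omega, hF, h23, h25, h26, hE, hA, hY⟩

theorem roundAdd_spec {σ : Store} {k c l inc N : ℕ} {S U : Finset ℕ} {Z : ℕ → ℕ}
    (hE : Enumerates (σ.arr 4) c S) (hS : ∀ x ∈ S, x < k) (hU : U ⊆ S)
    (h30 : σ.reg 30 = c) (h10 : σ.reg 10 = l) (h25 : σ.reg 25 = inc)
    (hFl : ∀ j < c, σ.arr 5 j = 1 ↔ σ.arr 4 j ∈ U) (hY : ∀ x < k, σ.arr 1 x = Z x)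
    (hZ : ∀ x < k, Z x ≤ N) (hinc : inc * 2 ^ l ≤ N) (hB : 2 * N + 16 * k + 100 < B) :
    WP B procs roundAdd (fun t σ' => t ≤ 5 * c + 2 ∧ Frame 13 14 [1] σ σ' ∧
      ∀ x < k, σ'.arr 1 x = Z x + if x ∈ U then inc * 2 ^ l else 0) σ := by
  have hck : c ≤ k := by
    rw [← hE.card, ← card_range k]
    exact card_le_card fun x hx => mem_range.2 (hS x hx)
  simp only [roundAdd, wp_seq, wp_set]
  refine ⟨by simp; omega, (WP.forLoop (fun i τ => Frame 13 14 [1] σ τ ∧ τ.reg 13 = i ∧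
      ∀ x < k, τ.arr 1 x = Z x + if ∃ j < i, σ.arr 4 j = x ∧ x ∈ U then inc * 2 ^ l else 0) c 4
      ?_ ?_ ?_).mono ?_⟩
  · rintro i τ hi ⟨hF, h1, h2⟩
    simp [hF.reg, h1, h30]
  · rintro i τ hi ⟨hF, h1, h2⟩
    have hx := hS _ (hE.mem i hi)
    -- As the list has no repetitions, this part has not been raised before.
    have hold : τ.arr 1 (σ.arr 4 i) = Z (σ.arr 4 i) := by
      rw [h2 _ hx, if_neg, add_zero]
      rintro ⟨j, hj, hj', -⟩
      exact absurd (hE.inj j (by omega) i hi hj') (by omega)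
    have hZi := hZ _ hx
    simp [hF.reg, hF.arr, h1, hF, hFl i hi, h10, h25, hold]
    refine ⟨by omega, by omega, fun hU' => ⟨by omega, by omega, by omega, by omega, fun x hxk => ?_⟩,
      fun hU' => ⟨by omega, fun x hxk => ?_⟩⟩
    · rw [Function.update_apply]
      split_ifs with q1 q2 q2
      · rw [q1]
      · exact absurd ⟨i, le_rfl, q1.symm, q1 ▸ hU'⟩ q2
      · obtain ⟨j, hj, hj', hj''⟩ := q2
        rw [h2 x hxk, if_pos ⟨j, lt_of_le_of_ne hj fun h => q1 (by rw [← hj', h]), hj', hj''⟩]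
      · rw [h2 x hxk, if_neg fun ⟨j, hj, hj'⟩ => q2 ⟨j, by omega, hj'⟩]
    · rw [h2 x hxk]
      congr 1
      refine if_congr ⟨fun ⟨j, hj, hj'⟩ => ⟨j, by omega, hj'⟩, fun ⟨j, hj, hj', hj''⟩ =>
        ⟨j, lt_of_le_of_ne hj fun h => hU' (by rw [← h, hj']; exact hj''), hj', hj''⟩⟩ rfl rfl
  · simpa [Frame.refl] using hY
  · rintro t τ ⟨ht, hF, -, h⟩
    refine ⟨by omega, hF, fun x hx => ?_⟩
    rw [h x hx]
    congr 1
    refine if_congr ⟨fun ⟨j, _, hj'⟩ => hj'.2, fun hxU => ?_⟩ rfl rfl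
    obtain ⟨j, hj, hj'⟩ := hE.surj (hU hxU)
    exact ⟨j, hj, hj', hxU⟩

end Round
end TrafficSplit

/-! ### The complete rounding procedure. -/

namespace TrafficSplit
open Finset

/-- Moves everything to one nonzero part. -/
def roundSingle : Stmt :=
  13 ≔ 0 ;; 14 ≔ 0 ;;
  .loop .lt (.reg 13) (.reg 0) (
    .put 1 (.reg 13) 0 ;; .ite .eq (.arr 0 (.reg 13)) 0 .skip (14 ≔ .reg 13) ;;
    13 ≔ .reg 13 + 1) ;;
  .put 1 (.reg 14) (.bin .shr (.reg 3) 3)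

/-- Writes an optimal partition at distance less than `r₄` from array `0` to array `1`. -/
def round : Stmt :=
  .ite .le (.bin .shr (.reg 3) 3) (.reg 4) roundSingle
   (10 ≔ .log2 (.reg 4) ;; 11 ≔ .bin .shl 1 (.reg 10) ;;
    23 ≔ .bin .shr (.bin .shr (.reg 3) 3) (.reg 10) ;;
    roundSums ;;
    .ite .le (.reg 22) (.reg 23) (24 ≔ 0 ;; 25 ≔ 1)
      (.ite .le (.reg 23) (.reg 21) (24 ≔ 1 ;; 25 ≔ 1) (24 ≔ 2 ;; 25 ≔ 2)) ;;
    roundCandidates ;;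
    31 ≔ .bin .shr (.reg 23 - .reg 26) (.reg 25 - 1) ;; choose ;; roundAdd)

section Round
variable {B : ℕ} {procs : List Stmt}

theorem card_filter_val_mem {k : ℕ} {U : Finset ℕ} (hU : ∀ x ∈ U, x < k) :
    (univ.filter fun i : Fin k => (i : ℕ) ∈ U).card = U.card := by
  rw [← card_map Fin.valEmbedding]
  congr 1
  ext x
  simp only [mem_map, mem_filter, mem_univ, true_and, Fin.valEmbedding_apply]
  constructor
  · rintro ⟨i, hi, rfl⟩; exact hi
  · exact fun hx => ⟨⟨x, hU x hx⟩, hx, rfl⟩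

theorem roundSingle_spec {σ : Store} {k W : ℕ} (h0 : σ.reg 0 = k) (h3 : σ.reg 3 = 2 ^ (W + 3))
    (hP : ∃ x < k, σ.arr 0 x ≠ 0) (hB : 16 * k + 100 < B) :
    WP B procs roundSingle (fun t σ' => t ≤ 5 * k + 4 ∧ Frame 13 15 [1] σ σ' ∧
      ∃ j < k, σ.arr 0 j ≠ 0 ∧ ∀ x < k, σ'.arr 1 x = if x = j then 2 ^ W else 0) σ := by
  have hM : 2 ^ (W + 3) / 8 = 2 ^ W := by rw [pow_add]; exact Nat.mul_div_cancel _ (by norm_num)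
  obtain ⟨y, hy, hy'⟩ := hP
  simp only [roundSingle, wp_seq, wp_set]
  refine ⟨by simp; omega, by simp; omega, (WP.forLoop (fun i τ => Frame 13 15 [1] σ τ ∧
      τ.reg 13 = i ∧ ((∃ x < i, σ.arr 0 x ≠ 0) → τ.reg 14 < k ∧ σ.arr 0 (τ.reg 14) ≠ 0) ∧
      ∀ x < i, τ.arr 1 x = 0) k 4 ?_ ?_ ?_).mono ?_⟩
  · rintro i τ hi ⟨hF, h1, h2⟩
    simp [hF.reg, h1, h0]
  · rintro i τ hi ⟨hF, h1, h2, h4⟩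
    have hY : ∀ x ≤ i, Function.update (τ.arr 1) i 0 x = 0 := fun x hx => by
      rw [Function.update_apply]
      split_ifs with h
      · rfl
      · exact h4 x (by omega)
    simp only [wp_seq, wp_put, wp_ite, wp_set, wp_skip]
    simp [hF.arr, h1, hF]
    refine ⟨by omega, by omega, by omega, fun hc => ⟨by omega, fun x hx hx' => ?_, hY⟩,
      fun hc => ⟨by omega, fun x hx hx' => ⟨hi, hc⟩, hY⟩⟩
    exact h2 ⟨x, lt_of_le_of_ne hx fun h => hx' (h ▸ hc), hx'⟩
  · simp [Frame.refl]
  · rintro t τ ⟨ht, hF, -, h1, h2⟩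
    obtain ⟨h14, h14'⟩ := h1 ⟨y, hy, hy'⟩
    simp [hF, hF.reg, h3, hM]
    refine ⟨by omega, by omega, by omega, _, h14, h14', fun x hx => ?_⟩
    rw [Function.update_apply]
    split_ifs
    · rfl
    · exact h2 x hx

/-- The level is the highest set bit of `e`, so that `2 ^ l ≤ e < 2 ^ (l + 1)`. Tolerances from `2 ^
W` on are treated first, which leaves `l < W`. Three scans and one selection make up the linear
time. -/
theorem round_spec (hp0 : procs[0]? = some selectProc) {σ : Store} {k W e : ℕ} (h0 : σ.reg 0 = k)
    (h3 : σ.reg 3 = 2 ^ (W + 3)) (h4 : σ.reg 4 = e) (he : 0 < e)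
    (hP : IsPartition W fun i : Fin k => σ.arr 0 i) (hB : 1000 * (2 ^ W + k) ≤ B) :
    WP B procs round (fun t σ' => t ≤ 2200 * k ∧ Frame 10 60 [1, 2, 3, 4, 5] σ σ' ∧
      IsOptimalRounding W (fun i : Fin k => σ.arr 0 i) e fun i : Fin k => σ'.arr 1 i) σ := by
  have hM : 2 ^ (W + 3) / 8 = 2 ^ W := by rw [pow_add]; exact Nat.mul_div_cancel _ (by norm_num)
  have h2W : 0 < 2 ^ W := by positivity
  have hk := hP.pos
  have hN : ∑ x ∈ range k, σ.arr 0 x = 2 ^ W := by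
    rw [← Fin.sum_univ_eq_sum_range (fun x => σ.arr 0 x) k]; exact hP
  have hpW : ∀ x < k, σ.arr 0 x ≤ 2 ^ W := fun x hx => by
    rw [← hN]
    exact single_le_sum (f := σ.arr 0) (fun _ _ => Nat.zero_le _) (mem_range.2 hx)
  rw [round, wp_ite]
  refine ⟨by simp; omega, by simp, fun hc => ?_, fun hc => ?_⟩
  · replace hc : 2 ^ W ≤ e := by simpa [h3, h4, hM] using hc
    refine (roundSingle_spec (k := k) (W := W) h0 h3 ?_ (by omega)).mono ?_
    · by_contra! hcon
      have : ∑ x ∈ range k, σ.arr 0 x = 0 := sum_eq_zero fun x hx => hcon x (mem_range.1 hx)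
      omega
    · rintro t τ ⟨ht, hF, j, hj, hj', hY⟩
      refine ⟨by omega, ⟨fun r hr => hF.reg r (by omega),
        fun i hi => hF.arr i (by simp at hi ⊢; exact hi.1)⟩, ?_⟩
      refine isOptimalRounding_single hP hc (j := ⟨j, hj⟩) hj' fun i => ?_
      rw [hY i i.2]
      simp [Fin.ext_iff]
  · replace hc : e < 2 ^ W := by simpa [h3, h4, hM] using hc
    obtain ⟨l, hl⟩ : ∃ l, Nat.log2 e = l := ⟨_, rfl⟩
    have hle : 2 ^ l ≤ e := by rw [← hl]; exact Nat.log2_self_le (by omega)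
    have hlt : e < 2 ^ (l + 1) := by rw [← hl]; exact Nat.lt_log2_self
    have hlW : l < W := (Nat.pow_lt_pow_iff_right (by norm_num : 1 < 2)).1 (hle.trans_lt hc)
    have hdiv : 2 ^ W / 2 ^ l = 2 ^ (W - l) := Nat.pow_div hlW.le (by norm_num)
    simp only [wp_seq, wp_set]
    refine ⟨by simp, ?_, by simp; omega, ?_⟩
    · simp [h4, hl]; omega
    refine (roundSums_spec (k := k) (l := l) (e := e) (N := 2 ^ W) (by simp [h0]) (by simp [h4])
      (by simp [h4, hl]) (by simp [h4, hl]) hle hlt hc.le (by simpa using hN) (by omega)).mono ?_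
    rintro t₁ τ₁ ⟨ht₁, hF₁, h21, h22⟩
    simp only [arr_set] at h21 h22
    have e23 := hF₁.reg 23 (by simp)
    have e10 := hF₁.reg 10 (by simp)
    have e11 := hF₁.reg 11 (by simp)
    simp [h4, hl, h3, hM, hdiv] at e23 e10 e11
    have hF : Frame 10 60 [1, 2, 3, 4, 5] σ τ₁ :=
      Frame.trans (by simp [Frame.refl]) hF₁ (by omega) (by omega) (by simp)
    clear hF₁
    have hmode : ∃ lo hi inc, RoundMode W (fun i : Fin k => σ.arr 0 i) l e lo hi inc ∧
        WP B procs (.ite .le (.reg 22) (.reg 23) (24 ≔ 0 ;; 25 ≔ 1)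
          (.ite .le (.reg 23) (.reg 21) (24 ≔ 1 ;; 25 ≔ 1) (24 ≔ 2 ;; 25 ≔ 2)))
          (fun t τ => t ≤ 4 ∧ Frame 24 26 [] τ₁ τ ∧ τ.reg 25 = inc ∧
            ((τ.reg 24 = 0 ∧ lo = boxEvenHi l e ∧ hi = boxHi l e) ∨
            (τ.reg 24 = 1 ∧ lo = boxLo l e ∧ hi = boxEvenLo l e) ∨
            (τ.reg 24 = 2 ∧ lo = boxEvenLo l e ∧ hi = boxEvenHi l e))) τ₁ := by
      rw [← Fin.sum_univ_eq_sum_range (fun x => boxEvenHi l e (σ.arr 0 x)) k] at h22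
      rw [← Fin.sum_univ_eq_sum_range (fun x => boxEvenLo l e (σ.arr 0 x)) k] at h21
      by_cases c1 : τ₁.reg 22 ≤ τ₁.reg 23
      · refine ⟨boxEvenHi l e, boxHi l e, 1, Or.inl ⟨rfl, rfl, rfl, by beta_reduce; omega⟩, ?_⟩
        simp [c1, Frame.refl]; omega
      · by_cases c2 : τ₁.reg 23 ≤ τ₁.reg 21
        · refine ⟨boxLo l e, boxEvenLo l e, 1, Or.inr (Or.inl ⟨rfl, rfl, rfl, by beta_reduce; omega⟩), ?_⟩
          simp [c1, c2, Frame.refl]; omega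
        · refine ⟨boxEvenLo l e, boxEvenHi l e, 2,
            Or.inr (Or.inr ⟨rfl, rfl, rfl, by beta_reduce; omega, by beta_reduce; omega⟩), ?_⟩
          simp [c1, c2, Frame.refl]; omega
    obtain ⟨lo, hi, inc, hR, hwp⟩ := hmode
    have hb := hR.hi_eq hle hlt
    obtain ⟨r, hr, hsum⟩ := hR.exists_count hP hle hlt hlW
    have hinc : inc = 1 ∨ inc = 2 := by
      rcases hR with ⟨-, -, h, -⟩ | ⟨-, -, h, -⟩ | ⟨-, -, h, -⟩ <;> simp [h]
    have hlo : ∀ p, lo p ≤ boxHi l e p := fun p => by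
      have := hb p
      omega
    have hloM : ∀ p, lo p * 2 ^ l ≤ p + e := fun p => by
      have h1 := Nat.mul_le_mul_right (2 ^ l) (hlo p)
      have h2 := Nat.div_mul_le_self (p + (e - 1)) (2 ^ l)
      rw [boxHi] at h1
      omega
    refine hwp.mono ?_
    rintro t₂ τ₂ ⟨ht₂, hF₂, h25, hm⟩
    have f23 := hF₂.reg 23 (by simp)
    have f10 := hF₂.reg 10 (by simp)
    have f11 := hF₂.reg 11 (by simp)
    replace hF : Frame 10 60 [1, 2, 3, 4, 5] σ τ₂ :=
      hF.trans hF₂ (by omega) (by omega) (by simp)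
    clear hF₂
    refine (roundCandidates_spec (k := k) (l := l) (e := e) (N := 2 ^ W) (lo := lo) (hi := hi)
      (by simp [hF.reg, h0]) (by simp [hF.reg, h4]) (by omega) (by omega) hle hlt hc.le
      (by rw [hF.arr 0 (by simp)]; exact hN) hm hlo (by omega)).mono ?_
    rintro t₃ τ₃ ⟨ht₃, hF₃, g23, g25, g26, hE, hA, hY⟩
    have g10 := hF₃.reg 10 (by simp)
    replace hF : Frame 10 60 [1, 2, 3, 4, 5] σ τ₃ :=
      hF.trans hF₃ (by omega) (by omega) (by simp)
    have hp2 : τ₂.arr 0 = σ.arr 0 := by rw [← hF₃.arr 0 (by simp), hF.arr 0 (by simp)]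
    clear hF₃
    rw [hp2] at g26 hE hA hY
    have hck : τ₃.reg 30 ≤ k := by
      rw [← hE.card]
      exact (card_filter_le _ _).trans (card_range k).le
    have hcard : (univ.filter fun i : Fin k => lo (σ.arr 0 i) ≠ hi (σ.arr 0 i)).card =
        τ₃.reg 30 := by
      rw [← hE.card, ← card_filter_val_mem (k := k) fun x hx => mem_range.1 (mem_filter.1 hx).1]
      congr 1
      ext i
      simp
    rw [hcard] at hr
    rw [Fin.sum_univ_eq_sum_range (fun x => lo (σ.arr 0 x)) k] at hsum
    -- The increment is 1 or 2, so shifting by the increment minus one divides by the increment.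
    have h31 : (τ₃.reg 23 - τ₃.reg 26) / 2 ^ (τ₃.reg 25 - 1) = r := by
      rw [g23, f23, e23, g26, ← hsum, Nat.add_sub_cancel_left, g25, h25]
      rcases hinc with rfl | rfl <;> simp
    refine ⟨?_, ?_⟩
    · simp only [ok_shr, ok_sub, ok_reg, val_reg, ok_lit, val_lit]
      exact ⟨⟨trivial, trivial, by omega⟩, trivial, by omega, by omega⟩
    refine (choose_enumerates (w := W + 3) (c := τ₃.reg 30) (r := r) (key := fun x => lo (σ.arr 0 x)) hp0
      (by simpa using hE) (by simp [hF.reg, h3]) (by simp) (by simpa using h31) hr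
      (by simpa using hA) ?_ (by omega)).mono ?_
    · intro x hx
      -- The keys are at most `2 ^ W + 2`, which can exceed `2 ^ W`. The modulus `2 ^ (W + 3)` of
      -- the word comparisons leaves enough room for them.
      have h1 := hpW x (mem_range.1 (mem_filter.1 hx).1)
      have h2 := boxHi_le_add_two (p := σ.arr 0 x) hlt
      have h3 := Nat.div_le_self (σ.arr 0 x) (2 ^ l)
      have h4 := hlo (σ.arr 0 x)
      rw [pow_add]
      omega
    rintro t₄ τ₄ ⟨ht₄, hF₄, U, hUS, hUr, hUf, htop⟩
    have m30 := hF₄.reg 30 (by simp)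
    have m10 := hF₄.reg 10 (by simp)
    have m25 := hF₄.reg 25 (by simp)
    have m4 := hF₄.arr 4 (by simp)
    have m1 := hF₄.arr 1 (by simp)
    simp [g10, f10, e10, g25, h25] at m30 m10 m25 m4 m1 hUf
    replace hF : Frame 10 60 [1, 2, 3, 4, 5] σ τ₄ :=
      Frame.trans (by simpa using hF) hF₄ (by omega) (by omega) (by simp)
    have hSk : ∀ x ∈ (range k).filter fun x => lo (σ.arr 0 x) ≠ hi (σ.arr 0 x), x < k :=
      fun x hx => mem_range.1 (mem_filter.1 hx).1
    have hincl : inc * 2 ^ l ≤ 2 ^ W * 2 := by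
      rcases hinc with rfl | rfl <;> omega
    refine (roundAdd_spec (k := k) (c := τ₃.reg 30) (l := l) (inc := inc) (N := 2 ^ W * 2)
      (Z := fun x => lo (σ.arr 0 x) * 2 ^ l) (by rw [m4]; exact hE) hSk hUS m30 m10 m25
      (by rw [m4]; exact hUf) (by rw [m1]; exact hY) ?_ hincl (by omega)).mono ?_
    · intro x hx
      have := hloM (σ.arr 0 x)
      have := hpW x hx
      omega
    rintro t₅ τ₅ ⟨ht₅, hF₅, hfin⟩
    refine ⟨by omega, hF.trans hF₅ (by omega) (by omega) (by simp), ?_⟩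
    refine hR.isOptimalRounding hP hle hlt hlW (S := univ.filter fun i : Fin k => (i : ℕ) ∈ U)
      ?_ ?_ ?_ ?_
    · intro i hi
      simpa using (mem_filter.1 (hUS (mem_filter.1 hi).2)).2
    · rw [card_filter_val_mem fun x hx => hSk x (hUS hx), hUr,
        Fin.sum_univ_eq_sum_range (fun x => lo (σ.arr 0 x)) k, hsum]
    · intro i hiS j hj hjU
      have hiU := (mem_filter.1 hiS).2
      have hjS : (j : ℕ) ∈ (range k).filter fun x => lo (σ.arr 0 x) ≠ hi (σ.arr 0 x) := by simpa using hj
      have hkey : ∀ x < k, lo (σ.arr 0 x) < 2 ^ (W + 3) := fun x hx => by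
        have h1 := hpW x hx
        have h2 := boxHi_le_add_two (p := σ.arr 0 x) hlt
        have h3 := Nat.div_le_self (σ.arr 0 x) (2 ^ l)
        have h4 := hlo (σ.arr 0 x)
        rw [pow_add]
        omega
      exact lexLe_of_rev_le (hkey j j.2) (hkey i i.2)
        (htop i hiU j hjS fun h => hjU (mem_filter.2 ⟨mem_univ _, h⟩))
    · intro i
      rw [hfin i i.2]
      simp only [mem_filter, mem_univ, true_and]
      split_ifs <;> ring

end Round
end TrafficSplit

namespace TrafficSplit
open Finset

/-! ### The bit matcher -/

/-- The lowest bit of `x` is at position `t`. -/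
def AtLevel (t x : ℕ) : Prop := ∃ c, x = 2 ^ t * (2 * c + 1)

theorem exists_atLevel {x : ℕ} (hx : x ≠ 0) : ∃ t, AtLevel t x := exists_eq_two_pow_mul_odd hx

theorem AtLevel.land {t x s : ℕ} (h : AtLevel t x) (hx : x < 2 ^ s) : x &&& (2 ^ s - x) = 2 ^ t := by
  obtain ⟨c, rfl⟩ := h
  exact land_two_pow_sub hx

theorem AtLevel.unique {t s x : ℕ} (h : AtLevel t x) (h' : AtLevel s x) : t = s := by
  have h1 := h.land (Nat.lt_two_pow_self (n := x))
  rw [h'.land Nat.lt_two_pow_self] at h1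
  exact (Nat.pow_right_injective le_rfl h1).symm

theorem AtLevel.le {t x : ℕ} (h : AtLevel t x) : 2 ^ t ≤ x := by
  obtain ⟨c, rfl⟩ := h
  exact Nat.le_mul_of_pos_right _ (by omega)

theorem atLevel_iff {t x : ℕ} (h : 2 ^ t ∣ x) : AtLevel t x ↔ x / 2 ^ t % 2 = 1 := by
  obtain ⟨y, rfl⟩ := h
  have h2 : 0 < 2 ^ t := by positivity
  rw [Nat.mul_div_cancel_left _ h2]
  constructor
  · rintro ⟨c, hc⟩
    have := Nat.eq_of_mul_eq_mul_left h2 hc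
    omega
  · exact fun h => ⟨y / 2, by congr 1; omega⟩

/-- One round of matching: the parts at the lowest level `t` are moved up or down by `2 ^ t`. -/
def matched (X : ℕ → ℕ) (t : ℕ) (S U : Finset ℕ) (x : ℕ) : ℕ :=
  if x ∈ U then X x + 2 ^ t else if x ∈ S then X x - 2 ^ t else X x

section Match
variable {k W t : ℕ} {X : ℕ → ℕ} {S U : Finset ℕ}

/-- The members of `S` are the entries with odd quotient by `2 ^ t`, and the quotients sum to `2 ^
(W - t)`, an even number below level `W`. -/
theorem even_card_level (hdiv : ∀ x < k, 2 ^ t ∣ X x) (hsum : ∑ x ∈ range k, X x = 2 ^ W)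
    (ht : t < W) (hS : ∀ x, x ∈ S ↔ x < k ∧ AtLevel t (X x)) : S.card % 2 = 0 := by
  have h2 : 0 < 2 ^ t := by positivity
  have hy : ∀ x ∈ range k, X x = 2 ^ t * (X x / 2 ^ t) := fun x hx =>
    (Nat.mul_div_cancel' (hdiv x (mem_range.1 hx))).symm
  rw [sum_congr rfl hy, ← mul_sum, show W = t + (W - t - 1 + 1) by omega, pow_add] at hsum
  have hsum' := Nat.eq_of_mul_eq_mul_left h2 hsum
  have hSf : S = (range k).filter fun x => X x / 2 ^ t % 2 = 1 := by
    ext x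
    rw [hS, mem_filter, mem_range]
    exact and_congr_right fun hx => atLevel_iff (hdiv x hx)
  have hcard : S.card = ∑ x ∈ range k, X x / 2 ^ t % 2 := by
    rw [hSf, card_filter]
    refine sum_congr rfl fun x _ => ?_
    split_ifs <;> omega
  rw [hcard, ← Finset.sum_nat_mod, hsum', pow_succ]
  omega

theorem sum_matched (hsum : ∑ x ∈ range k, X x = 2 ^ W)
    (hS : ∀ x, x ∈ S ↔ x < k ∧ AtLevel t (X x)) (hU : U ⊆ S) (hcard : 2 * U.card = S.card) :
    ∑ x ∈ range k, matched X t S U x = 2 ^ W := by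
  have hSk : S ⊆ range k := fun x hx => mem_range.2 ((hS x).1 hx).1
  have h1 : ∑ x ∈ range k, (matched X t S U x + if x ∈ S \ U then 2 ^ t else 0) =
      ∑ x ∈ range k, (X x + if x ∈ U then 2 ^ t else 0) := by
    refine sum_congr rfl fun x _ => ?_
    simp only [matched, mem_sdiff]
    by_cases hxU : x ∈ U
    · simp [hxU, hU hxU]
    · by_cases hxS : x ∈ S
      · have := ((hS x).1 hxS).2.le
        simp [hxU, hxS]
        omega
      · simp [hxU, hxS]
  rw [sum_add_distrib, sum_add_distrib, ← sum_filter, ← sum_filter, sum_const, sum_const,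
    filter_mem_eq_inter, filter_mem_eq_inter, inter_eq_right.2 (sdiff_subset.trans hSk),
    inter_eq_right.2 (hU.trans hSk), card_sdiff_of_subset hU, hsum,
    show S.card - U.card = U.card by omega] at h1
  omega

theorem matched_eq (hdiv : ∀ x < k, 2 ^ t ∣ X x) (hS : ∀ x, x ∈ S ↔ x < k ∧ AtLevel t (X x))
    {x : ℕ} (hx : x < k) : (matched X t S U x : ℤ) = 2 ^ t * ((X x / 2 ^ t : ℕ) +
      if x ∈ U then 1 else if ((X x / 2 ^ t : ℕ) : ℤ) % 2 = 1 then -1 else 0) := by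
  have hX : (X x : ℤ) = 2 ^ t * (X x / 2 ^ t : ℕ) := by
    exact_mod_cast (Nat.mul_div_cancel' (hdiv x hx)).symm
  have hiff : ((X x / 2 ^ t : ℕ) : ℤ) % 2 = 1 ↔ x ∈ S := by
    rw [hS, and_iff_right hx, atLevel_iff (hdiv x hx)]
    omega
  simp only [matched, hiff]
  generalize X x / 2 ^ t = y at hX
  split_ifs with h1 h2
  · push_cast
    rw [hX]; ring
  · have := ((hS x).1 h2).2.le
    rw [Nat.cast_sub this]
    push_cast
    rw [hX]; ring
  · rw [hX]; ring

theorem dvd_matched (hdiv : ∀ x < k, 2 ^ t ∣ X x) (hS : ∀ x, x ∈ S ↔ x < k ∧ AtLevel t (X x))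
    (hU : U ⊆ S) {x : ℕ} (hx : x < k) : 2 ^ (t + 1) ∣ matched X t S U x := by
  have h := matched_eq (U := U) hdiv hS hx
  have hiff : ((X x / 2 ^ t : ℕ) : ℤ) % 2 = 1 ↔ x ∈ S := by
    rw [hS, and_iff_right hx, atLevel_iff (hdiv x hx)]
    omega
  have : (2 ^ (t + 1) : ℤ) ∣ (matched X t S U x : ℤ) := by
    rw [h, pow_succ]
    refine mul_dvd_mul_left _ ?_
    split_ifs with h1
    · have := hiff.2 (hU h1)
      omega
    · omega
    · omega
  exact_mod_cast this

/-- Division by `2 ^ t` turns the entries of level `t` into the odd ones, and `decomp_match`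
applies. As an equivalence of budgets it makes the greedy rounds exact in both directions. -/
theorem decomp_matched (hdiv : ∀ x < k, 2 ^ t ∣ X x) (hsum : ∑ x ∈ range k, X x = 2 ^ W)
    (ht : t < W) (hS : ∀ x, x ∈ S ↔ x < k ∧ AtLevel t (X x)) (hU : U ⊆ S)
    (hcard : 2 * U.card = S.card)
    (htop : ∀ x ∈ U, ∀ y ∈ S, y ∉ U → LexLe (X y / 2 ^ t : ℕ) (X x / 2 ^ t : ℕ)) (N : ℤ) :
    Decomp (fun i : Fin k => (X i : ℤ)) N ↔
      Decomp (fun i : Fin k => (matched X t S U i : ℤ)) (N - S.card) := by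
  have hX : (fun i : Fin k => (X i : ℤ)) = fun i : Fin k => 2 ^ t * ((X i / 2 ^ t : ℕ) : ℤ) := by
    funext i
    exact_mod_cast (Nat.mul_div_cancel' (hdiv i i.2)).symm
  have hM : (fun i : Fin k => (matched X t S U i : ℤ)) = fun i : Fin k => 2 ^ t *
      (((X i / 2 ^ t : ℕ) : ℤ) + if i ∈ univ.filter (fun i : Fin k => (i : ℕ) ∈ U) then 1 else
        if ((X i / 2 ^ t : ℕ) : ℤ) % 2 = 1 then -1 else 0) := by
    funext i
    rw [matched_eq hdiv hS i.2]
    simp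
  have hmem : ∀ i : Fin k, ((X i / 2 ^ t : ℕ) : ℤ) % 2 = 1 ↔ (i : ℕ) ∈ S := fun i => by
    rw [hS, and_iff_right i.2, atLevel_iff (hdiv i i.2)]
    omega
  have hSk : ∀ x ∈ S, x < k := fun x hx => ((hS x).1 hx).1
  have hc : (univ.filter fun i : Fin k => ((X i / 2 ^ t : ℕ) : ℤ) % 2 = 1).card = S.card := by
    rw [← card_filter_val_mem hSk]
    congr 1
    ext i
    simp only [mem_filter, mem_univ, true_and, hmem]
  rw [hX, hM, decomp_two_pow_mul_iff, decomp_two_pow_mul_iff,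
    decomp_match (U := univ.filter (fun i : Fin k => (i : ℕ) ∈ U)), hc]
  · have heven := even_card_level hdiv hsum ht hS
    have h1 : ∑ i : Fin k, ((X i / 2 ^ t : ℕ) : ℤ) = ((∑ x ∈ range k, X x / 2 ^ t : ℕ) : ℤ) := by
      rw [← Fin.sum_univ_eq_sum_range (fun x => X x / 2 ^ t) k]
      push_cast
      rfl
    have hy : ∀ x ∈ range k, X x = 2 ^ t * (X x / 2 ^ t) := fun x hx =>
      (Nat.mul_div_cancel' (hdiv x (mem_range.1 hx))).symm
    rw [sum_congr rfl hy, ← mul_sum, show W = t + (W - t - 1 + 1) by omega, pow_add] at hsum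
    have hsum' := Nat.eq_of_mul_eq_mul_left (by positivity) hsum
    rw [h1, hsum', pow_succ]
    push_cast
    omega
  · intro i hi
    rw [hmem]
    exact hU (mem_filter.1 hi).2
  · rw [hc, card_filter_val_mem fun x hx => hSk x (hU hx), hcard]
  · intro i hi j hj hjU
    exact htop i (mem_filter.1 hi).2 j ((hmem j).1 hj) fun h => hjU (mem_filter.2 ⟨mem_univ _, h⟩)

/-- Each odd quotient needs a nonzero lowest digit. This justifies stopping the test as soon as a
level is larger than the remaining budget. -/
theorem card_level_le (hdiv : ∀ x < k, 2 ^ t ∣ X x) (hS : ∀ x, x ∈ S ↔ x < k ∧ AtLevel t (X x))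
    {N : ℤ} (h : Decomp (fun i : Fin k => (X i : ℤ)) N) : (S.card : ℤ) ≤ N := by
  have hX : (fun i : Fin k => (X i : ℤ)) = fun i : Fin k => 2 ^ t * ((X i / 2 ^ t : ℕ) : ℤ) := by
    funext i
    exact_mod_cast (Nat.mul_div_cancel' (hdiv i i.2)).symm
  rw [hX, decomp_two_pow_mul_iff] at h
  obtain ⟨D, C, m, -, hC, hn, hD⟩ := h.exists_step
  have hle : (S.card : ℤ) ≤ ∑ i, |D i| := by
    rw [← card_filter_val_mem (k := k) fun x hx => ((hS x).1 hx).1, card_filter]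
    push_cast
    refine sum_le_sum fun i _ => ?_
    split_ifs with hi
    · have h1 := (atLevel_iff (hdiv i i.2)).1 ((hS i).1 hi).2
      have h2 := hD i
      have : D i ≠ 0 := by omega
      exact Int.one_le_abs this
    · exact abs_nonneg _
  have := hC.nonneg
  omega

/-- The final state of the matcher: all weight is in one part and only the dummy transaction
remains. -/
theorem decomp_single (hsum : ∑ x ∈ range k, X x = 2 ^ W) {i : ℕ} (hi : i < k) (hX : 2 ^ W ≤ X i)
    {N : ℤ} (hN : 1 ≤ N) : Decomp (fun i : Fin k => (X i : ℤ)) N := by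
  have h1 : Decomp (fun _ : Fin k => (0 : ℤ)) 0 := .zero _ _ (by simp) le_rfl
  refine ((h1.add_top (by simp) W ⟨i, hi⟩).mono (n' := N) (by omega)).congr fun j => ?_
  have hle : X i ≤ 2 ^ W := by
    rw [← hsum]
    exact single_le_sum (f := X) (fun _ _ => Nat.zero_le _) (mem_range.2 hi)
  split_ifs with h
  · subst h
    have : X i = 2 ^ W := le_antisymm hle hX
    simp [this]
  · have h2 := Finset.add_le_sum (f := X) (s := range k) (fun _ _ => Nat.zero_le _)
      (mem_range.2 hi) (mem_range.2 j.2) fun hij => h (Fin.ext hij.symm)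
    rw [hsum] at h2
    have : X j = 0 := by omega
    simp [this]

end Match

/-! ### Buckets -/

/-- The list with head `h` and successors `nx`, where `i + 1` points to `i` and `0` to the end. -/
def Linked (nx : ℕ → ℕ) : ℕ → List ℕ → Prop
  | h, [] => h = 0
  | h, i :: l => h = i + 1 ∧ Linked nx (nx i) l

theorem Linked.congr {nx nx' : ℕ → ℕ} {l : List ℕ} {h : ℕ} (hl : Linked nx h l)
    (hnx : ∀ i ∈ l, nx' i = nx i) : Linked nx' h l := by
  induction l generalizing h with
  | nil => exact hl
  | cons i l ih =>
    refine ⟨hl.1, ?_⟩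
    rw [hnx i List.mem_cons_self]
    exact ih hl.2 fun j hj => hnx j (List.mem_cons_of_mem _ hj)

/-- The indices in `A` are kept in lists by the level of their entries in `X`; `mask` has the bits of
the nonempty levels. -/
structure Buckets (X nx hd : ℕ → ℕ) (mask : ℕ) (L : ℕ → List ℕ) (A : Finset ℕ) : Prop where
  bit : ∀ t, mask.testBit t = true ↔ L t ≠ []
  linked : ∀ t, L t ≠ [] → Linked nx (hd t) (L t)
  nodup : ∀ t, (L t).Nodup
  mem : ∀ t i, i ∈ L t ↔ i ∈ A ∧ AtLevel t (X i)

namespace Buckets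
variable {X nx hd : ℕ → ℕ} {mask : ℕ} {L : ℕ → List ℕ} {A : Finset ℕ}

theorem empty (X nx hd : ℕ → ℕ) : Buckets X nx hd 0 (fun _ => []) ∅ :=
  ⟨by simp, by simp, by simp, by simp⟩

theorem congr {X' : ℕ → ℕ} (h : Buckets X nx hd mask L A) (hX : ∀ i ∈ A, X' i = X i) :
    Buckets X' nx hd mask L A :=
  ⟨h.bit, h.linked, h.nodup, fun t i => by
    rw [h.mem]
    exact and_congr_right fun hi => by rw [hX i hi]⟩

/-- The head of an empty level is arbitrary memory. The mask tells whether it may be trusted, so the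
array of heads, whose length depends on `W` and not on `k`, never has to be initialised. -/
theorem insert (h : Buckets X nx hd mask L A) {i t : ℕ} (hi : i ∉ A) (ht : AtLevel t (X i)) :
    Buckets X (Function.update nx i (if mask.testBit t then hd t else 0))
      (Function.update hd t (i + 1)) (mask ||| 2 ^ t) (Function.update L t (i :: L t))
      (Insert.insert i A) := by
  have hL : ∀ s, i ∉ L s := fun s hs => hi ((h.mem s i).1 hs).1
  have hcongr : ∀ s, ∀ j ∈ L s, Function.update nx i (if mask.testBit t then hd t else 0) j = nx j :=
    fun s j hj => Function.update_of_ne (fun hji => hL s (by rwa [← hji])) _ _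
  refine ⟨fun s => ?_, fun s hs => ?_, fun s => ?_, fun s j => ?_⟩
  · rw [Nat.testBit_or, Nat.testBit_two_pow, Function.update_apply]
    split_ifs with hst
    · simp [hst]
    · simp [Ne.symm hst, h.bit]
  · by_cases hst : s = t
    · subst hst
      simp only [Function.update_self]
      refine ⟨rfl, ?_⟩
      rw [Function.update_self]
      by_cases hb : mask.testBit s = true
      · rw [if_pos hb]
        have hc := hcongr s
        rw [if_pos hb] at hc
        exact (h.linked s ((h.bit s).1 hb)).congr hc
      · rw [if_neg hb]
        have : L s = [] := not_not.1 (mt (h.bit s).2 hb)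
        rw [this]
        rfl
    · simp only [Function.update_of_ne hst] at hs ⊢
      exact (h.linked s hs).congr (hcongr s)
  · rw [Function.update_apply]
    split_ifs with hst
    · exact List.nodup_cons.2 ⟨hL t, h.nodup t⟩
    · exact h.nodup s
  · rw [Function.update_apply, mem_insert]
    split_ifs with hst
    · subst hst
      rw [List.mem_cons, h.mem]
      constructor
      · rintro (rfl | hj)
        · exact ⟨Or.inl rfl, ht⟩
        · exact ⟨Or.inr hj.1, hj.2⟩
      · rintro ⟨rfl | hj, hj'⟩
        · exact Or.inl rfl
        · exact Or.inr ⟨hj, hj'⟩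
    · rw [h.mem]
      constructor
      · exact fun hj => ⟨Or.inr hj.1, hj.2⟩
      · rintro ⟨rfl | hj, hj'⟩
        · exact absurd (hj'.unique ht) hst
        · exact ⟨hj, hj'⟩

/-- Clearing one bit of the mask empties the level; the stale head and links may stay, because
`linked` concerns nonempty levels only. -/
theorem remove (h : Buckets X nx hd mask L A) {t : ℕ} (ht : L t ≠ []) :
    Buckets X nx hd (mask ^^^ 2 ^ t) (Function.update L t []) (A \ (L t).toFinset) := by
  have hb := (h.bit t).2 ht
  refine ⟨fun s => ?_, fun s hs => ?_, fun s => ?_, fun s j => ?_⟩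
  · rw [Nat.testBit_xor, Nat.testBit_two_pow, Function.update_apply]
    split_ifs with hst
    · simp [hst, hb]
    · simp [Ne.symm hst, h.bit]
  · by_cases hst : s = t
    · subst hst; simp at hs
    · simp only [Function.update_of_ne hst] at hs ⊢
      exact h.linked s hs
  · rw [Function.update_apply]
    split_ifs
    · exact List.nodup_nil
    · exact h.nodup s
  · rw [Function.update_apply, mem_sdiff, List.mem_toFinset, h.mem]
    split_ifs with hst
    · subst hst
      simp only [List.not_mem_nil, false_iff]
      exact fun hj => hj.1.2 ⟨hj.1.1, hj.2⟩
    · rw [h.mem]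
      constructor
      · exact fun hj => ⟨⟨hj.1, fun h' => hst (hj.2.unique h'.2)⟩, hj.2⟩
      · exact fun hj => ⟨hj.1.1, hj.2⟩

theorem mask_lt (h : Buckets X nx hd mask L A) {W : ℕ} (hX : ∀ i ∈ A, X i ≤ 2 ^ W) :
    mask < 2 ^ (W + 1) := by
  refine Nat.lt_pow_two_of_testBit _ fun t ht => ?_
  by_contra hc
  obtain ⟨i, hi⟩ := List.exists_mem_of_ne_nil _ ((h.bit t).1 (by simpa using hc))
  obtain ⟨hi1, hi2⟩ := (h.mem t i).1 hi
  have := Nat.pow_lt_pow_right (a := 2) (by norm_num) (show W < t by omega)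
  have := hi2.le
  have := hX i hi1
  omega

/-- The lowest bit of the mask is the lowest level of the entries. -/
theorem lowest (h : Buckets X nx hd mask L A) {t : ℕ} (ht : AtLevel t mask) :
    L t ≠ [] ∧ ∀ i ∈ A, X i ≠ 0 → 2 ^ t ∣ X i := by
  obtain ⟨c, rfl⟩ := ht
  refine ⟨(h.bit t).1 ?_, fun i hi hXi => ?_⟩
  · rw [Nat.testBit_two_pow_mul]
    simp
  · obtain ⟨s, hs⟩ := exists_atLevel hXi
    have h1 := (h.bit s).2 (List.ne_nil_of_mem ((h.mem s i).2 ⟨hi, hs⟩))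
    rw [Nat.testBit_two_pow_mul] at h1
    simp only [Bool.and_eq_true, decide_eq_true_eq] at h1
    obtain ⟨c', hc'⟩ := hs
    rw [hc']
    exact (pow_dvd_pow 2 h1.1).mul_right _

end Buckets
end TrafficSplit

/-! ### Bucket operations of the complexity test. -/

namespace TrafficSplit
open Finset

/-- Puts the index `r₁₄` with entry `r₁₆` into its bucket; `r₁₇` is the mask of levels. -/
def checkInsert : Stmt :=
  18 ≔ .bin .and (.reg 16) (.reg 3 - .reg 16) ;; 19 ≔ .log2 (.reg 18) ;;
  .ite .eq (.bin .and (.reg 17) (.reg 18)) 0 (.put 6 (.reg 14) 0)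
    (.put 6 (.reg 14) (.arr 7 (.reg 19))) ;;
  .put 7 (.reg 19) (.reg 14 + 1) ;; 17 ≔ .bin .or (.reg 17) (.reg 18)

/-- Puts all nonzero entries of array `1` into buckets. -/
def checkInit : Stmt :=
  17 ≔ 0 ;; 14 ≔ 0 ;;
  .loop .lt (.reg 14) (.reg 0) (
    16 ≔ .arr 1 (.reg 14) ;; .ite .eq (.reg 16) 0 .skip checkInsert ;; 14 ≔ .reg 14 + 1)

/-- Takes the bucket of level `r₁₃` with bit `r₁₂` apart. -/
def checkPop : Stmt :=
  14 ≔ .arr 7 (.reg 13) ;; 30 ≔ 0 ;; 17 ≔ .bin .xor (.reg 17) (.reg 12) ;;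
  .loop .ne (.reg 14) 0 (
    14 ≔ .reg 14 - 1 ;; .put 4 (.reg 30) (.reg 14) ;;
    .put 2 (.reg 30) (.bin .shr (.arr 1 (.reg 14)) (.reg 13)) ;; 30 ≔ .reg 30 + 1 ;;
    14 ≔ .arr 6 (.reg 14))

/-- Matches the entries of a level and puts them back into buckets. -/
def checkReinsert : Stmt :=
  15 ≔ 0 ;;
  .loop .lt (.reg 15) (.reg 30) (
    14 ≔ .arr 4 (.reg 15) ;;
    .ite .eq (.arr 5 (.reg 15)) 1 (16 ≔ .arr 1 (.reg 14) + .reg 12)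
      (16 ≔ .arr 1 (.reg 14) - .reg 12) ;;
    .put 1 (.reg 14) (.reg 16) ;;
    .ite .eq (.reg 16) 0 .skip checkInsert ;; 15 ≔ .reg 15 + 1)

section Check
variable {B : ℕ} {procs : List Stmt} {k W : ℕ}

theorem checkInsert_spec {σ : Store} {i x t : ℕ} {X : ℕ → ℕ} {L : ℕ → List ℕ} {A : Finset ℕ}
    (h3 : σ.reg 3 = 2 ^ (W + 3)) (h14 : σ.reg 14 = i) (h16 : σ.reg 16 = x) (hx : AtLevel t x)
    (hxW : x ≤ 2 ^ W) (hb : Buckets X (σ.arr 6) (σ.arr 7) (σ.reg 17) L A) (hX : X i = x)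
    (hi : i ∉ A) (hik : i < k) (hB : 1000 * (2 ^ W + k) ≤ B) :
    WP B procs checkInsert (fun s σ' => s ≤ 6 ∧ Frame 17 20 [6, 7] σ σ' ∧
      ∃ L', Buckets X (σ'.arr 6) (σ'.arr 7) (σ'.reg 17) L' (insert i A)) σ := by
  have hM : 2 ^ (W + 3) = 2 ^ W * 8 := by rw [pow_add]; norm_num
  have h2W : 0 < 2 ^ W := by positivity
  have hland := hx.land (s := W + 3) (by omega)
  have htW : t ≤ W := (Nat.pow_le_pow_iff_right (by norm_num : 1 < 2)).1 (hx.le.trans hxW)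
  have hW := Nat.lt_two_pow_self (n := W)
  have hins := hb.insert hi (hX.symm ▸ hx)
  have hand : σ.reg 17 &&& 2 ^ t = 0 ↔ (σ.reg 17).testBit t = false := by
    rw [Nat.and_two_pow]
    cases (σ.reg 17).testBit t <;> simp
  simp [checkInsert, h3, h14, h16, hland, Frame.refl, hand, Nat.log2_two_pow]
  repeat' with_reducible first | intro hc | refine And.intro ?_ ?_
  all_goals first | omega | exact ⟨Function.update L t (i :: L t), by simpa [hc] using hins⟩

theorem checkInit_spec {σ : Store} (h0 : σ.reg 0 = k) (h3 : σ.reg 3 = 2 ^ (W + 3))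
    (hX : ∀ x < k, σ.arr 1 x ≤ 2 ^ W) (hB : 1000 * (2 ^ W + k) ≤ B) :
    WP B procs checkInit (fun s σ' => s ≤ 11 * k + 4 ∧ Frame 14 20 [6, 7] σ σ' ∧
      ∃ L A, Buckets (σ.arr 1) (σ'.arr 6) (σ'.arr 7) (σ'.reg 17) L A ∧
        ∀ x, x ∈ A ↔ x < k ∧ σ.arr 1 x ≠ 0) σ := by
  have h2W : 0 < 2 ^ W := by positivity
  simp only [checkInit, wp_seq, wp_set]
  refine ⟨by simp; omega, by simp; omega, (WP.forLoop (fun i τ => Frame 14 20 [6, 7] σ τ ∧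
      τ.reg 14 = i ∧ ∃ L A, Buckets (σ.arr 1) (τ.arr 6) (τ.arr 7) (τ.reg 17) L A ∧
        ∀ x, x ∈ A ↔ x < i ∧ σ.arr 1 x ≠ 0) k 10 ?_ ?_ ?_).mono ?_⟩
  · rintro i τ hi ⟨hF, h1, h2⟩
    simp [hF.reg, h1, h0]
  · rintro i τ hi ⟨hF, h1, L, A, hb, hA⟩
    have e1 := hF.arr 1 (by simp)
    have hiA : i ∉ A := fun h => absurd ((hA i).1 h).1 (lt_irrefl _)
    rw [wp_seq, wp_set]
    refine ⟨by simp [h1]; omega, ?_⟩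
    rw [wp_seq, wp_ite]
    refine ⟨by simp, by simp; omega, fun hc => ?_, fun hc => ?_⟩
    · replace hc : σ.arr 1 i = 0 := by simpa [h1, e1] using hc
      simp [hF, h1]
      refine ⟨by omega, L, A, hb, fun x => ?_⟩
      rw [hA]
      constructor
      · rintro ⟨hx, hx'⟩; exact ⟨by omega, hx'⟩
      · rintro ⟨hx, hx'⟩
        exact ⟨lt_of_le_of_ne hx fun h => hx' (h ▸ hc), hx'⟩
    · replace hc : σ.arr 1 i ≠ 0 := by simpa [h1, e1] using hc
      obtain ⟨t, ht⟩ := exists_atLevel hc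
      refine (checkInsert_spec (W := W) (k := k) (i := i) (t := t) (X := σ.arr 1) (L := L) (A := A)
        (by simp [hF.reg, h3]) (by simp [h1]) (by simp [h1, e1]) ht (hX i hi) (by simpa using hb) rfl
        hiA hi hB).mono ?_
      rintro s τ' ⟨hs, hF', L', hb'⟩
      have hF2 : Frame 14 20 [6, 7] σ τ' := Frame.trans (by simpa using hF) hF' (by omega) (by omega)
        (by simp)
      have e14 := hF'.reg 14 (by simp)
      simp [h1] at e14
      simp [hF2, e14]
      refine ⟨by omega, by omega, L', _, hb', fun x => ?_⟩
      rw [mem_insert, hA]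
      constructor
      · rintro (rfl | ⟨hx, hx'⟩)
        · exact ⟨by omega, hc⟩
        · exact ⟨by omega, hx'⟩
      · rintro ⟨hx, hx'⟩
        rcases Nat.lt_or_eq_of_le hx with h | h
        · exact Or.inr ⟨h, hx'⟩
        · exact Or.inl h
  · simp [Frame.refl]
    exact ⟨_, _, Buckets.empty _ _ _, by simp⟩
  · rintro s τ ⟨hs, hF, -, h⟩
    exact ⟨by omega, hF, h⟩

theorem checkPop_spec {σ : Store} {t : ℕ} {L : ℕ → List ℕ} {A : Finset ℕ}
    (h12 : σ.reg 12 = 2 ^ t) (h13 : σ.reg 13 = t) (htW : t ≤ W) (ht : L t ≠ [])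
    (hb : Buckets (σ.arr 1) (σ.arr 6) (σ.arr 7) (σ.reg 17) L A) (hA : ∀ x ∈ A, x < k)
    (hB : 1000 * (2 ^ W + k) ≤ B) :
    WP B procs checkPop (fun s σ' => s ≤ 6 * (L t).length + 4 ∧ Frame 14 31 [2, 4] σ σ' ∧
      σ'.reg 17 = σ.reg 17 ^^^ 2 ^ t ∧ σ'.reg 30 = (L t).length ∧
      Enumerates (σ'.arr 4) (L t).length (L t).toFinset ∧
      ∀ j < (L t).length, σ'.arr 2 j = σ.arr 1 (σ'.arr 4 j) / 2 ^ t) σ := by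
  have h2W : 0 < 2 ^ W := by positivity
  have hW := Nat.lt_two_pow_self (n := W)
  have hlen : (L t).length ≤ k := by
    rw [← List.toFinset_card_of_nodup (hb.nodup t), ← card_range k]
    exact card_le_card fun x hx =>
      mem_range.2 (hA x ((hb.mem t x).1 (List.mem_toFinset.1 hx)).1)
  simp only [checkPop, wp_seq, wp_set]
  -- The ghost data are the indices already taken out and those still linked from register 14.
  refine ⟨by simp [h13]; omega, by simp; omega, by simp, (WP.loop
    (fun (x : List ℕ × List ℕ) τ => Frame 14 31 [2, 4] σ τ ∧ τ.reg 17 = σ.reg 17 ^^^ 2 ^ t ∧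
      x.1 ++ x.2 = L t ∧ τ.reg 30 = x.1.length ∧ Linked (σ.arr 6) (τ.reg 14) x.2 ∧
      Enumerates (τ.arr 4) x.1.length x.1.toFinset ∧
      ∀ j < x.1.length, τ.arr 2 j = σ.arr 1 (τ.arr 4 j) / 2 ^ t) (fun x => 6 * x.2.length + 1)
    ?_ ?_ (x := ([], L t)) ?_).mono ?_⟩
  · rintro ⟨d, l⟩ τ h
    simp; omega
  · rintro ⟨d, l⟩ τ ⟨hF, h17, hdl, h30, hl, hE, hA'⟩ hc
    simp only at hdl h30 hl hE hA'
    have hnd := hb.nodup t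
    rw [← hdl] at hnd hlen
    cases l with
    | nil => exact absurd (show τ.reg 14 = 0 from hl) (by simpa using hc)
    | cons i l =>
      obtain ⟨h14, hl⟩ := hl
      have hi : i < k := hA i ((hb.mem t i).1 (by rw [← hdl]; simp)).1
      have hid : i ∉ d := fun h => (List.disjoint_of_nodup_append hnd) h List.mem_cons_self
      have hE' := hE.snoc (x := i) (by simpa using hid)
      have e13 := (hF.reg 13 (by simp)).trans h13
      have e1 := hF.arr 1 (by simp)
      have e6 := hF.arr 6 (by simp)
      simp at hlen
      refine WP.mono (Q := fun s τ' => s ≤ 5 ∧ Frame 14 31 [2, 4] σ τ' ∧ τ'.reg 17 = τ.reg 17 ∧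
        τ'.reg 30 = d.length + 1 ∧ τ'.reg 14 = σ.arr 6 i ∧
        τ'.arr 4 = Function.update (τ.arr 4) d.length i ∧
        τ'.arr 2 = Function.update (τ.arr 2) d.length (σ.arr 1 i / 2 ^ t)) ?_ ?_
      · simp [h14]
        rw [h30, e13, e1, e6]
        exact ⟨by omega, by omega, by omega, by omega, ⟨by omega, by omega⟩, by omega, hF, rfl, rfl,
          rfl, rfl⟩
      rintro s τ' ⟨hs, hF', g17, g30, g14, g4, g2⟩
      refine ⟨(d ++ [i], l), ⟨hF', g17.trans h17, by simp [hdl], by simp [g30], g14.symm ▸ hl, ?_, ?_⟩, ?_⟩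
      · have hset : (d ++ [i]).toFinset = insert i d.toFinset := by ext; simp
        simp only [hset, g4, List.length_append, List.length_cons, List.length_nil, zero_add]
        exact hE'
      · intro j hj
        simp only [List.length_append, List.length_cons, List.length_nil] at hj
        simp only [g2, g4, Function.update_apply]
        split_ifs with hjd
        · rfl
        · exact hA' j (by omega)
      · simp only [List.length_cons]
        omega
  · refine ⟨by simp [Frame.refl], by simp [h12], rfl, by simp, ?_, ?_, ?_⟩
    · simpa [h13] using hb.linked t ht
    · simpa using Enumerates.empty _
    · simp
  · rintro s τ ⟨hs, ⟨d, l⟩, ⟨hF, h17, hdl, h30, hl, hE, hA'⟩, hc⟩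
    simp only at hdl h30 hl hE hA' hs
    have h14 : τ.reg 14 = 0 := by simpa using hc
    cases l with
    | cons i l => exact absurd hl.1 (by omega)
    | nil =>
      rw [List.append_nil] at hdl
      subst hdl
      exact ⟨by omega, hF, h17, h30, hE, hA'⟩

end Check
end TrafficSplit

/-! ### One matching round on the buckets. -/

namespace TrafficSplit
open Finset

/-- Sets `r₇` to `1` if the partition in array `1` has complexity at most `r₂`, and to `0` otherwise. -/
def check : Stmt :=
  checkInit ;; 11 ≔ .reg 2 - 1 ;; 7 ≔ 1 ;; 12 ≔ .bin .and (.reg 17) (.reg 3 - .reg 17) ;;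
  .loop .ne (.reg 12) (.bin .shr (.reg 3) 3) (
    13 ≔ .log2 (.reg 12) ;; checkPop ;; 31 ≔ .bin .shr (.reg 30) 1 ;;
    .ite .lt (.reg 11) (.reg 31) (7 ≔ 0 ;; 12 ≔ .bin .shr (.reg 3) 3)
      (11 ≔ .reg 11 - .reg 31 ;; choose ;; checkReinsert ;;
        12 ≔ .bin .and (.reg 17) (.reg 3 - .reg 17)))

section Check
variable {B : ℕ} {procs : List Stmt} {k W : ℕ}

/-- Array 1 changes gradually, but in the loop invariant the buckets refer to the final vector `X'`
from the start. This is sound since `X'` agrees with the old vector off `S`, and members of `S`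
enter the buckets only after their new value is known. -/
theorem checkReinsert_spec {σ : Store} {t c : ℕ} {S U A₀ : Finset ℕ} {L₀ : ℕ → List ℕ}
    (h3 : σ.reg 3 = 2 ^ (W + 3)) (h12 : σ.reg 12 = 2 ^ t) (h30 : σ.reg 30 = c) (htW : t ≤ W)
    (hE : Enumerates (σ.arr 4) c S) (hS : ∀ x, x ∈ S ↔ x < k ∧ AtLevel t (σ.arr 1 x)) (hU : U ⊆ S)
    (hFl : ∀ j < c, σ.arr 5 j = 1 ↔ σ.arr 4 j ∈ U)
    (hb : Buckets (σ.arr 1) (σ.arr 6) (σ.arr 7) (σ.reg 17) L₀ A₀)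
    (hA₀ : ∀ x, x ∈ A₀ ↔ (x < k ∧ σ.arr 1 x ≠ 0) ∧ x ∉ S)
    (hXW : ∀ x < k, σ.arr 1 x ≤ 2 ^ W) (hMW : ∀ x < k, matched (σ.arr 1) t S U x ≤ 2 ^ W)
    (hB : 1000 * (2 ^ W + k) ≤ B) :
    WP B procs checkReinsert (fun s σ' => s ≤ 15 * c + 2 ∧ Frame 14 20 [1, 6, 7] σ σ' ∧
      σ'.arr 1 = matched (σ.arr 1) t S U ∧
      ∃ L A, Buckets (σ'.arr 1) (σ'.arr 6) (σ'.arr 7) (σ'.reg 17) L A ∧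
        ∀ x, x ∈ A ↔ x < k ∧ σ'.arr 1 x ≠ 0) σ := by
  have h2W : 0 < 2 ^ W := by positivity
  have h2t : 2 ^ t ≤ 2 ^ W := Nat.pow_le_pow_right (by norm_num) htW
  have hck : c ≤ k := by
    rw [← hE.card, ← card_range k]
    exact card_le_card fun x hx => mem_range.2 ((hS x).1 hx).1
  have hoff : ∀ x, x ∉ S → matched (σ.arr 1) t S U x = σ.arr 1 x := fun x hx => by
    rw [matched, if_neg fun h => hx (hU h), if_neg hx]
  obtain ⟨X', hX'⟩ : ∃ X', matched (σ.arr 1) t S U = X' := ⟨_, rfl⟩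
  simp only [checkReinsert, wp_seq, wp_set]
  refine ⟨by simp; omega, (WP.forLoop (fun i τ => Frame 14 20 [1, 6, 7] σ τ ∧ τ.reg 15 = i ∧
      (∀ j < i, τ.arr 1 (σ.arr 4 j) = X' (σ.arr 4 j)) ∧
      (∀ x, (∀ j < i, σ.arr 4 j ≠ x) → τ.arr 1 x = σ.arr 1 x) ∧
      ∃ L A, Buckets X' (τ.arr 6) (τ.arr 7) (τ.reg 17) L A ∧
        ∀ x, x ∈ A ↔ x ∈ A₀ ∨ ((∃ j < i, σ.arr 4 j = x) ∧ X' x ≠ 0)) c 14 ?_ ?_ ?_).mono ?_⟩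
  · rintro i τ hi ⟨hF, h1, h2⟩
    simp [hF.reg, h1, h30]
  · rintro i τ hi ⟨hF, h1, hdone, htodo, L, A, hbA, hA⟩
    obtain ⟨y, hy⟩ : ∃ y, σ.arr 4 i = y := ⟨_, rfl⟩
    have hyS : y ∈ S := hy ▸ hE.mem i hi
    obtain ⟨hyk, hyt⟩ := (hS y).1 hyS
    have hyX := hXW y hyk
    have hyM := hMW y hyk
    rw [hX'] at hyM
    have hnew : ∀ j < i, σ.arr 4 j ≠ y := fun j hj h =>
      absurd (hE.inj j (by omega) i hi (h.trans hy.symm)) (by omega)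
    have hτy := htodo y hnew
    have hyA : y ∉ A := fun h => by
      rcases (hA y).1 h with h | ⟨⟨j, hj, hj'⟩, -⟩
      · exact ((hA₀ y).1 h).2 hyS
      · exact hnew j hj hj'
    have hfi := hFl i hi
    rw [hy] at hfi
    have e4 := hF.arr 4 (by simp)
    have e5 := hF.arr 5 (by simp)
    have e12 := (hF.reg 12 (by simp)).trans h12
    have hle := hyt.le
    rw [wp_seq, wp_set]
    refine ⟨by simp [h1]; omega, ?_⟩
    rw [wp_seq]
    refine WP.mono (Q := fun s τ' => s ≤ 2 ∧ Frame 16 17 [] (τ.set 14 y) τ' ∧ τ'.reg 16 = X' y) ?_ ?_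
    · simp [h1, e4, e5, hfi, hy, hτy, e12, Frame.refl, ← hX', matched, hyS]
      by_cases hyU : y ∈ U
      · simp [hyU]; omega
      · simp [hyU]; omega
    rintro s₁ τ₁ ⟨hs₁, hF₁, g16⟩
    have hF2 : Frame 14 20 [1, 6, 7] σ τ₁ := Frame.trans (by simpa using hF) hF₁ (by omega)
      (by omega) (by simp)
    have g14 := hF₁.reg 14 (by simp)
    have g15 := hF₁.reg 15 (by simp)
    have g17 := hF₁.reg 17 (by simp)
    have g1 := hF₁.arr 1 (by simp)
    have g6 := hF₁.arr 6 (by simp)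
    have g7 := hF₁.arr 7 (by simp)
    simp [h1] at g14 g15 g17 g1 g6 g7
    clear hF₁
    have hdone' : ∀ j < i + 1, Function.update (τ.arr 1) y (X' y) (σ.arr 4 j) = X' (σ.arr 4 j) := by
      intro j hj
      rw [Function.update_apply]
      split_ifs with h
      · rw [h]
      · refine hdone j (lt_of_le_of_ne (by omega) fun hji => h (by rw [hji, hy]))
    have htodo' : ∀ x, (∀ j < i + 1, σ.arr 4 j ≠ x) →
        Function.update (τ.arr 1) y (X' y) x = σ.arr 1 x := by
      intro x hx
      rw [Function.update_of_ne fun h => hx i (by omega) (hy.trans h.symm)]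
      exact htodo x fun j hj => hx j (by omega)
    rw [wp_seq, wp_put]
    refine ⟨by simp, by simp, by simp [g14]; omega, ?_⟩
    rw [wp_seq, wp_ite]
    refine ⟨by simp, by simp; omega, fun hc => ?_, fun hc => ?_⟩
    · replace hc : X' y = 0 := by simpa [g16] using hc
      rw [wp_skip, wp_set]
      refine ⟨by simp [g15]; omega, by omega, by simpa using hF2, by simp [g15], ?_, ?_, L, A, ?_, fun x => ?_⟩
      · simpa [g14, g1, g16] using hdone'
      · simpa [g14, g1, g16] using htodo'
      · simpa [g17, g6, g7] using hbA
      · rw [hA]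
        refine or_congr_right ⟨fun ⟨⟨j, hj, hj'⟩, h⟩ => ⟨⟨j, by omega, hj'⟩, h⟩,
          fun ⟨⟨j, hj, hj'⟩, h⟩ => ⟨⟨j, lt_of_le_of_ne (by omega) fun hji => h ?_, hj'⟩, h⟩⟩
        rw [← hj', hji, hy, hc]
    · replace hc : X' y ≠ 0 := by simpa [g16] using hc
      obtain ⟨s, hs⟩ := exists_atLevel hc
      refine (checkInsert_spec (W := W) (k := k) (i := y) (t := s) (X := X') (L := L) (A := A)
        (by simp [hF2.reg, h3]) (by simp [g14]) (by simp [g16]) hs hyM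
        (by simpa [g17, g6, g7] using hbA) rfl hyA hyk hB).mono ?_
      rintro s₂ τ₂ ⟨hs₂, hF₂, L', hb'⟩
      have hF3 : Frame 14 20 [1, 6, 7] σ τ₂ := Frame.trans (by simpa using hF2) hF₂ (by omega)
        (by omega) (by simp)
      have f15 := hF₂.reg 15 (by simp)
      have f1 := hF₂.arr 1 (by simp)
      simp [g15, g14, g1, g16] at f15 f1
      rw [wp_set]
      refine ⟨by simp [f15]; omega, by omega, by simpa using hF3, by simp [f15], ?_, ?_, L', _, by simpa using hb',
        fun x => ?_⟩
      · simpa [f1] using hdone'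
      · simpa [f1] using htodo'
      · rw [mem_insert, hA]
        constructor
        · rintro (rfl | h | ⟨⟨j, hj, hj'⟩, h⟩)
          · exact Or.inr ⟨⟨i, by omega, hy⟩, hc⟩
          · exact Or.inl h
          · exact Or.inr ⟨⟨j, by omega, hj'⟩, h⟩
        · rintro (h | ⟨⟨j, hj, hj'⟩, h⟩)
          · exact Or.inr (Or.inl h)
          · rcases Nat.lt_or_eq_of_le (Nat.lt_succ_iff.1 hj) with h' | rfl
            · exact Or.inr (Or.inr ⟨⟨j, h', hj'⟩, h⟩)
            · exact Or.inl (hj'.symm.trans hy)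
  · refine ⟨by simp [Frame.refl], by simp, by simp, by simp, L₀, A₀, ?_, by simp⟩
    refine Buckets.congr (by simpa using hb) fun x hx => ?_
    rw [← hX', hoff x ((hA₀ x).1 hx).2]
  · rintro s τ ⟨hs, hF, -, hdone, htodo, L, A, hbA, hA⟩
    have h1 : τ.arr 1 = X' := by
      funext x
      by_cases hx : x ∈ S
      · obtain ⟨j, hj, rfl⟩ := hE.surj hx
        exact hdone j hj
      · rw [htodo x fun j hj h => hx (h ▸ hE.mem j hj), ← hX', hoff x hx]
    rw [hX', h1]
    refine ⟨by omega, hF, rfl, L, A, hbA, fun x => ?_⟩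
    rw [hA, hA₀]
    by_cases hx : x ∈ S
    · obtain ⟨j, hj, hj'⟩ := hE.surj hx
      have := ((hS x).1 hx).1
      constructor
      · rintro (h | h)
        · exact absurd hx h.2
        · exact ⟨this, h.2⟩
      · exact fun h => Or.inr ⟨⟨j, hj, hj'⟩, h.2⟩
    · have : X' x = σ.arr 1 x := by rw [← hX', hoff x hx]
      rw [this]
      constructor
      · rintro (h | ⟨⟨j, hj, hj'⟩, -⟩)
        · exact h.1
        · exact absurd (hj' ▸ hE.mem j hj) hx
      · exact fun h => Or.inl ⟨h, hx⟩

/-- The sum is positive, so some bucket is nonempty; no entry exceeds `2 ^ W`, so no level exceeds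
`W`. The lowest bit of the mask therefore exists and fits in the word. -/
theorem Buckets.exists_lowest {X nx hd : ℕ → ℕ} {mask : ℕ} {L : ℕ → List ℕ} {A : Finset ℕ}
    (hb : Buckets X nx hd mask L A) (hA : ∀ x, x ∈ A ↔ x < k ∧ X x ≠ 0)
    (hsum : ∑ x ∈ range k, X x = 2 ^ W) :
    mask < 2 ^ (W + 3) ∧ ∃ t ≤ W, AtLevel t mask ∧ mask &&& (2 ^ (W + 3) - mask) = 2 ^ t := by
  have hX : ∀ x < k, X x ≤ 2 ^ W := fun x hx => by
    rw [← hsum]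
    exact single_le_sum (f := X) (fun _ _ => Nat.zero_le _) (mem_range.2 hx)
  have hlt := hb.mask_lt (W := W) fun i hi => hX i ((hA i).1 hi).1
  have hlt' : mask < 2 ^ (W + 3) := hlt.trans (Nat.pow_lt_pow_right (by norm_num) (by omega))
  have hne : mask ≠ 0 := by
    rintro rfl
    have h0 : ∑ x ∈ range k, X x = 0 := sum_eq_zero fun x hx => by
      by_contra hc
      obtain ⟨t, ht⟩ := exists_atLevel hc
      have := (hb.bit t).2 (List.ne_nil_of_mem ((hb.mem t x).2 ⟨(hA x).2 ⟨mem_range.1 hx, hc⟩, ht⟩))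
      simp at this
    have : 0 < 2 ^ W := by positivity
    omega
  obtain ⟨t, ht⟩ := exists_atLevel hne
  refine ⟨hlt', t, ?_, ht, ht.land hlt'⟩
  have := (Nat.pow_lt_pow_iff_right (by norm_num : 1 < 2)).1 (ht.le.trans_lt hlt)
  omega

end Check
end TrafficSplit

/-! ### Correctness and running time of the complexity test. -/

namespace TrafficSplit
open Finset

section Check
variable {B : ℕ} {procs : List Stmt} {k W : ℕ}

/-- The time bound for the check with budget `rem` from level `t` on. -/
def checkTime (k W : ℕ) : ℕ × ℕ × Bool → ℕ
  | (rem, t, true) => 2100 * min (2 * rem) ((W - t) * k) + 10 * k + 20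
  | (_, _, false) => 1

/-- The invariant of the check. -/
def CheckInv (k W n : ℕ) (σ : Store) : ℕ × ℕ × Bool → Store → Prop
  | (rem, t, true), τ => Frame 7 60 [1, 2, 3, 4, 5, 6, 7] σ τ ∧ τ.reg 7 = 1 ∧ τ.reg 11 = rem ∧
      t ≤ W ∧ (∀ x < k, 2 ^ t ∣ τ.arr 1 x) ∧ ∑ x ∈ range k, τ.arr 1 x = 2 ^ W ∧
      (Decomp (fun i : Fin k => (σ.arr 1 i : ℤ)) (2 * n - 1) ↔
        Decomp (fun i : Fin k => (τ.arr 1 i : ℤ)) (2 * rem + 1)) ∧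
      τ.reg 12 = τ.reg 17 &&& (2 ^ (W + 3) - τ.reg 17) ∧
      ∃ L A, Buckets (τ.arr 1) (τ.arr 6) (τ.arr 7) (τ.reg 17) L A ∧
        ∀ x, x ∈ A ↔ x < k ∧ τ.arr 1 x ≠ 0
  | (_, _, false), τ => Frame 7 60 [1, 2, 3, 4, 5, 6, 7] σ τ ∧ τ.reg 7 = 0 ∧ τ.reg 12 = 2 ^ W ∧
      ¬ Decomp (fun i : Fin k => (σ.arr 1 i : ℤ)) (2 * n - 1)

/-- A round that handles a set `S` takes time linear in its size. It spends half that many moves, so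
`2 * rem` falls by the size of `S`, and `(W - t) * k` falls by at least `k`, which is no less. The
minimum of the two thus pays for the round. -/
theorem check_step (hp0 : procs[0]? = some selectProc) {σ τ : Store} {n rem t₀ : ℕ}
    (h3 : σ.reg 3 = 2 ^ (W + 3)) (hB : 1000 * (2 ^ W + k) ≤ B)
    (hinv : CheckInv k W n σ (rem, t₀, true) τ) (hne : τ.reg 12 ≠ 2 ^ W) :
    WP B procs (13 ≔ .log2 (.reg 12) ;; checkPop ;; 31 ≔ .bin .shr (.reg 30) 1 ;;
      .ite .lt (.reg 11) (.reg 31) (7 ≔ 0 ;; 12 ≔ .bin .shr (.reg 3) 3)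
        (11 ≔ .reg 11 - .reg 31 ;; choose ;; checkReinsert ;;
          12 ≔ .bin .and (.reg 17) (.reg 3 - .reg 17)))
      (fun s τ' => ∃ y, CheckInv k W n σ y τ' ∧
        s + 1 + checkTime k W y ≤ checkTime k W (rem, t₀, true)) τ := by
  have hM : 2 ^ (W + 3) / 8 = 2 ^ W := by rw [pow_add]; exact Nat.mul_div_cancel _ (by norm_num)
  have h2W : 0 < 2 ^ W := by positivity
  obtain ⟨hF, h7, h11, ht₀, hdiv, hsum, hdec, h12, L, A, hb, hA⟩ := hinv
  obtain ⟨hmask, t, htW', hmt, hland⟩ := hb.exists_lowest hA hsum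
  rw [hland] at h12
  have htW : t < W := lt_of_le_of_ne htW' fun h => hne (by rw [h12, h])
  obtain ⟨hLt, hlow⟩ := hb.lowest hmt
  have hdivt : ∀ x < k, 2 ^ t ∣ τ.arr 1 x := fun x hx => by
    by_cases h0 : τ.arr 1 x = 0
    · rw [h0]; exact dvd_zero _
    · exact hlow x ((hA x).2 ⟨hx, h0⟩) h0
  have ht : t₀ ≤ t := by
    obtain ⟨i, hi⟩ := List.exists_mem_of_ne_nil _ hLt
    obtain ⟨hi1, c, hi2⟩ := (hb.mem t i).1 hi
    have h := hdiv i ((hA i).1 hi1).1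
    rw [hi2] at h
    exact (Nat.pow_dvd_pow_iff_le_right (by norm_num : 1 < 2)).1
      ((Nat.Coprime.pow_left _ (by simp)).dvd_of_dvd_mul_right h)
  have hXW : ∀ x < k, τ.arr 1 x ≤ 2 ^ W := fun x hx => by
    rw [← hsum]
    exact single_le_sum (f := τ.arr 1) (fun _ _ => Nat.zero_le _) (mem_range.2 hx)
  obtain ⟨S, hSL⟩ : ∃ S, (L t).toFinset = S := ⟨_, rfl⟩
  have hS : ∀ x, x ∈ S ↔ x < k ∧ AtLevel t (τ.arr 1 x) := fun x => by
    rw [← hSL, List.mem_toFinset, hb.mem, hA]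
    refine ⟨fun h => ⟨h.1.1, h.2⟩, fun h => ⟨⟨h.1, fun h0 => ?_⟩, h.2⟩⟩
    have := h.2.le
    rw [h0] at this
    have : 0 < 2 ^ t := by positivity
    omega
  have hcard : S.card = (L t).length := by rw [← hSL, List.toFinset_card_of_nodup (hb.nodup t)]
  have hpos := List.length_pos_of_ne_nil hLt
  have hev := even_card_level hdivt hsum htW hS
  have hSk : S.card ≤ k := by
    rw [← card_range k]
    exact card_le_card fun x hx => mem_range.2 ((hS x).1 hx).1
  rw [wp_seq, wp_set]
  refine ⟨by simp, ?_⟩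
  rw [wp_seq]
  refine (checkPop_spec (k := k) (W := W) (t := t) (L := L) (A := A) (by simp [h12])
    (by simp [h12, Nat.log2_two_pow]) htW' hLt (by simpa using hb) (fun x hx => ((hA x).1 hx).1) hB).mono ?_
  rintro s₁ τ₁ ⟨hs₁, hF₁, h17, h30, hE, hA₁⟩
  have e1 := hF₁.arr 1 (by simp)
  have e6 := hF₁.arr 6 (by simp)
  have e7 := hF₁.arr 7 (by simp)
  have r7 := hF₁.reg 7 (by simp)
  have r11 := hF₁.reg 11 (by simp)
  have r12 := hF₁.reg 12 (by simp)
  simp only [arr_set] at e1 e6 e7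
  simp [h7, h11, h12] at r7 r11 r12 h17
  simp only [arr_set] at hA₁
  rw [hSL, ← hcard] at hE
  rw [← hcard] at h30 hA₁ hs₁
  have hF2 : Frame 7 60 [1, 2, 3, 4, 5, 6, 7] σ τ₁ := Frame.trans (by simpa using hF) hF₁ (by omega)
    (by omega) (by simp)
  have r3 := (hF2.reg 3 (by simp)).trans h3
  rw [wp_seq, wp_set]
  refine ⟨by simp; omega, ?_⟩
  rw [wp_ite]
  refine ⟨by simp, by simp, fun hc => ?_, fun hc => ?_⟩
  · replace hc : rem < S.card / 2 := by simpa [r11, h30] using hc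
    simp only [wp_seq, wp_set]
    refine ⟨by simp; omega, by simp; omega, (rem, t, false), ⟨by simpa using hF2, by simp, by simp [r3, hM], ?_⟩, ?_⟩
    · intro hD
      -- The size of `S` is even, so a half larger than `rem` means a size of at least `2 * rem +
      -- 2`, beyond the budget `2 * rem + 1`.
      have := card_level_le hdivt hS (hdec.1 hD)
      omega
    · simp only [checkTime]
      omega
  · replace hc : S.card / 2 ≤ rem := by simpa [r11, h30] using hc
    rw [wp_seq, wp_set]
    refine ⟨by simpa [r11, h30] using hc, ?_⟩
    rw [wp_seq]
    refine (choose_enumerates (w := W + 3) (c := S.card) (r := S.card / 2) (S := S)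
      (key := fun x => τ.arr 1 x / 2 ^ t) hp0 (by simpa using hE) (by simp [r3]) (by simp [h30])
      (by simp [h30]) (by omega) (by simpa using hA₁) ?_ (by omega)).mono ?_
    · intro x hx
      have h1 := hXW x ((hS x).1 hx).1
      have h2 := Nat.div_le_self (τ.arr 1 x) (2 ^ t)
      rw [pow_add]
      omega
    rintro s₂ τ₂ ⟨hs₂, hF₂, U, hU, hUc, hUf, htop⟩
    simp only [arr_set] at hUf
    have g1 := (hF₂.arr 1 (by simp)).trans e1
    have g4 := hF₂.arr 4 (by simp)
    have g6 := (hF₂.arr 6 (by simp)).trans e6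
    have g7 := (hF₂.arr 7 (by simp)).trans e7
    have q7 := hF₂.reg 7 (by simp)
    have q11 := hF₂.reg 11 (by simp)
    have q12 := hF₂.reg 12 (by simp)
    have q17 := hF₂.reg 17 (by simp)
    have q30 := hF₂.reg 30 (by simp)
    simp [r7, r11, r12, h17, h30] at q7 q11 q12 q17 q30 g4
    have hF3 : Frame 7 60 [1, 2, 3, 4, 5, 6, 7] σ τ₂ := Frame.trans (by simpa using hF2) hF₂
      (by omega) (by omega) (by simp)
    have hUS : 2 * U.card = S.card := by omega
    have hsum' := sum_matched hsum hS hU hUS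
    have hrm := hb.remove hLt
    rw [hSL] at hrm
    rw [wp_seq]
    refine (checkReinsert_spec (W := W) (k := k) (t := t) (c := S.card) (S := S) (U := U)
      (A₀ := A \ S) (L₀ := Function.update L t []) (by simp [hF3.reg, h3]) q12 q30 htW' (by rw [g4]; exact hE)
      (by rw [g1]; exact hS) hU (by rw [g4]; exact hUf) (by rw [g1, g6, g7, q17]; exact hrm)
      (fun x => by rw [g1, mem_sdiff, hA]) (by rw [g1]; exact hXW) ?_ hB).mono ?_
    · intro x hx
      rw [g1, ← hsum']
      exact single_le_sum (f := matched (τ.arr 1) t S U) (fun _ _ => Nat.zero_le _) (mem_range.2 hx)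
    rintro s₃ τ₃ ⟨hs₃, hF₃, m1, L', A', hb', hA'⟩
    have m7 := (hF₃.reg 7 (by simp)).trans q7
    have m11 := (hF₃.reg 11 (by simp)).trans q11
    have hF4 : Frame 7 60 [1, 2, 3, 4, 5, 6, 7] σ τ₃ := hF3.trans hF₃ (by omega) (by omega) (by simp)
    have m3 := (hF4.reg 3 (by simp)).trans h3
    rw [g1] at m1
    obtain ⟨hmask', -⟩ := hb'.exists_lowest hA' (by rw [m1]; exact hsum')
    rw [wp_set]
    refine ⟨by simp [m3]; omega, (rem - S.card / 2, t + 1, true), ⟨by simpa using hF4, by simp [m7],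
      by simp [m11], by omega, ?_, ?_, ?_, by simp [m3], L', A', by simpa using hb', hA'⟩, ?_⟩
    · intro x hx
      simp only [arr_set, m1]
      exact dvd_matched hdivt hS hU hx
    · simp only [arr_set, m1]
      exact hsum'
    · rw [hdec, decomp_matched hdivt hsum htW hS hU hUS]
      · simp only [arr_set, m1]
        have : (2 * ((rem - S.card / 2 : ℕ) : ℤ) + 1) = 2 * rem + 1 - S.card := by omega
        rw [this]
      · intro x hx y hy hyU
        have hkey : ∀ x < k, τ.arr 1 x / 2 ^ t < 2 ^ (W + 3) := fun x hx => by
          have h1 := hXW x hx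
          have h2 := Nat.div_le_self (τ.arr 1 x) (2 ^ t)
          rw [pow_add]
          omega
        exact lexLe_of_rev_le (hkey y ((hS y).1 hy).1) (hkey x ((hS x).1 (hU hx)).1) (htop x hx y hy hyU)
    · have h1 : (W - (t + 1)) * k + k ≤ (W - t₀) * k := by
        rw [← Nat.succ_mul]
        exact Nat.mul_le_mul_right _ (by omega)
      simp only [checkTime]
      omega

theorem check_spec (hp0 : procs[0]? = some selectProc) {σ : Store} {n : ℕ} (h0 : σ.reg 0 = k)
    (h2 : σ.reg 2 = n) (hn : 1 ≤ n) (h3 : σ.reg 3 = 2 ^ (W + 3))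
    (hsum : ∑ x ∈ range k, σ.arr 1 x = 2 ^ W) (hB : 1000 * (2 ^ W + k) ≤ B) :
    WP B procs check (fun s σ' => s ≤ 2100 * min (2 * n) (W * k) + 30 * k + 30 ∧
      Frame 7 60 [1, 2, 3, 4, 5, 6, 7] σ σ' ∧
      (σ'.reg 7 = 1 ∧ Decomp (fun i : Fin k => (σ.arr 1 i : ℤ)) (2 * n - 1) ∨
        σ'.reg 7 = 0 ∧ ¬ Decomp (fun i : Fin k => (σ.arr 1 i : ℤ)) (2 * n - 1))) σ := by
  have hM : 2 ^ (W + 3) / 8 = 2 ^ W := by rw [pow_add]; exact Nat.mul_div_cancel _ (by norm_num)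
  have h2W : 0 < 2 ^ W := by positivity
  have hXW : ∀ x < k, σ.arr 1 x ≤ 2 ^ W := fun x hx => by
    rw [← hsum]
    exact single_le_sum (f := σ.arr 1) (fun _ _ => Nat.zero_le _) (mem_range.2 hx)
  rw [check, wp_seq]
  refine (checkInit_spec (k := k) (W := W) h0 h3 hXW hB).mono ?_
  rintro s₁ τ ⟨hs₁, hF, L, A, hb, hA⟩
  obtain ⟨hmask, -⟩ := hb.exists_lowest hA hsum
  have e1 := hF.arr 1 (by simp)
  have e2 := (hF.reg 2 (by simp)).trans h2
  have e3 := (hF.reg 3 (by simp)).trans h3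
  have hF1 : Frame 7 60 [1, 2, 3, 4, 5, 6, 7] σ τ := Frame.trans (Frame.refl _ _ _ _) hF (by omega)
    (by omega) (by simp)
  simp only [wp_seq, wp_set]
  refine ⟨by simp [e2]; omega, by simp; omega, by simp [e3]; omega, ?_⟩
  refine (WP.loop (CheckInv k W n σ) (checkTime k W) ?_ ?_ (x := (n - 1, 0, true)) ?_).mono ?_
  · rintro ⟨rem, t, b⟩ τ' hinv
    refine ⟨by simp, by simp; omega, ?_⟩
    cases b <;> simp only [checkTime] <;> omega
  · rintro ⟨rem, t, b⟩ τ' hinv hc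
    cases b with
    | true =>
      have r3 := (hinv.1.reg 3 (by simp)).trans h3
      exact check_step hp0 h3 hB hinv (by simpa [r3, hM] using hc)
    | false =>
      have r3 := (hinv.1.reg 3 (by simp)).trans h3
      exact absurd hinv.2.2.1 (by simpa [r3, hM] using hc)
  · refine ⟨by simpa using hF1, by simp, by simp [e2], Nat.zero_le _, by simp, by simpa [e1] using hsum, ?_, by simp [e3],
      L, A, by simpa [e1] using hb, by simpa [e1] using hA⟩
    -- Register 11 counts the moves available; one of the `n` transactions is reserved for the
    -- dummy.
    have : (2 * ((n - 1 : ℕ) : ℤ) + 1) = 2 * n - 1 := by omega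
    simp [e1, this]
  · rintro s₂ τ' ⟨hs₂, ⟨rem, t, b⟩, hinv, hc⟩
    have hmin : min (2 * (n - 1)) ((W - 0) * k) ≤ min (2 * n) (W * k) :=
      min_le_min (by omega) (by simp)
    simp only [checkTime] at hs₂
    refine ⟨by omega, ?_⟩
    cases b with
    | false => exact ⟨hinv.1, Or.inr ⟨hinv.2.1, hinv.2.2.2⟩⟩
    | true =>
      obtain ⟨hF', h7, -, -, -, hsum', hdec, h12, L', A', hb', hA'⟩ := hinv
      have r3 := (hF'.reg 3 (by simp)).trans h3
      have h12' : τ'.reg 12 = 2 ^ W := by simpa [r3, hM] using hc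
      obtain ⟨-, t', ht', hmt, hland⟩ := hb'.exists_lowest hA' hsum'
      rw [h12', hland] at h12
      -- The lowest occupied level is `W`, so some entry is at least `2 ^ W` and holds the whole
      -- sum. The remaining budget is at least 1, enough for the dummy transaction.
      obtain rfl : W = t' := Nat.pow_right_injective le_rfl h12
      refine ⟨hF', Or.inl ⟨h7, hdec.2 ?_⟩⟩
      obtain ⟨i, hi⟩ := List.exists_mem_of_ne_nil _ (hb'.lowest hmt).1
      obtain ⟨hi1, hi2⟩ := (hb'.mem _ i).1 hi
      exact decomp_single hsum' ((hA' i).1 hi1).1 hi2.le (by omega)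

end Check
end TrafficSplit

/-! ### The two programs and the main theorem. -/

namespace TrafficSplit
open Finset

section Main
variable {B : ℕ} {procs : List Stmt} {k W : ℕ}

/-- The program for the bounded-error problem. -/
def errorMain : Stmt :=
  3 ≔ .bin .shl 1 (.reg 1 + 3) ;; 4 ≔ .reg 2 ;; round

theorem errorMain_spec (hp0 : procs[0]? = some selectProc) {σ : Store} {e : ℕ} (h0 : σ.reg 0 = k)
    (h1 : σ.reg 1 = W) (h2 : σ.reg 2 = e) (he : 0 < e) (hP : IsPartition W fun i : Fin k => σ.arr 0 i)
    (hB : 1000 * (2 ^ W + k) ≤ B) :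
    WP B procs errorMain (fun t σ' => t ≤ 2202 * k ∧ σ'.reg 0 = k ∧
      IsOptimalRounding W (fun i : Fin k => σ.arr 0 i) e fun i : Fin k => σ'.arr 1 i) σ := by
  have h2W : 0 < 2 ^ W := by positivity
  have hWlt : W < 2 ^ W := Nat.lt_two_pow_self
  have hk := hP.pos
  have h3 : 2 ^ (W + 3) = 2 ^ W * 8 := by rw [pow_add]; rfl
  simp only [errorMain, wp_seq, wp_set]
  refine ⟨by simp [h1]; omega, by simp, (round_spec (k := k) (W := W) (e := e) hp0 (by simp [h0])
    (by simp [h1]) (by simp [h2]) he (by simpa using hP) hB).mono ?_⟩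
  rintro t σ' ⟨ht, hF, hY⟩
  exact ⟨by omega, by simpa [h0] using hF.reg 0 (by simp), by simpa using hY⟩

/-- One step of the binary search for the least achievable error. -/
def searchStep : Stmt :=
  4 ≔ .bin .shr (.reg 5 + .reg 6) 1 ;; round ;; check ;;
    .ite .eq (.reg 7) 1 (6 ≔ .reg 4) (5 ≔ .reg 4)

/-- The program for the bounded-length problem. -/
def lengthMain : Stmt :=
  3 ≔ .bin .shl 1 (.reg 1 + 3) ;;
  .ite .eq (.reg 0) 1 (.put 1 0 (.arr 0 0))
    (5 ≔ 0 ;; 6 ≔ .bin .shr (.reg 3) 3 ;; .loop .lt (.reg 5 + 1) (.reg 6) searchStep ;;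
      4 ≔ .reg 6 ;; round)

/-- Some partition of complexity at most `n` has distance less than `e` from `P`. -/
def Achievable (W : ℕ) (P : Fin k → ℕ) (n e : ℕ) : Prop :=
  ∃ Q : Fin k → ℕ, IsPartition W Q ∧ linftyDist Q P < e ∧ Decomp (fun i => (Q i : ℤ)) (2 * n - 1)

/-- Because the rounding is optimal for every budget, testing this one partition decides whether the
error bound is achievable. -/
theorem IsOptimalRounding.decomp_iff {P Y : Fin k → ℕ} {e n : ℕ} (h : IsOptimalRounding W P e Y) :
    Decomp (fun i => (Y i : ℤ)) (2 * n - 1) ↔ Achievable W P n e :=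
  ⟨fun hd => ⟨Y, h.1, h.2.1, hd⟩, fun ⟨Q, h1, h2, h3⟩ => h.2.2 Q h1 h2 _ h3⟩

theorem IsPartition.achievable {P : Fin k → ℕ} (hP : IsPartition W P) {n : ℕ} (hn : 1 ≤ n) :
    Achievable W P n (2 ^ W) := by
  obtain ⟨j, hj⟩ : ∃ j, P j ≠ 0 := by
    by_contra! hc
    have : ∑ i, P i = 2 ^ W := hP
    rw [sum_eq_zero fun i _ => hc i] at this
    exact (pow_pos two_pos W).ne this
  have hY := isOptimalRounding_single hP le_rfl hj (Y := fun i => if i = j then 2 ^ W else 0)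
    fun _ => rfl
  refine hY.decomp_iff.1 ?_
  have hsum : ∑ x ∈ range k, (if x = (j : ℕ) then 2 ^ W else 0) = 2 ^ W := by simp
  refine (decomp_single (k := k) hsum j.2 (by simp) (by omega)).congr fun i => ?_
  simp [Fin.ext_iff]

/-- The invariant of the binary search. -/
def SearchInv (k W n : ℕ) (σ : Store) (i : ℕ) (τ : Store) : Prop :=
  Frame 4 60 [1, 2, 3, 4, 5, 6, 7] σ τ ∧ τ.reg 6 = τ.reg 5 + 2 ^ (W - i) ∧ τ.reg 6 ≤ 2 ^ W ∧
    ¬ Achievable W (fun i : Fin k => σ.arr 0 i) n (τ.reg 5) ∧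
    Achievable W (fun i : Fin k => σ.arr 0 i) n (τ.reg 6)

theorem searchStep_spec (hp0 : procs[0]? = some selectProc) {σ τ : Store} {n i : ℕ}
    (h0 : σ.reg 0 = k) (h2 : σ.reg 2 = n) (hn : 1 ≤ n) (h3 : σ.reg 3 = 2 ^ (W + 3))
    (hP : IsPartition W fun i : Fin k => σ.arr 0 i) (hB : 1000 * (2 ^ W + k) ≤ B) (hi : i < W)
    (hinv : SearchInv k W n σ i τ) :
    WP B procs searchStep (fun t τ' =>
      t ≤ 2230 * k + 2100 * min (2 * n) (W * k) + 40 ∧ SearchInv k W n σ (i + 1) τ') τ := by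
  obtain ⟨hF, h56, h6, hlo, hhi⟩ := hinv
  have h2W : 0 < 2 ^ W := by positivity
  have hpow : 2 ^ (W - i) = 2 ^ (W - (i + 1)) * 2 := by
    rw [← pow_succ]; congr 1; omega
  have hpos : 0 < 2 ^ (W - (i + 1)) := by positivity
  have f0 := (hF.reg 0 (by simp)).trans h0
  have f2 := (hF.reg 2 (by simp)).trans h2
  have f3 := (hF.reg 3 (by simp)).trans h3
  have fa := hF.arr 0 (by simp)
  have hmid : (τ.reg 5 + τ.reg 6) / 2 = τ.reg 5 + 2 ^ (W - (i + 1)) := by omega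
  simp only [searchStep, wp_seq, wp_set]
  refine ⟨by simp; omega, (round_spec (k := k) (W := W) (e := τ.reg 5 + 2 ^ (W - (i + 1))) hp0
    (by simp [f0]) (by simp [f3]) (by simp [hmid]) (by omega) (by simpa [fa] using hP) hB).mono ?_⟩
  rintro t₁ τ₁ ⟨ht₁, hF₁, hY⟩
  have g0 : τ₁.reg 0 = k := by simpa [f0] using hF₁.reg 0 (by simp)
  have g2 : τ₁.reg 2 = n := by simpa [f2] using hF₁.reg 2 (by simp)
  have g3 : τ₁.reg 3 = 2 ^ (W + 3) := by simpa [f3] using hF₁.reg 3 (by simp)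
  have g4 : τ₁.reg 4 = τ.reg 5 + 2 ^ (W - (i + 1)) := by simpa [hmid] using hF₁.reg 4 (by simp)
  have g5 : τ₁.reg 5 = τ.reg 5 := by simpa using hF₁.reg 5 (by simp)
  have g6 : τ₁.reg 6 = τ.reg 6 := by simpa using hF₁.reg 6 (by simp)
  replace hF : Frame 4 60 [1, 2, 3, 4, 5, 6, 7] σ τ₁ :=
    Frame.trans (by simpa using hF) hF₁ (by omega) (by omega) (by simp)
  simp only [arr_set, fa] at hY
  have hsum : ∑ x ∈ range k, τ₁.arr 1 x = 2 ^ W := by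
    rw [← Fin.sum_univ_eq_sum_range]
    exact hY.1
  refine (check_spec (k := k) (W := W) hp0 g0 g2 hn g3 hsum hB).mono ?_
  rintro t₂ τ₂ ⟨ht₂, hF₂, hdec⟩
  rw [hY.decomp_iff] at hdec
  have k4 := (hF₂.reg 4 (by simp)).trans g4
  have k5 := (hF₂.reg 5 (by simp)).trans g5
  have k6 := (hF₂.reg 6 (by simp)).trans g6
  replace hF := hF.trans hF₂ (by omega) (by omega) (by simp)
  rcases hdec with ⟨h7, hdec⟩ | ⟨h7, hdec⟩
  · simp [h7, SearchInv, hF, k4, k5, hlo, hdec]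
    omega
  · simp [h7, SearchInv, hF, k4, k6, hhi, hdec]
    omega

/-- Bisection keeps an unachievable bound in register 5 and an achievable one in register 6, at
distance `2 ^ (W - i)` after `i` steps. At the end they are adjacent: the rounding has distance
below the upper bound, and no competitor has distance below the lower one. -/
theorem lengthMain_spec (hp0 : procs[0]? = some selectProc) {σ : Store} {n : ℕ} (h0 : σ.reg 0 = k)
    (h1 : σ.reg 1 = W) (h2 : σ.reg 2 = n) (hn : 1 ≤ n) (hW : 1 ≤ W)
    (hP : IsPartition W fun i : Fin k => σ.arr 0 i) (hB : 1000 * (2 ^ W + k) ≤ B) :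
    WP B procs lengthMain (fun t σ' =>
      t ≤ (if k = 1 then 5 else 5000 * (W * (k + min (2 * n) (W * k)))) ∧ σ'.reg 0 = k ∧
      IsPartition W (fun i : Fin k => σ'.arr 1 i) ∧
      Decomp (fun i : Fin k => (σ'.arr 1 i : ℤ)) (2 * n - 1) ∧
      ∀ Q : Fin k → ℕ, IsPartition W Q → Decomp (fun i => (Q i : ℤ)) (2 * n - 1) →
        linftyDist (fun i : Fin k => σ'.arr 1 i) (fun i : Fin k => σ.arr 0 i) ≤
          linftyDist Q fun i : Fin k => σ.arr 0 i) σ := by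
  have h2W : 0 < 2 ^ W := by positivity
  have hWlt : W < 2 ^ W := Nat.lt_two_pow_self
  have hk := hP.pos
  have h3 : 2 ^ (W + 3) = 2 ^ W * 8 := by rw [pow_add]; rfl
  simp only [lengthMain, wp_seq, wp_set]
  refine ⟨by simp [h1]; omega, ?_⟩
  rw [wp_ite]
  refine ⟨by simp, by simp; omega, fun hc => ?_, fun hc => ?_⟩
  -- There is only one partition. This case is separate because `logb 2 1 = 0` leaves no room in the
  -- claimed time for running the test.
  · obtain rfl : k = 1 := by simpa [h0] using hc
    have hP0 : σ.arr 0 0 = 2 ^ W := by simpa [IsPartition] using hP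
    have hdec : Decomp (fun i : Fin 1 => (σ.arr 0 i : ℤ)) (2 * n - 1) :=
      decomp_single (W := W) (by simpa using hP0) (i := 0) one_pos hP0.ge (by omega)
    rw [wp_put]
    refine ⟨by simp; omega, by simp; omega, by simp; omega, by simp, by simpa using h0, ?_, ?_, ?_⟩
    · simpa [IsPartition] using hP
    · refine hdec.congr fun i => ?_
      simp [Fin.fin_one_eq_zero i]
    · intro Q _ _
      simp [linftyDist]
  · have hk1 : k ≠ 1 := by simpa [h0] using hc
    have hM : 2 ^ (W + 3) / 8 = 2 ^ W := by omega
    simp only [wp_seq, wp_set]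
    refine ⟨by simp; omega, by simp; omega, ?_⟩
    set τ := ((σ.set 3 (Expr.val σ (.bin .shl 1 (.reg 1 + 3)))).set 5 (Expr.val
      (σ.set 3 (Expr.val σ (.bin .shl 1 (.reg 1 + 3)))) 0)) with hτ
    have t0 : τ.reg 0 = k := by simp [hτ, h0]
    have t2 : τ.reg 2 = n := by simp [hτ, h2]
    have t3 : τ.reg 3 = 2 ^ (W + 3) := by simp [hτ, h1]
    have t5 : τ.reg 5 = 0 := by simp [hτ]
    have ta : τ.arr 0 = σ.arr 0 := by simp [hτ]
    rw [← ta] at hP ⊢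
    refine (WP.forLoop (SearchInv k W n τ) W (2230 * k + 2100 * min (2 * n) (W * k) + 40) ?_
      (fun i τ' hi hinv => searchStep_spec hp0 t0 t2 hn t3 hP hB hi hinv) ?_).mono ?_
    · rintro i τ' hi ⟨-, h56, h6, -, -⟩
      have hpos : 0 < 2 ^ (W - i) := by positivity
      refine ⟨by simp; omega, by simp, ?_⟩
      simp only [holds_lt, val_add, val_reg, val_lit, h56]
      constructor
      · intro h
        by_contra hc
        rw [show W - i = 0 by omega] at h
        simp at h
      · intro h
        have := Nat.one_lt_two_pow (show W - i ≠ 0 by omega)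
        omega
    -- No distance is below `0`, while below `2 ^ W` all weight may go to one nonzero part, at
    -- complexity 1.
    · refine ⟨by simp [Frame.refl], by simp [t3, t5, hM], by simp [t3, hM], ?_, ?_⟩
      · rintro ⟨Q, -, h, -⟩
        simp [t5] at h
      · simpa [t3, hM] using hP.achievable hn
    · rintro t₁ τ₁ ⟨ht₁, hF, h56, h6, hlo, hhi⟩
      have f0 := (hF.reg 0 (by simp)).trans t0
      have f3 := (hF.reg 3 (by simp)).trans t3
      have fa := hF.arr 0 (by simp)
      simp only [Nat.sub_self, pow_zero] at h56
      refine ⟨by simp, (round_spec (k := k) (W := W) (e := τ₁.reg 6) hp0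
        (by simp [f0]) (by simp [f3]) (by simp) (by omega) (by simpa [fa] using hP) hB).mono ?_⟩
      rintro t₂ τ₂ ⟨ht₂, hF₂, hY⟩
      simp only [arr_set, fa] at hY
      refine ⟨?_, by simpa [f0] using hF₂.reg 0 (by simp), hY.1, hY.decomp_iff.2 hhi,
        fun Q hQ hd => ?_⟩
      · rw [if_neg hk1]
        generalize min (2 * n) (W * k) = m at ht₁ ⊢
        nlinarith [Nat.mul_le_mul hW hk, Nat.mul_le_mul_right k hW]
      · have h4 : linftyDist (fun i : Fin k => τ₂.arr 1 i) (fun i : Fin k => τ.arr 0 i) <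
          τ₁.reg 6 := hY.2.1
        have h5 : ¬ linftyDist Q (fun i : Fin k => τ.arr 0 i) < τ₁.reg 5 :=
          fun h => hlo ⟨Q, hQ, h, hd⟩
        omega

end Main

theorem exists_boundedError_program :
    ∃ (prog : Program) (c C : ℕ), ∀ (b k W : ℕ) (P : Fin k → ℕ) (e : ℝ),
      IsPartition W P → 0 < e → c * (2 ^ W + k) ≤ 2 ^ b → ⌈e⌉₊ < 2 ^ b →
      ∃ (t : ℕ) (P' : Fin k → ℕ), prog.Outputs b k W ⌈e⌉₊ P t P' ∧ SolvesBoundedError W P e P' ∧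
        t ≤ C * k := by
  refine ⟨toProgram [selectProc] errorMain, 1000,
    20 + (errorMain.size + selectProc.size + 1) * 2202, fun b k W P e hP he hB heB => ?_⟩
  have h2W : 0 < 2 ^ W := by positivity
  have hWlt : W < 2 ^ W := Nat.lt_two_pow_self
  have hPle : ∀ i, P i ≤ 2 ^ W := fun i => by
    rw [← show ∑ i, P i = 2 ^ W from hP]
    exact single_le_sum (fun _ _ => Nat.zero_le _) (mem_univ i)
  obtain ⟨t, P', hout, hQ, ht⟩ := toProgram_outputs (procs := [selectProc]) (s := errorMain)
    (K := errorMain.size + selectProc.size + 1) (T := 2202 * k) (P := P) (a := ⌈e⌉₊) (W := W)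
    (b := b) (Q := IsOptimalRounding W P ⌈e⌉₊) (by
      intro s hs
      obtain rfl : s = selectProc := by simpa using hs
      exact ⟨by decide, by omega⟩) (by decide) (by omega) (by omega) (by omega) (by omega) heB
    (fun i => by have := hPle i; omega) hP.pos fun σ h0 h1 h2 ha => by
      have hfun : (fun i : Fin k => σ.arr 0 i) = P := funext ha
      have := errorMain_spec (B := 2 ^ b) (procs := [selectProc]) (k := k) (W := W) rfl h0 h1 h2
        (Nat.ceil_pos.2 he) (by rwa [hfun]) hB
      rwa [hfun] at this
  refine ⟨t, P', hout, ⟨⟨hQ.1, Nat.lt_ceil.1 hQ.2.1⟩, fun R hR => ?_⟩, by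
    calc t ≤ _ := ht
      _ = _ := by ring⟩
  -- The optimal rounding inherits every decomposition of a competitor `R`, in particular the one
  -- given by the complexity of `R`.
  exact (complexity_le_iff hQ.1).2
    (hQ.2.2 R hR.1 (Nat.lt_ceil.2 hR.2) _ ((complexity_le_iff hR.1).1 le_rfl))

/-- From two parts on the logarithm is at least 1, so `n` is dominated by `n * logb 2 k`; and `k ≤ W
* k` since `W` is positive. -/
theorem search_time_le {k W n : ℕ} (hk : 2 ≤ k) (hW : 1 ≤ W) :
    ((k + min (2 * n) (W * k) : ℕ) : ℝ) ≤ 2 * min ((W : ℝ) * k) (k + n * Real.logb 2 k) := by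
  have hlog : 1 ≤ Real.logb 2 k := by
    rw [Real.le_logb_iff_rpow_le one_lt_two (by positivity)]
    simpa using (by exact_mod_cast hk : (2 : ℝ) ≤ k)
  have hn : (n : ℝ) ≤ n * Real.logb 2 k := le_mul_of_one_le_right (by positivity) hlog
  have hkW : (k : ℝ) ≤ W * k := le_mul_of_one_le_left (by positivity) (by exact_mod_cast hW)
  have h1 : ((min (2 * n) (W * k) : ℕ) : ℝ) ≤ 2 * n := by exact_mod_cast min_le_left _ _
  have h2 : ((min (2 * n) (W * k) : ℕ) : ℝ) ≤ W * k := by exact_mod_cast min_le_right _ _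
  rw [Nat.cast_add, mul_min_of_nonneg _ _ zero_le_two]
  refine le_min (by linarith) ?_
  have : (0 : ℝ) ≤ k := by positivity
  linarith

theorem exists_boundedLength_program :
    ∃ (prog : Program) (c C : ℕ), ∀ (b k W : ℕ) (P : Fin k → ℕ) (n : ℕ),
      IsPartition W P → 1 ≤ W → 1 ≤ n → c * (2 ^ W + k) ≤ 2 ^ b → n < 2 ^ b →
      ∃ (t : ℕ) (P' : Fin k → ℕ), prog.Outputs b k W n P t P' ∧ SolvesBoundedLength W P n P' ∧
        (t : ℝ) ≤ C * (W * min ((W : ℝ) * k) (k + n * Real.logb 2 k)) := by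
  set K := lengthMain.size + selectProc.size + 1 with hK
  refine ⟨toProgram [selectProc] lengthMain, 1000, 20 + K * 10000,
    fun b k W P n hP hW hn hB hnB => ?_⟩
  have h2W : 0 < 2 ^ W := by positivity
  have hWlt : W < 2 ^ W := Nat.lt_two_pow_self
  have hPle : ∀ i, P i ≤ 2 ^ W := fun i => by
    rw [← show ∑ i, P i = 2 ^ W from hP]
    exact single_le_sum (fun _ _ => Nat.zero_le _) (mem_univ i)
  obtain ⟨t, P', hout, ⟨hP', hd, hmin⟩, ht⟩ := toProgram_outputs (procs := [selectProc])
    (s := lengthMain) (K := K)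
    (T := if k = 1 then 5 else 5000 * (W * (k + min (2 * n) (W * k)))) (P := P) (a := n) (W := W)
    (b := b) (Q := fun Y => IsPartition W Y ∧ Decomp (fun i => (Y i : ℤ)) (2 * n - 1) ∧
      ∀ Q : Fin k → ℕ, IsPartition W Q → Decomp (fun i => (Q i : ℤ)) (2 * n - 1) →
        linftyDist Y P ≤ linftyDist Q P) (by
      intro s hs
      obtain rfl : s = selectProc := by simpa using hs
      exact ⟨by decide, by omega⟩) (by decide) (by omega) (by omega) (by omega) (by omega) hnB
    (fun i => by have := hPle i; omega) hP.pos fun σ h0 h1 h2 ha => by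
      have hfun : (fun i : Fin k => σ.arr 0 i) = P := funext ha
      have := lengthMain_spec (B := 2 ^ b) (procs := [selectProc]) (k := k) (W := W) rfl h0 h1 h2
        hn hW (by rwa [hfun]) hB
      rwa [hfun] at this
  refine ⟨t, P', hout, ⟨⟨hP', (complexity_le_iff hP').2 hd⟩,
    fun R hR => hmin R hR.1 ((complexity_le_iff hR.1).1 hR.2)⟩, ?_⟩
  have ht' : (t : ℝ) ≤ ((20 * k + K * if k = 1 then 5 else
    5000 * (W * (k + min (2 * n) (W * k))) : ℕ) : ℝ) := by exact_mod_cast ht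
  refine ht'.trans ?_
  have hW' : (1 : ℝ) ≤ W := by exact_mod_cast hW
  have hK0 : (0 : ℝ) ≤ K := by positivity
  have hk := hP.pos
  push_cast
  rcases (show k = 1 ∨ 2 ≤ k by omega) with rfl | hk2
  -- For a single part the minimum is `1`, and the constant time of the direct answer fits into a
  -- multiple of `W`.
  · simp only [if_true, Nat.cast_one, Real.logb_one, mul_zero, add_zero, mul_one, min_eq_right hW']
    nlinarith
  · have h1 := search_time_le (n := n) hk2 hW
    set M := min ((W : ℝ) * k) (k + n * Real.logb 2 k) with hM
    rw [if_neg (by omega)]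
    push_cast at h1
    have hm : (0 : ℝ) ≤ min (2 * n : ℝ) (W * k) := by positivity
    have hlog : 0 ≤ Real.logb 2 k := Real.logb_nonneg one_lt_two (by exact_mod_cast hk)
    have hkM : (k : ℝ) ≤ M := le_min (le_mul_of_one_le_left (by positivity) hW')
      (le_add_of_nonneg_right (by positivity))
    have hM0 : 0 ≤ M := le_trans (by positivity) hkM
    have h2 : (W : ℝ) * (k + min (2 * n : ℝ) (W * k)) ≤ W * (2 * M) :=
      mul_le_mul_of_nonneg_left h1 (by positivity)
    have h3 : M ≤ W * M := le_mul_of_one_le_left hM0 hW'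
    have h4 := mul_le_mul_of_nonneg_left h2 hK0
    linarith

end TrafficSplit

theorem mainTheorem7 :
    (∃ (prog : TrafficSplit.Program) (c C : ℕ),
      ∀ (b k W : ℕ) (P : Fin k → ℕ) (e : ℝ),
        TrafficSplit.IsPartition W P → 0 < e →
        c * (2 ^ W + k) ≤ 2 ^ b → ⌈e⌉₊ < 2 ^ b →
        ∃ (t : ℕ) (P' : Fin k → ℕ),
          prog.Outputs b k W ⌈e⌉₊ P t P' ∧
          TrafficSplit.SolvesBoundedError W P e P' ∧
          t ≤ C * k) ∧
    (∃ (prog : TrafficSplit.Program) (c C : ℕ),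
      ∀ (b k W : ℕ) (P : Fin k → ℕ) (n : ℕ),
        TrafficSplit.IsPartition W P → 1 ≤ W → 1 ≤ n →
        c * (2 ^ W + k) ≤ 2 ^ b → n < 2 ^ b →
        ∃ (t : ℕ) (P' : Fin k → ℕ),
          prog.Outputs b k W n P t P' ∧
          TrafficSplit.SolvesBoundedLength W P n P' ∧
          (t : ℝ) ≤ C * (W * min ((W : ℝ) * k) (k + n * Real.logb 2 k))) :=
  ⟨TrafficSplit.exists_boundedError_program, TrafficSplit.exists_boundedLength_program⟩
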